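/- For integers $n\ge k\ge 0$ and $\ell\ge 0$ and a graph $G$ on $n$ vertices, let $N_G(k,\ell)$ be the number of sets of $k$ vertices of $G$ that induce exactly $\ell$ edges, and define the edge-inducibility $$\operatorname{ind}(k,\ell)=\lim_{n\to\infty}\ \max_{G}\ \frac{N_G(k,\ell)}{\binom nk},$$ where the maximum is over all graphs $G$ on $n$ vertices. There is an absolute constant $C>0$ such that for all integers $k,\ell$ with $k\ge 0$ and $0<\ell<\binom k2$, the limit defining $\operatorname{ind}(k,\ell)$ exists and $$\operatorname{ind}(k,\ell)\le \frac{C}{\sqrt{\min\left(\ell,\binom k2-\ell\right)/k}}.$$ -/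

import Mathlib

open Filter Topology

/-- The number of sets of `k` vertices of `G` that induce exactly `ℓ` edges. -/
noncomputable def inducedCount {V : Type*} [Fintype V] (G : SimpleGraph V) (k ℓ : ℕ) : ℕ :=
  ((Finset.powersetCard k (Finset.univ : Finset V)).filter
    (fun s : Finset V => (G.induce (s : Set V)).edgeSet.ncard = ℓ)).card

/-- The maximum, over all graphs `G` on `n` vertices, of the fraction of `k`-vertex sets
of `G` inducing exactly `ℓ` edges. The supremum runs over a finite nonempty type, so it is
attained. For `n < k` the value is `0`. -/
noncomputable def maxInducedDensity (k ℓ n : ℕ) : ℝ :=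
  ⨆ G : SimpleGraph (Fin n), (inducedCount G k ℓ : ℝ) / (n.choose k : ℝ)

/-- The edge-inducibility: the limit of `maxInducedDensity k ℓ n` as `n → ∞`. -/
noncomputable def edgeInducibility (k ℓ : ℕ) : ℝ :=
  limUnder atTop (fun n : ℕ => maxInducedDensity k ℓ n)

/-! Sampling the k vertices independently and uniformly costs only a factor 2 when n ≥ 2k², so it
suffices to bound the probability that a random k-tuple spans ℓ edges. Draw two candidate vertices
for each index and let a fair coin choose between them. Given the candidates, the edge count is a
quadratic polynomial in independent signs, and its mixed coefficient at i, j is, up to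
normalization, the alternating sum of the adjacency kernel around the four-cycle formed by the two
candidate pairs. If these sums are nonzero often enough, a quadratic Littlewood–Offord theorem
applies (`anticoncentrationBound`, `uniformProb_pairSum_eq_le`). If not, the kernel is nearly a
constant 0 or 1 (`exists_nearly_constant`); after complementing if necessary, ℓ edges force at least
twice as many exceptional pairs as are allowed for, and Chebyshev's inequality suffices. The limit
exists because averaging over vertex deletions makes the maximal density nonincreasing from n = k
on.

The core is the bound O(1/√n) for the point probabilities of a quadratic Y having n directions whose
slopes (discrete derivatives) each involve at least n signs. The slopes are affine forms L_i with
coefficients in {-2, ..., 2}. If, on an event where Y is constant, the slopes along a set T of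
directions keep prescribed signs, then after reflecting coordinates the event is an antichain in the
cube on T, and Sperner's theorem gives O(1/√|T|). Signs are never quite fixed, so
`card_le_of_small_weights` tolerates comparable pairs that are exceptional for one of their two
members: a random maximal chain then still meets the family at most twice on average.

The theorem is proved by strong induction on n. Let z be the relative distance at which pairs of
nearly proportional rows stop being rare. If z < 1/8, many rows are close to multiples of one row
L_s. When |L_s| is large compared with the errors, all these slopes have the sign of a multiple of
L_s, and Sperner applies (`IsQuadraticOn.cubeProb_eq_and_le_slope_le`). When |L_s| is small, an
event of probability O(z + 1/√n), a random set P of coordinates of density about z² is exposed last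
(`IsQuadraticOn.cubeProb_eq_and_slope_lt_le`): the parts of the slopes off P are typically large
enough to fix the signs, which gives O(1/(z√n)) conditionally, so the factors z cancel; if z is
itself O(1/√n), the smallness of L_s is enough. If z ≥ 1/8, the same exposure works with no
condition on L_s. Exceptional events depend only on the coordinates in, or only on those outside,
some set; the induction hypothesis is applied to the remaining coordinates, and their probabilities
are small enough that the total is a fraction of the target bound. -/

set_option linter.unusedSectionVars false

/-! ### Uniform measure on the discrete cube, moments of linear forms, conditioning on coordinates.
-/

section Cube

variable {ι : Type} [Fintype ι]

/-- Mean of a function over the discrete cube, whose points are the subsets of `ι`. -/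
noncomputable def cubeMean (f : Finset ι → ℝ) : ℝ :=
  (∑ A : Finset ι, f A) / 2 ^ Fintype.card ι

open scoped Classical in
/-- Probability of an event under the uniform measure on the discrete cube. -/
noncomputable def cubeProb (p : Finset ι → Prop) : ℝ :=
  cubeMean fun A => if p A then 1 else 0

open scoped Classical in
/-- The sign of the coordinate `u` at the point `A` of the cube. -/
noncomputable def spin (A : Finset ι) (u : ι) : ℝ := if u ∈ A then 1 else -1

theorem cubeMean_const (c : ℝ) : cubeMean (fun _ : Finset ι => c) = c := by
  simp [cubeMean]

theorem cubeMean_add (f g : Finset ι → ℝ) :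
    cubeMean (fun A => f A + g A) = cubeMean f + cubeMean g := by
  simp [cubeMean, Finset.sum_add_distrib, add_div]

theorem cubeMean_const_mul (c : ℝ) (f : Finset ι → ℝ) :
    cubeMean (fun A => c * f A) = c * cubeMean f := by
  simp [cubeMean, ← Finset.mul_sum, mul_div_assoc]

theorem cubeMean_sum {κ : Type*} (s : Finset κ) (f : κ → Finset ι → ℝ) :
    cubeMean (fun A => ∑ k ∈ s, f k A) = ∑ k ∈ s, cubeMean (f k) := by
  simp only [cubeMean]
  rw [Finset.sum_comm, Finset.sum_div]

theorem cubeMean_mono {f g : Finset ι → ℝ} (h : ∀ A, f A ≤ g A) : cubeMean f ≤ cubeMean g := by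
  unfold cubeMean
  gcongr
  exact h _

theorem cubeMean_nonneg {f : Finset ι → ℝ} (h : ∀ A, 0 ≤ f A) : 0 ≤ cubeMean f :=
  div_nonneg (Finset.sum_nonneg fun A _ => h A) (by positivity)

theorem cubeMean_comm (f : Finset ι → Finset ι → ℝ) :
    cubeMean (fun A => cubeMean fun B => f A B) = cubeMean fun B => cubeMean fun A => f A B := by
  simp only [cubeMean, ← Finset.sum_div]
  rw [Finset.sum_comm]

theorem cubeProb_nonneg (p : Finset ι → Prop) : 0 ≤ cubeProb p :=
  cubeMean_nonneg fun A => by split_ifs <;> norm_num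

theorem cubeProb_mono {p q : Finset ι → Prop} (h : ∀ A, p A → q A) : cubeProb p ≤ cubeProb q :=
  cubeMean_mono fun A => by
    by_cases hp : p A
    · simp [hp, h A hp]
    · simp only [hp, if_false]
      split_ifs <;> norm_num

theorem cubeProb_le_one (p : Finset ι → Prop) : cubeProb p ≤ 1 := by
  rw [← cubeMean_const (ι := ι) 1]
  exact cubeMean_mono fun A => by split_ifs <;> norm_num

theorem cubeProb_or_le (p q : Finset ι → Prop) :
    cubeProb (fun A => p A ∨ q A) ≤ cubeProb p + cubeProb q := by
  unfold cubeProb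
  rw [← cubeMean_add]
  refine cubeMean_mono fun A => ?_
  by_cases hp : p A <;> by_cases hq : q A <;> simp [hp, hq]

theorem cubeProb_le_add {p q r : Finset ι → Prop} (h : ∀ A, p A → q A ∨ r A) :
    cubeProb p ≤ cubeProb q + cubeProb r :=
  (cubeProb_mono h).trans (cubeProb_or_le q r)

theorem cubeProb_eq_zero {p : Finset ι → Prop} (h : ∀ A, ¬ p A) : cubeProb p = 0 := by
  simp [cubeProb, h, cubeMean_const]

theorem cubeProb_le_cubeMean_div {f : Finset ι → ℝ} (hf : ∀ A, 0 ≤ f A) {t : ℝ} (ht : 0 < t)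
    {p : Finset ι → Prop} (hp : ∀ A, p A → t ≤ f A) : cubeProb p ≤ cubeMean f / t := by
  rw [div_eq_inv_mul, ← cubeMean_const_mul]
  refine cubeMean_mono fun A => ?_
  by_cases h : p A
  · simp only [h, if_true]
    rw [← div_eq_inv_mul, one_le_div ht]
    exact hp A h
  · simp only [h, if_false]
    exact mul_nonneg (inv_nonneg.2 ht.le) (hf A)

theorem spin_sq (A : Finset ι) (u : ι) : spin A u * spin A u = 1 := by
  unfold spin; split_ifs <;> norm_num

theorem abs_spin (A : Finset ι) (u : ι) : |spin A u| = 1 := by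
  unfold spin; split_ifs <;> norm_num

variable [DecidableEq ι]

theorem cubeMean_symmDiff (f : Finset ι → ℝ) (s : Finset ι) :
    cubeMean (fun A => f (symmDiff A s)) = cubeMean f := by
  unfold cubeMean
  congr 1
  exact Fintype.sum_equiv (Equiv.ofBijective (fun A => symmDiff A s)
    (Function.Involutive.bijective fun A => by simp)) _ _ fun A => rfl

theorem cubeProb_symmDiff (p : Finset ι → Prop) (s : Finset ι) :
    cubeProb (fun A => p (symmDiff A s)) = cubeProb p := by
  classical
  exact cubeMean_symmDiff (fun A => if p A then 1 else 0) s

theorem spin_symmDiff_of_mem {s : Finset ι} {u : ι} (h : u ∈ s) (A : Finset ι) :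
    spin (symmDiff A s) u = - spin A u := by
  by_cases hA : u ∈ A <;> simp [spin, Finset.mem_symmDiff, h, hA]

theorem spin_symmDiff_of_notMem {s : Finset ι} {u : ι} (h : u ∉ s) (A : Finset ι) :
    spin (symmDiff A s) u = spin A u := by
  by_cases hA : u ∈ A <;> simp [spin, Finset.mem_symmDiff, h, hA]

theorem cubeMean_spin (u : ι) : cubeMean (fun A => spin A u) = 0 := by
  have h := cubeMean_symmDiff (fun A => spin A u) {u}
  simp only [spin_symmDiff_of_mem (Finset.mem_singleton_self u)] at h
  have h2 := cubeMean_const_mul (-1) (fun A : Finset ι => spin A u)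
  simp only [neg_mul, one_mul] at h2
  linarith

theorem cubeMean_spin_mul_spin (u v : ι) :
    cubeMean (fun A => spin A u * spin A v) = if u = v then 1 else 0 := by
  split_ifs with huv
  · subst huv
    simp [spin_sq, cubeMean_const]
  · have h := cubeMean_symmDiff (fun A => spin A u * spin A v) {u}
    simp only [spin_symmDiff_of_mem (Finset.mem_singleton_self u),
      spin_symmDiff_of_notMem (s := {u}) (u := v) (by simpa using Ne.symm huv)] at h
    have h2 := cubeMean_const_mul (-1) (fun A : Finset ι => spin A u * spin A v)
    simp only [neg_mul, one_mul] at h h2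
    linarith

theorem cubeMean_linear_sq (s : Finset ι) (β : ℝ) (c : ι → ℝ) :
    cubeMean (fun A => (β + ∑ u ∈ s, c u * spin A u) ^ 2) = β ^ 2 + ∑ u ∈ s, c u ^ 2 := by
  have h1 : ∀ A : Finset ι, (β + ∑ u ∈ s, c u * spin A u) ^ 2 = β ^ 2 +
      ((∑ u ∈ s, (2 * β * c u) * spin A u) +
        ∑ u ∈ s, ∑ v ∈ s, (c u * c v) * (spin A u * spin A v)) := by
    intro A
    have : (∑ u ∈ s, c u * spin A u) ^ 2
        = ∑ u ∈ s, ∑ v ∈ s, (c u * c v) * (spin A u * spin A v) := by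
      rw [sq, Finset.sum_mul_sum]
      exact Finset.sum_congr rfl fun u _ => Finset.sum_congr rfl fun v _ => by ring
    rw [← this, add_sq, Finset.mul_sum]
    simp only [mul_assoc]
    ring
  simp only [h1, cubeMean_add, cubeMean_sum, cubeMean_const_mul, cubeMean_spin,
    cubeMean_spin_mul_spin, cubeMean_const, mul_zero, Finset.sum_const_zero, zero_add]
  congr 1
  refine Finset.sum_congr rfl fun u hu => ?_
  simp [hu, sq]

theorem cubeMean_prod_ite (f g : ι → ℝ) :
    cubeMean (fun A => (∏ u ∈ A, f u) * ∏ u ∈ Finset.univ \ A, g u) = ∏ u, (f u + g u) / 2 := by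
  unfold cubeMean
  rw [Finset.prod_div_distrib, Finset.prod_add, Finset.prod_const, Finset.powerset_univ]
  rfl

/-- The mean factors over coordinates into a product of cosh (c u), and cosh x ≤ exp (x² / 2). -/
theorem cubeMean_exp_linear_le (s : Finset ι) (c : ι → ℝ) :
    cubeMean (fun A => Real.exp (∑ u ∈ s, c u * spin A u)) ≤
      Real.exp ((∑ u ∈ s, c u ^ 2) / 2) := by
  set c' : ι → ℝ := fun u => if u ∈ s then c u else 0 with hc'
  have h1 : ∀ A : Finset ι, ∑ u ∈ s, c u * spin A u = ∑ u, c' u * spin A u := by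
    intro A
    simp [hc', Finset.sum_ite_mem]
  have h2 : ∑ u ∈ s, c u ^ 2 = ∑ u, c' u ^ 2 := by
    simp [hc', Finset.sum_ite_mem]
  have h3 : ∀ A : Finset ι, Real.exp (∑ u, c' u * spin A u) =
      (∏ u ∈ A, Real.exp (c' u)) * ∏ u ∈ Finset.univ \ A, Real.exp (-c' u) := by
    intro A
    rw [Real.exp_sum, ← Finset.prod_sdiff (Finset.subset_univ A), mul_comm]
    congr 1
    · exact Finset.prod_congr rfl fun u hu => by simp [spin, hu]
    · exact Finset.prod_congr rfl fun u hu => by simp [spin, (Finset.mem_sdiff.1 hu).2]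
  simp only [h1, h2, h3]
  rw [cubeMean_prod_ite, Finset.sum_div, Real.exp_sum]
  refine Finset.prod_le_prod (fun u _ => by positivity) fun u _ => ?_
  rw [← Real.cosh_eq]
  exact Real.cosh_le_exp_half_sq _

theorem cubeMean_exp_abs_linear_le (s : Finset ι) (β t : ℝ) (ht : 0 ≤ t) (c : ι → ℝ) :
    cubeMean (fun A => Real.exp (t * |β + ∑ u ∈ s, c u * spin A u|)) ≤
      2 * Real.exp (t * |β| + t ^ 2 * (∑ u ∈ s, c u ^ 2) / 2) := by
  have key : ∀ A : Finset ι, Real.exp (t * |β + ∑ u ∈ s, c u * spin A u|) ≤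
      Real.exp (t * |β|) * Real.exp (∑ u ∈ s, (t * c u) * spin A u) +
      Real.exp (t * |β|) * Real.exp (∑ u ∈ s, (-(t * c u)) * spin A u) := by
    intro A
    have e1 : ∑ u ∈ s, (t * c u) * spin A u = t * ∑ u ∈ s, c u * spin A u := by
      rw [Finset.mul_sum]; exact Finset.sum_congr rfl fun _ _ => by ring
    have e2 : ∑ u ∈ s, (-(t * c u)) * spin A u = -(t * ∑ u ∈ s, c u * spin A u) := by
      rw [← e1, ← Finset.sum_neg_distrib]; exact Finset.sum_congr rfl fun _ _ => by ring
    rw [e1, e2, ← Real.exp_add, ← Real.exp_add]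
    set S := ∑ u ∈ s, c u * spin A u
    rcases abs_cases (β + S) with ⟨h, _⟩ | ⟨h, _⟩
    · rw [h]
      have : Real.exp (t * (β + S)) ≤ Real.exp (t * |β| + t * S) := by
        apply Real.exp_le_exp.2
        nlinarith [le_abs_self β]
      linarith [Real.exp_pos (t * |β| + -(t * S))]
    · rw [h]
      have : Real.exp (t * -(β + S)) ≤ Real.exp (t * |β| + -(t * S)) := by
        apply Real.exp_le_exp.2
        nlinarith [neg_abs_le β]
      linarith [Real.exp_pos (t * |β| + t * S)]
  refine (cubeMean_mono key).trans ?_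
  rw [cubeMean_add, cubeMean_const_mul, cubeMean_const_mul]
  have h1 := cubeMean_exp_linear_le s (fun u => t * c u)
  have h2 := cubeMean_exp_linear_le s (fun u => -(t * c u))
  have e : (∑ u ∈ s, (t * c u) ^ 2) / 2 = t ^ 2 * (∑ u ∈ s, c u ^ 2) / 2 := by
    rw [Finset.mul_sum]; congr 1; exact Finset.sum_congr rfl fun _ _ => by ring
  simp only [neg_sq] at h2
  rw [e] at h1 h2
  rw [Real.exp_add]
  have := Real.exp_pos (t * |β|)
  nlinarith

/-! ### Conditioning on a set of coordinates -/

/-- The point that agrees with `A` on `S` and with `B` off `S`. -/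
def glue (S A B : Finset ι) : Finset ι := (A ∩ S) ∪ (B \ S)

theorem mem_glue {S A B : Finset ι} {u : ι} : u ∈ glue S A B ↔ (u ∈ S ∧ u ∈ A) ∨ (u ∉ S ∧ u ∈ B) := by
  simp [glue]; tauto

theorem spin_glue_of_mem {S : Finset ι} {u : ι} (h : u ∈ S) (A B : Finset ι) :
    spin (glue S A B) u = spin A u := by
  simp [spin, mem_glue, h]

theorem spin_glue_of_notMem {S : Finset ι} {u : ι} (h : u ∉ S) (A B : Finset ι) :
    spin (glue S A B) u = spin B u := by
  simp [spin, mem_glue, h]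

/-- The map (A, B) ↦ (`glue S A B`, `glue S B A`) is an involution of the set of pairs, so gluing
two independent uniform points gives a uniform point. -/
theorem cubeMean_glue (S : Finset ι) (f : Finset ι → ℝ) :
    cubeMean f = cubeMean fun B => cubeMean fun A => f (glue S A B) := by
  have h : ∑ p : Finset ι × Finset ι, f (glue S p.1 p.2) = ∑ p : Finset ι × Finset ι, f p.1 := by
    refine Fintype.sum_equiv (Equiv.ofBijective
      (fun p : Finset ι × Finset ι => (glue S p.1 p.2, glue S p.2 p.1))
      (Function.Involutive.bijective fun p => ?_)) _ _ fun p => rfl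
    ext u <;> simp only [mem_glue] <;> tauto
  rw [cubeMean_comm, Fintype.sum_prod_type, Fintype.sum_prod_type] at *
  simp only [Finset.sum_const, Finset.card_univ, Fintype.card_finset, nsmul_eq_mul] at h
  simp only [cubeMean, ← Finset.sum_div]
  rw [h, ← Finset.mul_sum]
  push_cast
  field_simp

theorem cubeProb_glue (S : Finset ι) (p : Finset ι → Prop) :
    cubeProb p = cubeMean fun B => cubeProb fun A => p (glue S A B) :=
  cubeMean_glue S _

theorem cubeProb_le_of_glue (S : Finset ι) {p : Finset ι → Prop} {c : ℝ}
    (h : ∀ B, cubeProb (fun A => p (glue S A B)) ≤ c) : cubeProb p ≤ c := by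
  rw [cubeProb_glue S p, ← cubeMean_const (ι := ι) c]
  exact cubeMean_mono h

/-- If `p` does not depend on the coordinates in `S`, then the probability of `p ∧ q` is at most
that of `p` times the largest conditional probability of `q` given the coordinates off `S`. -/
theorem cubeProb_and_le (S : Finset ι) {p q : Finset ι → Prop} {c : ℝ}
    (hp : ∀ A B, p (glue S A B) ↔ p B)
    (hq : ∀ B, p B → cubeProb (fun A => q (glue S A B)) ≤ c) :
    cubeProb (fun A => p A ∧ q A) ≤ cubeProb p * c := by
  have e : c * cubeProb p = cubeMean fun B => c * (open scoped Classical in if p B then 1 else 0) :=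
    (cubeMean_const_mul c _).symm
  rw [cubeProb_glue S, mul_comm, e]
  refine cubeMean_mono fun B => ?_
  by_cases h : p B
  · rw [if_pos h, mul_one]
    exact (cubeProb_mono fun A hA => hA.2).trans (hq B h)
  · rw [if_neg h, mul_zero]
    exact (cubeProb_eq_zero fun A hA => h ((hp A B).1 hA.1)).le

theorem cubeProb_inter_eq (T : Finset ι) (q : Finset ι → Prop) [DecidablePred q] :
    cubeProb (fun A => q (A ∩ T)) = ((T.powerset.filter q).card : ℝ) / 2 ^ T.card := by
  have e : cubeProb (fun A => q (A ∩ T)) =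
      (∑ A : Finset ι, if q (A ∩ T) then (1 : ℝ) else 0) / 2 ^ Fintype.card ι := by
    simp only [cubeProb, cubeMean]
    congr!
  rw [e, Finset.sum_boole, div_eq_div_iff (by positivity) (by positivity)]
  have h : (Finset.univ.filter fun A : Finset ι => q (A ∩ T)).card
      = (T.powerset.filter q).card * 2 ^ (Fintype.card ι - T.card) := by
    rw [← Finset.card_compl, ← Finset.card_powerset, ← Finset.card_product]
    refine Finset.card_bij' (fun A _ => (A ∩ T, A \ T)) (fun p _ => p.1 ∪ p.2) ?_ ?_ ?_ ?_
    · intro A hA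
      simp only [Finset.mem_filter, Finset.mem_univ, true_and] at hA
      simp only [Finset.mem_product, Finset.mem_filter, Finset.mem_powerset]
      refine ⟨⟨Finset.inter_subset_right, hA⟩, fun x hx => ?_⟩
      simp at hx ⊢; exact hx.2
    · rintro ⟨A, B⟩ h
      simp only [Finset.mem_product, Finset.mem_filter, Finset.mem_powerset] at h
      simp only [Finset.mem_filter, Finset.mem_univ, true_and]
      have : (A ∪ B) ∩ T = A := by
        ext x
        have h1 := @h.1.1 x
        have h2 := @h.2 x
        simp at h1 h2 ⊢; tauto
      rw [this]; exact h.1.2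
    · intro A _
      ext x; simp; tauto
    · rintro ⟨A, B⟩ h
      simp only [Finset.mem_product, Finset.mem_filter, Finset.mem_powerset] at h
      ext x <;>
      · have h1 := @h.1.1 x
        have h2 := @h.2 x
        simp at h1 h2 ⊢; tauto
  have h3 : (2 : ℝ) ^ Fintype.card ι = 2 ^ (Fintype.card ι - T.card) * 2 ^ T.card := by
    rw [← pow_add, Nat.sub_add_cancel T.card_le_univ]
  rw [h, h3]
  push_cast
  ring

end Cube

/-! ### Random maximal chains, a LYM inequality counting pairs, elementary symmetric sums. -/

section Chains

/-- This is (M/q)^q ≤ binom(M, q). The induction raises both parameters and uses (1 + 1/M)^q ≤ (1 +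
1/q)^q for q ≤ M. -/
theorem pow_le_choose_mul_pow : ∀ q M : ℕ, q ≤ M → M ^ q ≤ M.choose q * q ^ q
  | 0, M, _ => by simp
  | q + 1, 0, h => by omega
  | q + 1, M + 1, h => by
    have ih := pow_le_choose_mul_pow q M (by omega)
    have h1 : ((M + 1) * q) ^ q ≤ (M * (q + 1)) ^ q :=
      Nat.pow_le_pow_left (by nlinarith [Nat.succ_le_succ_iff.1 h]) q
    have h2 : (M + 1) ^ q ≤ M.choose q * (q + 1) ^ q := by
      rcases Nat.eq_zero_or_pos q with rfl | hq
      · simp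
      · refine Nat.le_of_mul_le_mul_right ?_ (pow_pos hq q)
        rw [mul_pow, mul_pow] at h1
        calc (M + 1) ^ q * q ^ q ≤ M ^ q * (q + 1) ^ q := h1
          _ ≤ (M.choose q * q ^ q) * (q + 1) ^ q := Nat.mul_le_mul_right _ ih
          _ = _ := by ring
    calc (M + 1) ^ (q + 1) = (M + 1) * (M + 1) ^ q := by ring
      _ ≤ (M + 1) * (M.choose q * (q + 1) ^ q) := Nat.mul_le_mul_left _ h2
      _ = ((M + 1) * M.choose q) * (q + 1) ^ q := by ring
      _ = ((M + 1).choose (q + 1) * (q + 1)) * (q + 1) ^ q := by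
        rw [← Nat.add_one_mul_choose_eq]
      _ = _ := by ring

theorem centralBinom_sq_mul_le (n : ℕ) : n.centralBinom ^ 2 * (2 * n + 1) ≤ 16 ^ n := by
  induction n with
  | zero => simp
  | succ n ih =>
    have h := Nat.succ_mul_centralBinom_succ n
    refine Nat.le_of_mul_le_mul_right ?_ (show 0 < (n + 1) ^ 2 by positivity)
    calc (n + 1).centralBinom ^ 2 * (2 * (n + 1) + 1) * (n + 1) ^ 2
        = ((n + 1) * (n + 1).centralBinom) ^ 2 * (2 * n + 3) := by ring
      _ = (n.centralBinom ^ 2 * (2 * n + 1)) * (4 * ((2 * n + 1) * (2 * n + 3))) := by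
        rw [h]; ring
      _ ≤ 16 ^ n * (4 * (4 * (n + 1) ^ 2)) := by
        exact Nat.mul_le_mul ih (by nlinarith)
      _ = _ := by ring

theorem choose_le_two_pow_div_sqrt {N : ℕ} (hN : 0 < N) (k : ℕ) :
    (N.choose k : ℝ) ≤ 2 ^ N / √N := by
  have key : ∀ n : ℕ, (n.centralBinom : ℝ) ≤ 4 ^ n / √(2 * n + 1) := by
    intro n
    rw [le_div_iff₀ (by positivity)]
    refine le_of_sq_le_sq ?_ (by positivity)
    rw [mul_pow, Real.sq_sqrt (by positivity), ← pow_mul, mul_comm n 2, pow_mul]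
    have := centralBinom_sq_mul_le n
    norm_num
    exact_mod_cast this
  rcases Nat.even_or_odd' N with ⟨n, rfl | rfl⟩
  · have h1 : ((2 * n).choose k : ℝ) ≤ n.centralBinom := by
      exact_mod_cast Nat.choose_le_centralBinom k n
    refine h1.trans ((key n).trans ?_)
    rw [pow_mul]
    norm_num only
    have : (0 : ℝ) < n := by exact_mod_cast (by omega : 0 < n)
    push_cast
    gcongr
    linarith
  · have h1 : ((2 * n + 1).choose k : ℝ) ≤ 2 * n.centralBinom := by
      have : (2 * n + 1).choose k ≤ 2 * n.centralBinom := by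
        rcases k with _ | k
        · have := Nat.centralBinom_pos n
          simp; omega
        · rw [Nat.choose_succ_succ']
          have a := Nat.choose_le_centralBinom k n
          have b := Nat.choose_le_centralBinom (k + 1) n
          omega
      exact_mod_cast this
    refine h1.trans ?_
    have := key n
    push_cast
    rw [pow_succ, pow_mul, mul_comm _ (2 : ℝ), mul_div_assoc]
    norm_num only
    linarith

variable {ι : Type} [DecidableEq ι]

/-- A random maximal chain below X meets a given set A of size a with probability 1 / binom(|X|, a).
The identity splits off the top of the chain: X itself, followed by a chain below X minus a
uniformly random element. -/
theorem sum_powerset_div_choose (X : Finset ι) (hX : X.Nonempty) (w : Finset ι → ℝ) :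
    ∑ A ∈ X.powerset, w A / (X.card.choose A.card : ℝ) =
      w X + (∑ x ∈ X, ∑ A ∈ (X.erase x).powerset,
        w A / ((X.erase x).card.choose A.card : ℝ)) / X.card := by
  have h1 : ∑ x ∈ X, ∑ A ∈ (X.erase x).powerset, w A / ((X.erase x).card.choose A.card : ℝ) =
      ∑ A ∈ X.powerset, ∑ x ∈ X \ A, w A / ((X.card - 1).choose A.card : ℝ) := by
    have : ∀ x ∈ X, ∑ A ∈ (X.erase x).powerset, w A / ((X.erase x).card.choose A.card : ℝ) =
        ∑ A ∈ (X.erase x).powerset, w A / ((X.card - 1).choose A.card : ℝ) := by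
      intro x hx
      rw [Finset.card_erase_of_mem hx]
    rw [Finset.sum_congr rfl this]
    refine Finset.sum_comm' fun x A => ?_
    simp only [Finset.mem_powerset, Finset.mem_sdiff, Finset.subset_erase]
    tauto
  have hpos : (0 : ℝ) < X.card := by exact_mod_cast hX.card_pos
  rw [h1, Finset.sum_div, ← Finset.sum_erase_add _ _ (Finset.mem_powerset_self X), add_comm,
    ← Finset.sum_erase_add (s := X.powerset) (f := fun A => (∑ x ∈ X \ A,
      w A / ((X.card - 1).choose A.card : ℝ)) / (X.card : ℝ)) (a := X)
      (h := Finset.mem_powerset_self X)]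
  simp only [Nat.choose_self, Nat.cast_one, div_one, Finset.sdiff_self, Finset.sum_empty,
    zero_div, add_zero]
  congr 1
  refine Finset.sum_congr rfl fun A hA => ?_
  obtain ⟨hne, hA⟩ := Finset.mem_erase.1 hA
  rw [Finset.mem_powerset] at hA
  have hlt : A.card < X.card := Finset.card_lt_card (hA.ssubset_of_ne hne)
  rw [Finset.sum_const, Finset.card_sdiff_of_subset hA, nsmul_eq_mul]
  obtain ⟨m, hm⟩ : ∃ m, X.card = m + 1 := ⟨X.card - 1, by omega⟩
  have hid := Nat.choose_mul_succ_eq m A.card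
  rw [hm] at hlt ⊢
  have hc1 : (0 : ℝ) < m.choose A.card := by exact_mod_cast Nat.choose_pos (by omega)
  have hc2 : (0 : ℝ) < (m + 1).choose A.card := by exact_mod_cast Nat.choose_pos (by omega)
  have hid' : (m.choose A.card : ℝ) * ((m + 1 : ℕ) : ℝ)
      = (m + 1).choose A.card * ((m + 1 - A.card : ℕ) : ℝ) := by exact_mod_cast hid
  have hm1 : ((m + 1 : ℕ) : ℝ) ≠ 0 := by positivity
  rw [Nat.add_sub_cancel]
  field_simp
  rw [mul_comm] at hid'
  linear_combination (w A) * hid'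

open scoped Classical in
/-- Expected number of members of `𝒜` on a uniformly random maximal chain of subsets of `X`. -/
noncomputable def chainHits (𝒜 : Finset (Finset ι)) (X : Finset ι) : ℝ :=
  ∑ A ∈ X.powerset, (if A ∈ 𝒜 then 1 else 0) / (X.card.choose A.card : ℝ)

theorem one_le_chainHits {𝒜 : Finset (Finset ι)} {X : Finset ι} (h : X ∈ 𝒜) :
    1 ≤ chainHits 𝒜 X := by
  have := Finset.single_le_sum (s := X.powerset)
    (f := fun A => (if A ∈ 𝒜 then (1 : ℝ) else 0) / (X.card.choose A.card : ℝ))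
    (fun A _ => by positivity) (Finset.mem_powerset_self X)
  simpa [h, chainHits] using this

/-- A form of the LYM inequality for arbitrary families: the expected number of hits of a random
chain is at most one plus the expected number of pairs of hits. -/
theorem chainHits_le (𝒜 : Finset (Finset ι)) (X : Finset ι) :
    chainHits 𝒜 X ≤ 1 + ∑ A ∈ X.powerset,
      (if A ∈ 𝒜 then chainHits 𝒜 A - 1 else 0) / (X.card.choose A.card : ℝ) := by
  classical
  induction hn : X.card generalizing X with
  | zero =>
    rw [Finset.card_eq_zero] at hn
    subst hn
    by_cases h : (∅ : Finset ι) ∈ 𝒜 <;> simp [chainHits, h]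
  | succ n ih =>
    have hX : X.Nonempty := Finset.card_pos.1 (by omega)
    rw [← hn, sum_powerset_div_choose X hX]
    have e := sum_powerset_div_choose X hX (fun A => if A ∈ 𝒜 then (1 : ℝ) else 0)
    have e' : chainHits 𝒜 X = (if X ∈ 𝒜 then (1 : ℝ) else 0) +
        (∑ x ∈ X, chainHits 𝒜 (X.erase x)) / X.card := by
      simpa only [chainHits] using e
    set q : ι → ℝ := fun x => ∑ A ∈ (X.erase x).powerset,
        (if A ∈ 𝒜 then chainHits 𝒜 A - 1 else 0) / ((X.erase x).card.choose A.card : ℝ) with hq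
    have hpos : (0 : ℝ) < X.card := by exact_mod_cast hX.card_pos
    have h1 : (∑ x ∈ X, chainHits 𝒜 (X.erase x)) / X.card ≤ 1 + (∑ x ∈ X, q x) / X.card := by
      rw [div_le_iff₀ hpos, add_mul, div_mul_cancel₀ _ hpos.ne']
      have : ∑ x ∈ X, chainHits 𝒜 (X.erase x) ≤ ∑ x ∈ X, (1 + q x) := by
        refine Finset.sum_le_sum fun x hx => ?_
        have hc : (X.erase x).card = n := by rw [Finset.card_erase_of_mem hx]; omega
        have := ih (X.erase x) hc
        rw [← hc] at this
        exact this
      rw [Finset.sum_add_distrib] at this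
      simpa using this
    have h2 : 0 ≤ (∑ x ∈ X, q x) / X.card := by
      refine div_nonneg (Finset.sum_nonneg fun x _ => Finset.sum_nonneg fun A _ => ?_) hpos.le
      refine div_nonneg ?_ (by positivity)
      split_ifs with h
      · linarith [one_le_chainHits h]
      · exact le_rfl
    -- If X is a hit, the term A = X already brings the right side up to `chainHits 𝒜 X`, the other
    -- terms being nonnegative; otherwise the averaged induction hypothesis is the claim.
    by_cases h : X ∈ 𝒜
    · simp only [h, if_true] at e' ⊢
      rw [e']
      linarith
    · simp only [h, if_false] at e' ⊢
      linarith

/-- Bound for the normalized elementary symmetric sums of small nonnegative weights. -/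
theorem sum_prod_div_choose_le {X : Finset ι} (hX : X.Nonempty) {y : ι → ℝ}
    (hy : ∀ i, 0 ≤ y i) {s : ℝ} (hs : 0 < s) (hsum : ∑ i ∈ X, y i ≤ s)
    (hsX : 100 * s ≤ X.card) :
    ∑ R ∈ X.powerset.erase ∅, (∏ i ∈ R, y i) / (X.card.choose R.card : ℝ) ≤ 1 / 32 := by
  set M := X.card with hM
  have hMpos : (0 : ℝ) < M := by exact_mod_cast hX.card_pos
  set ρ : ℝ := Real.exp 1 * s / M with hρ
  have hρ0 : 0 ≤ ρ := by positivity
  -- The term of size q will be at most ρ^q, where e / 100 ≤ 1 / 33; the geometric series without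
  -- its first term is then at most 1 / 32.
  have hρ1 : ρ ≤ 1 / 33 := by
    rw [hρ, div_le_iff₀ hMpos]
    have := Real.exp_one_lt_d9
    nlinarith
  have hq : ∀ q ∈ Finset.range (M + 1), q ≠ 0 →
      ∑ R ∈ X.powersetCard q, (∏ i ∈ R, y i) / (M.choose R.card : ℝ) ≤ ρ ^ q := by
    intro q hqM hq0
    have hqM' : q ≤ M := by simpa [Nat.lt_succ_iff] using hqM
    have hqpos : (0 : ℝ) < q := by exact_mod_cast Nat.pos_of_ne_zero hq0
    -- This t minimizes exp (t s) / t^q, which bounds the q-th elementary symmetric sum through ∏ (1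
    -- + t y i) ≤ exp (t s); the minimum is (e s / q)^q.
    set t : ℝ := q / s with ht
    have htpos : 0 < t := by positivity
    have h1 : (∑ R ∈ X.powersetCard q, ∏ i ∈ R, y i) * t ^ q ≤ Real.exp q := by
      calc (∑ R ∈ X.powersetCard q, ∏ i ∈ R, y i) * t ^ q
          = ∑ R ∈ X.powersetCard q, ∏ i ∈ R, (t * y i) := by
            rw [Finset.sum_mul]
            refine Finset.sum_congr rfl fun R hR => ?_
            rw [Finset.prod_mul_distrib, Finset.prod_const, (Finset.mem_powersetCard.1 hR).2]
            ring
        _ ≤ ∑ R ∈ X.powerset, ∏ i ∈ R, (t * y i) := by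
            refine Finset.sum_le_sum_of_subset_of_nonneg ?_ fun R _ _ =>
              Finset.prod_nonneg fun i _ => mul_nonneg htpos.le (hy i)
            intro R hR
            exact Finset.mem_powerset.2 (Finset.mem_powersetCard.1 hR).1
        _ = ∏ i ∈ X, (t * y i + 1) := by
            rw [Finset.prod_add]
            simp
        _ ≤ ∏ i ∈ X, Real.exp (t * y i) :=
            Finset.prod_le_prod (fun i _ => by have := hy i; positivity)
              fun i _ => Real.add_one_le_exp _
        _ = Real.exp (t * ∑ i ∈ X, y i) := by rw [← Real.exp_sum, Finset.mul_sum]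
        _ ≤ Real.exp q := by
            apply Real.exp_le_exp.2
            calc t * ∑ i ∈ X, y i ≤ t * s := by gcongr
              _ = q := by rw [ht]; field_simp
    have hch : (0 : ℝ) < M.choose q := by exact_mod_cast Nat.choose_pos hqM'
    have h2 : (M : ℝ) ^ q ≤ M.choose q * (q : ℝ) ^ q := by
      exact_mod_cast pow_le_choose_mul_pow q M hqM'
    have h3 : ∑ R ∈ X.powersetCard q, (∏ i ∈ R, y i) / (M.choose R.card : ℝ)
        = (∑ R ∈ X.powersetCard q, ∏ i ∈ R, y i) / (M.choose q : ℝ) := by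
      rw [Finset.sum_div]
      exact Finset.sum_congr rfl fun R hR => by rw [(Finset.mem_powersetCard.1 hR).2]
    rw [h3, div_le_iff₀ hch]
    have h4 : ρ ^ q * (M.choose q : ℝ) * t ^ q = Real.exp q * ((M.choose q * (q : ℝ) ^ q) / M ^ q) := by
      rw [hρ, ht, div_pow, div_pow, mul_pow, ← Real.exp_nat_mul, mul_one]
      field_simp
    have h5 : 1 ≤ (M.choose q * (q : ℝ) ^ q) / (M : ℝ) ^ q := by
      rw [one_le_div (by positivity)]; exact h2
    refine le_of_mul_le_mul_right ?_ (pow_pos htpos q)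
    rw [h4]
    nlinarith [Real.exp_pos (q : ℝ)]
  have hsplit : ∑ R ∈ X.powerset.erase ∅, (∏ i ∈ R, y i) / (M.choose R.card : ℝ) + 1 =
      ∑ q ∈ Finset.range (M + 1), ∑ R ∈ X.powersetCard q, (∏ i ∈ R, y i) / (M.choose R.card : ℝ) := by
    rw [← Finset.sum_powerset, ← Finset.sum_erase_add _ _ (Finset.empty_mem_powerset X)]
    simp
  have hsum2 : ∑ q ∈ Finset.range (M + 1),
      ∑ R ∈ X.powersetCard q, (∏ i ∈ R, y i) / (M.choose R.card : ℝ) ≤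
      ∑ q ∈ Finset.range (M + 1), ρ ^ q := by
    refine Finset.sum_le_sum fun q hqM => ?_
    rcases eq_or_ne q 0 with rfl | h0
    · simp
    · exact hq q hqM h0
  have hgeom : ∑ q ∈ Finset.range (M + 1), ρ ^ q ≤ 33 / 32 := by
    have h1 : (∑ q ∈ Finset.range (M + 1), ρ ^ q) * (1 - ρ) = 1 - ρ ^ (M + 1) :=
      geom_sum_mul_neg ρ (M + 1)
    have h2 : 0 ≤ ρ ^ (M + 1) := pow_nonneg hρ0 _
    have h3 : (0 : ℝ) ≤ ∑ q ∈ Finset.range (M + 1), ρ ^ q :=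
      Finset.sum_nonneg fun q _ => pow_nonneg hρ0 q
    nlinarith
  linarith

end Chains

/-! ### A Sperner theorem that tolerates exceptional comparable pairs. -/

section ChainBound

variable {ι : Type} [DecidableEq ι]

theorem chainHits_eq (𝒜 : Finset (Finset ι)) (X : Finset ι) :
    chainHits 𝒜 X = ∑ A ∈ 𝒜 with A ⊆ X, 1 / (X.card.choose A.card : ℝ) := by
  unfold chainHits
  simp only [ite_div, zero_div]
  rw [← Finset.sum_filter]
  refine Finset.sum_congr ?_ fun _ _ => rfl
  ext A
  simp [and_comm]

/-- Each comparable pair is charged to the member whose weights have product at least 1 on the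
difference. For a fixed member the differences are distinct nonempty sets, so
`sum_prod_div_choose_le` bounds its charges from below and from above by 1/32 each. Expected pairs
are therefore at most a sixteenth of expected hits, and `chainHits_le` closes the loop. -/
theorem sum_chainHits_sub_one_le {𝒜 : Finset (Finset ι)} {T : Finset ι} (hT : T.Nonempty)
    (h𝒜 : ∀ A ∈ 𝒜, A ⊆ T) (hmid : ∀ A ∈ 𝒜, T.card ≤ 4 * A.card ∧ 4 * A.card ≤ 3 * T.card)
    {y : Finset ι → ι → ℝ} (hy : ∀ A i, 0 ≤ y A i)
    (hsum : ∀ A ∈ 𝒜, 400 * ∑ i ∈ T, y A i ≤ T.card)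
    (hpair : ∀ A ∈ 𝒜, ∀ B ∈ 𝒜, A ⊂ B → 1 ≤ ∏ i ∈ B \ A, y A i ∨ 1 ≤ ∏ i ∈ B \ A, y B i) :
    chainHits 𝒜 T ≤ 2 := by
  have hTpos : 0 < T.card := hT.card_pos
  have hTpos' : (0 : ℝ) < T.card := by exact_mod_cast hTpos
  -- Sets in the middle layers leave at least |T| / 4 = 100 s elements both inside and outside, as
  -- `sum_prod_div_choose_le` requires.
  set s : ℝ := T.card / 400 with hs
  have hspos : 0 < s := by positivity
  set H : ℝ := ∑ A ∈ 𝒜, 1 / (T.card.choose A.card : ℝ) with hH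
  have hHeq : chainHits 𝒜 T = H := by
    rw [chainHits_eq, Finset.filter_true_of_mem h𝒜]
  have hchoose : ∀ A ∈ 𝒜, (0 : ℝ) < T.card.choose A.card := fun A hA => by
    exact_mod_cast Nat.choose_pos (Finset.card_le_card (h𝒜 A hA))
  have hq : ∑ A ∈ T.powerset, (if A ∈ 𝒜 then chainHits 𝒜 A - 1 else 0) /
      (T.card.choose A.card : ℝ) =
      ∑ B ∈ 𝒜, ∑ A ∈ 𝒜 with A ⊂ B, 1 / ((B.card.choose A.card : ℝ) * T.card.choose B.card) := by
    simp only [ite_div, zero_div]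
    rw [← Finset.sum_filter]
    have e : T.powerset.filter (fun A => A ∈ 𝒜) = 𝒜 := by
      ext A
      simp only [Finset.mem_filter, Finset.mem_powerset]
      exact ⟨fun h => h.2, fun h => ⟨h𝒜 A h, h⟩⟩
    rw [e]
    refine Finset.sum_congr rfl fun B hB => ?_
    have e2 : 𝒜.filter (fun A => A ⊆ B) = insert B (𝒜.filter fun A => A ⊂ B) := by
      ext A
      simp only [Finset.mem_filter, Finset.mem_insert, Finset.ssubset_iff_subset_ne]
      constructor
      · rintro ⟨h1, h2⟩
        by_cases h : A = B
        · exact Or.inl h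
        · exact Or.inr ⟨h1, h2, h⟩
      · rintro (rfl | ⟨h1, h2, _⟩)
        · exact ⟨hB, subset_rfl⟩
        · exact ⟨h1, h2⟩
    rw [chainHits_eq, e2, Finset.sum_insert (by simp)]
    simp only [Nat.choose_self, Nat.cast_one, div_one, add_sub_cancel_left]
    rw [Finset.sum_div]
    exact Finset.sum_congr rfl fun A _ => by rw [div_div]
  have hdown : ∀ B ∈ 𝒜, ∑ A ∈ 𝒜 with A ⊂ B, (∏ i ∈ B \ A, y B i) / (B.card.choose A.card : ℝ)
      ≤ 1 / 32 := by
    intro B hB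
    have hBc : T.card ≤ 4 * B.card := (hmid B hB).1
    have hBne : B.Nonempty := Finset.card_pos.1 (by omega)
    have h1 := sum_prod_div_choose_le hBne (hy B) hspos
      ((Finset.sum_le_sum_of_subset_of_nonneg (h𝒜 B hB) fun i _ _ => hy B i).trans
        (by rw [hs]; linarith [hsum B hB])) (by
          rw [hs]
          have : (T.card : ℝ) ≤ 4 * B.card := by exact_mod_cast hBc
          linarith)
    refine le_trans ?_ h1
    calc ∑ A ∈ 𝒜 with A ⊂ B, (∏ i ∈ B \ A, y B i) / (B.card.choose A.card : ℝ)
        = ∑ R ∈ (𝒜.filter fun A => A ⊂ B).image (fun A => B \ A),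
          (∏ i ∈ R, y B i) / (B.card.choose R.card : ℝ) := by
          rw [Finset.sum_image]
          · refine Finset.sum_congr rfl fun A hA => ?_
            have hAB := (Finset.mem_filter.1 hA).2.subset
            rw [Finset.card_sdiff_of_subset hAB, Nat.choose_symm (Finset.card_le_card hAB)]
          · intro A hA A' hA' h
            have h1 := (Finset.mem_filter.1 (Finset.mem_coe.1 hA)).2.subset
            have h2 := (Finset.mem_filter.1 (Finset.mem_coe.1 hA')).2.subset
            rw [← Finset.sdiff_sdiff_eq_self h1, ← Finset.sdiff_sdiff_eq_self h2]
            exact congrArg (fun R => B \ R) h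
      _ ≤ _ := by
          refine Finset.sum_le_sum_of_subset_of_nonneg ?_ fun R _ _ =>
            div_nonneg (Finset.prod_nonneg fun i _ => hy B i) (by positivity)
          intro R hR
          obtain ⟨A, hA, rfl⟩ := Finset.mem_image.1 hR
          have hAB := (Finset.mem_filter.1 hA).2
          refine Finset.mem_erase.2 ⟨?_, Finset.mem_powerset.2 Finset.sdiff_subset⟩
          exact (Finset.sdiff_nonempty.2 hAB.2).ne_empty
  have hup : ∀ A ∈ 𝒜, ∑ B ∈ 𝒜 with A ⊂ B,
      (∏ i ∈ B \ A, y A i) / (((T.card - A.card).choose (B.card - A.card) : ℕ) : ℝ) ≤ 1 / 32 := by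
    intro A hA
    have hAT := h𝒜 A hA
    have hAc : 4 * A.card ≤ 3 * T.card := (hmid A hA).2
    have hc : (T \ A).card = T.card - A.card := Finset.card_sdiff_of_subset hAT
    have hne : (T \ A).Nonempty := Finset.card_pos.1 (by omega)
    have h1 := sum_prod_div_choose_le hne (hy A) hspos
      ((Finset.sum_le_sum_of_subset_of_nonneg Finset.sdiff_subset fun i _ _ => hy A i).trans
        (by rw [hs]; linarith [hsum A hA])) (by
          rw [hs]
          have : (T.card : ℝ) ≤ 4 * (T \ A).card := by exact_mod_cast (by omega)
          linarith)
    refine le_trans ?_ h1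
    calc ∑ B ∈ 𝒜 with A ⊂ B,
        (∏ i ∈ B \ A, y A i) / (((T.card - A.card).choose (B.card - A.card) : ℕ) : ℝ)
        = ∑ R ∈ (𝒜.filter fun B => A ⊂ B).image (fun B => B \ A),
          (∏ i ∈ R, y A i) / ((T \ A).card.choose R.card : ℝ) := by
          rw [Finset.sum_image]
          · refine Finset.sum_congr rfl fun B hB => ?_
            rw [hc, Finset.card_sdiff_of_subset (Finset.mem_filter.1 hB).2.subset]
          · intro B hB B' hB' h
            have h1 := (Finset.mem_filter.1 (Finset.mem_coe.1 hB)).2.subset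
            have h2 := (Finset.mem_filter.1 (Finset.mem_coe.1 hB')).2.subset
            rw [← Finset.union_sdiff_of_subset h1, ← Finset.union_sdiff_of_subset h2]
            exact congrArg (fun R => A ∪ R) h
      _ ≤ _ := by
          refine Finset.sum_le_sum_of_subset_of_nonneg ?_ fun R _ _ =>
            div_nonneg (Finset.prod_nonneg fun i _ => hy A i) (by positivity)
          intro R hR
          obtain ⟨B, hB, rfl⟩ := Finset.mem_image.1 hR
          have hAB := (Finset.mem_filter.1 hB)
          refine Finset.mem_erase.2 ⟨(Finset.sdiff_nonempty.2 hAB.2.2).ne_empty,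
            Finset.mem_powerset.2 (Finset.sdiff_subset_sdiff (h𝒜 B hAB.1) subset_rfl)⟩
  have hmain : ∑ B ∈ 𝒜, ∑ A ∈ 𝒜 with A ⊂ B,
      1 / ((B.card.choose A.card : ℝ) * T.card.choose B.card) ≤ H / 32 + H / 32 := by
    calc ∑ B ∈ 𝒜, ∑ A ∈ 𝒜 with A ⊂ B, 1 / ((B.card.choose A.card : ℝ) * T.card.choose B.card)
        ≤ ∑ B ∈ 𝒜, ∑ A ∈ 𝒜 with A ⊂ B,
          ((∏ i ∈ B \ A, y B i) / ((B.card.choose A.card : ℝ) * T.card.choose B.card) +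
          (∏ i ∈ B \ A, y A i) / ((B.card.choose A.card : ℝ) * T.card.choose B.card)) := by
          refine Finset.sum_le_sum fun B hB => Finset.sum_le_sum fun A hA => ?_
          obtain ⟨hA, hAB⟩ := Finset.mem_filter.1 hA
          rw [← add_div]
          have p1 : 0 ≤ ∏ i ∈ B \ A, y A i := Finset.prod_nonneg fun i _ => hy A i
          have p2 : 0 ≤ ∏ i ∈ B \ A, y B i := Finset.prod_nonneg fun i _ => hy B i
          gcongr
          rcases hpair A hA B hB hAB with h | h <;> linarith
      _ = ∑ B ∈ 𝒜, (1 / (T.card.choose B.card : ℝ)) *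
            (∑ A ∈ 𝒜 with A ⊂ B, (∏ i ∈ B \ A, y B i) / (B.card.choose A.card : ℝ)) +
          ∑ A ∈ 𝒜, (1 / (T.card.choose A.card : ℝ)) *
            (∑ B ∈ 𝒜 with A ⊂ B, (∏ i ∈ B \ A, y A i) /
              (((T.card - A.card).choose (B.card - A.card) : ℕ) : ℝ)) := by
          simp only [Finset.sum_add_distrib]
          congr 1
          · refine Finset.sum_congr rfl fun B hB => ?_
            rw [Finset.mul_sum]
            refine Finset.sum_congr rfl fun A hA => ?_
            rw [div_mul_div_comm, one_mul, mul_comm (T.card.choose B.card : ℝ)]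
          · simp only [Finset.sum_filter, Finset.mul_sum]
            rw [Finset.sum_comm]
            refine Finset.sum_congr rfl fun A hA => Finset.sum_congr rfl fun B hB => ?_
            by_cases hAB : A ⊂ B
            · simp only [hAB, if_true]
              -- binom(t, b) binom(b, a) = binom(t, a) binom(t - a, b - a): a chain can be drawn
              -- downwards from B or upwards from A, which permits charging to the lower member.
              have := Nat.choose_mul (n := T.card) (k := B.card) (s := A.card)
                (Finset.card_le_card hAB.subset)
              rw [div_mul_div_comm, one_mul]
              congr 1
              rw [mul_comm]
              exact_mod_cast this
            · simp [hAB]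
      _ ≤ ∑ B ∈ 𝒜, (1 / (T.card.choose B.card : ℝ)) * (1 / 32) +
          ∑ A ∈ 𝒜, (1 / (T.card.choose A.card : ℝ)) * (1 / 32) := by
          gcongr with B hB A hA
          · exact hdown B hB
          · exact hup A hA
      _ = H / 32 + H / 32 := by
          rw [← Finset.sum_mul]; ring
  have := chainHits_le 𝒜 T
  rw [hHeq, hq] at this
  rw [hHeq]
  linarith

variable [Fintype ι]

theorem card_powerset_filter_eq (T : Finset ι) (q : Finset ι → Prop) [DecidablePred q] :
    ((T.powerset.filter q).card : ℝ) = cubeProb (fun A => q (A ∩ T)) * 2 ^ T.card := by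
  rw [cubeProb_inter_eq, div_mul_cancel₀ _ (by positivity)]

theorem sum_spin_inter (T A : Finset ι) :
    ∑ u ∈ T, spin A u = 2 * ((A ∩ T).card : ℝ) - T.card := by
  have h : ∀ u ∈ T, spin A u = 2 * (if u ∈ A then (1 : ℝ) else 0) - 1 := by
    intro u _
    unfold spin; split_ifs <;> norm_num
  rw [Finset.sum_congr rfl h, Finset.sum_sub_distrib, ← Finset.mul_sum, Finset.sum_boole,
    Finset.filter_mem_eq_inter, Finset.inter_comm]
  simp

/-- A robust form of Sperner's theorem: comparable pairs are allowed, provided that they are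
exceptional with respect to small weights attached to one of the two members. -/
theorem card_le_of_small_weights {𝒜 : Finset (Finset ι)} {T : Finset ι} (hT : T.Nonempty)
    (h𝒜 : ∀ A ∈ 𝒜, A ⊆ T) {y : Finset ι → ι → ℝ} (hy : ∀ A i, 0 ≤ y A i)
    (hsum : ∀ A ∈ 𝒜, 400 * ∑ i ∈ T, y A i ≤ T.card)
    (hpair : ∀ A ∈ 𝒜, ∀ B ∈ 𝒜, A ⊂ B → 1 ≤ ∏ i ∈ B \ A, y A i ∨ 1 ≤ ∏ i ∈ B \ A, y B i) :
    (𝒜.card : ℝ) ≤ 6 * (2 ^ T.card / √T.card) := by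
  have hTpos : (0 : ℝ) < T.card := by exact_mod_cast hT.card_pos
  have hT1 : (1 : ℝ) ≤ T.card := by exact_mod_cast hT.card_pos
  -- The outer layers hold at most a fraction 4 / |T| of the cube by Chebyshev's inequality, which
  -- is within the bound.
  set mid : Finset ι → Prop := fun A => T.card ≤ 4 * A.card ∧ 4 * A.card ≤ 3 * T.card with hmid
  set 𝓜 := 𝒜.filter mid
  have h1 : (𝓜.card : ℝ) ≤ 2 * (2 ^ T.card / √T.card) := by
    have hh : chainHits 𝓜 T ≤ 2 := by
      refine sum_chainHits_sub_one_le hT (fun A hA => h𝒜 A (Finset.mem_filter.1 hA).1)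
        (fun A hA => (Finset.mem_filter.1 hA).2) hy
        (fun A hA => hsum A (Finset.mem_filter.1 hA).1)
        (fun A hA B hB => hpair A (Finset.mem_filter.1 hA).1 B (Finset.mem_filter.1 hB).1)
    rw [chainHits_eq, Finset.filter_true_of_mem (fun A hA => h𝒜 A (Finset.mem_filter.1 hA).1)] at hh
    calc (𝓜.card : ℝ) = ∑ A ∈ 𝓜, 1 := by simp
      _ ≤ ∑ A ∈ 𝓜, (2 ^ T.card / √T.card) * (1 / (T.card.choose A.card : ℝ)) := by
        refine Finset.sum_le_sum fun A hA => ?_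
        have hc : (0 : ℝ) < T.card.choose A.card := by
          exact_mod_cast Nat.choose_pos (Finset.card_le_card (h𝒜 A (Finset.mem_filter.1 hA).1))
        rw [mul_one_div, one_le_div hc]
        exact choose_le_two_pow_div_sqrt hT.card_pos _
      _ = (2 ^ T.card / √T.card) * ∑ A ∈ 𝓜, 1 / (T.card.choose A.card : ℝ) := by
        rw [Finset.mul_sum]
      _ ≤ (2 ^ T.card / √T.card) * 2 := by gcongr
      _ = _ := by ring
  have h2 : ((𝒜.filter fun A => ¬ mid A).card : ℝ) ≤ 4 * (2 ^ T.card / √T.card) := by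
    have hsub : 𝒜.filter (fun A => ¬ mid A) ⊆ T.powerset.filter fun A => ¬ mid A := by
      intro A hA
      obtain ⟨hA, hm⟩ := Finset.mem_filter.1 hA
      exact Finset.mem_filter.2 ⟨Finset.mem_powerset.2 (h𝒜 A hA), hm⟩
    have hp : cubeProb (fun A => ¬ mid (A ∩ T)) ≤ 4 / T.card := by
      have hv := cubeMean_linear_sq T 0 (fun _ => 1)
      have hmk := cubeProb_le_cubeMean_div (f := fun A => (∑ u ∈ T, spin A u) ^ 2)
        (fun A => sq_nonneg _) (t := (T.card : ℝ) ^ 2 / 4) (by positivity)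
        (p := fun A => ¬ mid (A ∩ T)) (by
          intro A hA
          rw [sum_spin_inter]
          simp only [hmid, not_and_or, not_le] at hA
          rcases hA with hA | hA
          · have : (4 : ℝ) * (A ∩ T).card < T.card := by exact_mod_cast hA
            nlinarith
          · have : (3 : ℝ) * T.card < 4 * (A ∩ T).card := by exact_mod_cast hA
            nlinarith)
      simp only [one_mul, zero_add, one_pow, Finset.sum_const, nsmul_eq_mul, mul_one] at hv
      rw [hv] at hmk
      refine hmk.trans (le_of_eq ?_)
      field_simp
      ring
    calc ((𝒜.filter fun A => ¬ mid A).card : ℝ) ≤ ((T.powerset.filter fun A => ¬ mid A).card : ℝ) := by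
          exact_mod_cast Finset.card_le_card hsub
      _ = cubeProb (fun A => ¬ mid (A ∩ T)) * 2 ^ T.card := card_powerset_filter_eq T _
      _ ≤ 4 / T.card * 2 ^ T.card := by gcongr
      _ ≤ 4 / √T.card * 2 ^ T.card := by
          gcongr
          rw [Real.sqrt_le_left (by positivity)]
          nlinarith
      _ = _ := by ring
  have h3 := Finset.card_filter_add_card_filter_not (s := 𝒜) mid
  have h4 : (𝒜.card : ℝ) = 𝓜.card + (𝒜.filter fun A => ¬ mid A).card := by exact_mod_cast h3.symm
  linarith

end ChainBound

/-! ### Quadratic functions on the cube, sign patterns of slopes, the linear Littlewood–Offord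
bound. -/

section Quadratic

variable {ι : Type} [Fintype ι] [DecidableEq ι]

/-- The affine form with constant term `b i` and coefficients `r i`. -/
noncomputable def slopeAt (r : ι → ι → ℤ) (b : ι → ℝ) (A : Finset ι) (i : ι) : ℝ :=
  b i + ∑ u, (r i u : ℝ) * spin A u

/-- `Y` is a function on the cube whose discrete derivatives in the directions `i ∈ U` are the
affine forms with constant terms `b i` and integer coefficients `r i u`, bounded by `2`. -/
structure IsQuadraticOn (Y : Finset ι → ℝ) (U : Finset ι) (r : ι → ι → ℤ) (b : ι → ℝ) : Prop where
  bound : ∀ i ∈ U, ∀ u, |r i u| ≤ 2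
  diag : ∀ i ∈ U, r i i = 0
  symm : ∀ i ∈ U, ∀ j ∈ U, r i j = r j i
  deriv : ∀ i ∈ U, ∀ A, Y (insert i A) - Y (A.erase i) = 2 * slopeAt r b A i

/-- The set of coordinates on which the form `r i` really depends. -/
def rowSupport (r : ι → ι → ℤ) (i : ι) : Finset ι := Finset.univ.filter fun u => r i u ≠ 0

theorem mem_rowSupport {r : ι → ι → ℤ} {i u : ι} : u ∈ rowSupport r i ↔ r i u ≠ 0 := by
  simp [rowSupport]

theorem slope_symmDiff (r : ι → ι → ℤ) (b : ι → ℝ) (A R : Finset ι) (i : ι) :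
    slopeAt r b (symmDiff A R) i = slopeAt r b A i - 2 * ∑ u ∈ R, (r i u : ℝ) * spin A u := by
  unfold slopeAt
  have h : ∀ u, (r i u : ℝ) * spin (symmDiff A R) u =
      (r i u : ℝ) * spin A u - 2 * (if u ∈ R then (r i u : ℝ) * spin A u else 0) := by
    intro u
    by_cases hu : u ∈ R
    · rw [spin_symmDiff_of_mem hu, if_pos hu]; ring
    · rw [spin_symmDiff_of_notMem hu, if_neg hu]; ring
  simp only [h, Finset.sum_sub_distrib, ← Finset.mul_sum, Finset.sum_ite_mem, Finset.univ_inter]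
  ring

theorem IsQuadraticOn.sub_flip {Y : Finset ι → ℝ} {U : Finset ι} {r : ι → ι → ℤ} {b : ι → ℝ}
    (h : IsQuadraticOn Y U r b) {i : ι} (hi : i ∈ U) (A : Finset ι) :
    Y (symmDiff A {i}) - Y A = -(2 * spin A i * slopeAt r b A i) := by
  have hd := h.deriv i hi A
  by_cases hA : i ∈ A
  · have e1 : symmDiff A {i} = A.erase i := by
      ext x; by_cases hx : x = i <;> simp [Finset.mem_symmDiff, hx, hA]
    rw [Finset.insert_eq_of_mem hA] at hd
    simp only [e1, spin, hA, if_true]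
    linarith
  · have e1 : symmDiff A {i} = insert i A := by
      ext x; by_cases hx : x = i <;> simp [Finset.mem_symmDiff, hx, hA]
    rw [Finset.erase_eq_of_notMem hA] at hd
    simp only [e1, spin, hA, if_false]
    linarith

/-- The midpoint formula for increments of a quadratic polynomial. -/
theorem IsQuadraticOn.sub_symmDiff {Y : Finset ι → ℝ} {U : Finset ι} {r : ι → ι → ℤ} {b : ι → ℝ}
    (h : IsQuadraticOn Y U r b) {R : Finset ι} (hR : R ⊆ U) (A : Finset ι) :
    Y (symmDiff A R) - Y A =
      -∑ i ∈ R, spin A i * (slopeAt r b A i + slopeAt r b (symmDiff A R) i) := by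
  induction R using Finset.induction_on with
  | empty => rw [show symmDiff A ∅ = A from symmDiff_bot A]; simp
  | insert j R hj ih =>
    have hjU : j ∈ U := hR (Finset.mem_insert_self j R)
    have hRU : R ⊆ U := fun x hx => hR (Finset.mem_insert_of_mem hx)
    have e : symmDiff A (insert j R) = symmDiff (symmDiff A R) {j} := by
      rw [symmDiff_assoc]
      congr 1
      ext x
      by_cases hx : x = j <;> simp [Finset.mem_symmDiff, hx, hj]
    have h1 := h.sub_flip hjU (symmDiff A R)
    rw [spin_symmDiff_of_notMem hj] at h1
    have h2 := ih hRU
    have h3 : ∀ i, slopeAt r b (symmDiff (symmDiff A R) {j}) i =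
        slopeAt r b (symmDiff A R) i - 2 * ((r i j : ℝ) * spin A j) := by
      intro i
      rw [slope_symmDiff, Finset.sum_singleton, spin_symmDiff_of_notMem hj]
    have h4 : slopeAt r b A j = slopeAt r b (symmDiff A R) j + 2 * ∑ u ∈ R, (r j u : ℝ) * spin A u := by
      rw [slope_symmDiff]; ring
    have h5 : ∑ i ∈ R, spin A i * (slopeAt r b A i + slopeAt r b (symmDiff (symmDiff A R) {j}) i) =
        ∑ i ∈ R, spin A i * (slopeAt r b A i + slopeAt r b (symmDiff A R) i) -
          2 * spin A j * ∑ u ∈ R, (r j u : ℝ) * spin A u := by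
      rw [Finset.mul_sum, ← Finset.sum_sub_distrib]
      refine Finset.sum_congr rfl fun i hi => ?_
      rw [h3, h.symm i (hRU hi) j hjU]
      ring
    rw [e, Finset.sum_insert hj, h5, h3 j, h.diag j hjU, h4]
    push_cast
    linear_combination h1 + h2

/-- If on the event `p` the function `Y` is nearly constant, while along most directions in `T` its
slopes follow a fixed sign pattern, then `p` has small probability. -/
theorem IsQuadraticOn.cubeProb_le_of_pattern {Y : Finset ι → ℝ} {U : Finset ι} {r : ι → ι → ℤ}
    {b : ι → ℝ} (h : IsQuadraticOn Y U r b) {T : Finset ι} (hT : T.Nonempty) (hTU : T ⊆ U)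
    (Neg : Finset ι) {p : Finset ι → Prop} {g : ℝ} (hp : ∀ A B, p A → p B → Y B ≤ Y A + g)
    {y : Finset ι → ι → ℝ} (hy : ∀ A i, 0 ≤ y A i) (hsum : ∀ A, p A → 400 * ∑ i ∈ T, y A i ≤ T.card)
    (hpos : ∀ A, p A → ∀ R ⊆ T, R.Nonempty → ∏ i ∈ R, y A i < 1 →
      g / 2 < ∑ i ∈ R, (if i ∈ Neg then -1 else 1) * slopeAt r b A i) (B : Finset ι) :
    cubeProb (fun A => p (glue T A B)) ≤ 6 / √T.card := by
  classical
  -- Reflecting the coordinates in `Neg` turns the pattern into all plus signs. Going up from A to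
  -- A' then raises Y by the sum of the signed slopes at both ends; each exceeds g / 2 unless the
  -- corresponding weight product is at least 1.
  set Φ : Finset ι → Finset ι := fun A => glue T (symmDiff A Neg) B with hΦ
  have hΦT : ∀ A, Φ A = Φ (A ∩ T) := by
    intro A
    ext x
    simp only [hΦ, mem_glue, Finset.mem_symmDiff, Finset.mem_inter]
    tauto
  have e1 : cubeProb (fun A => p (glue T A B)) = cubeProb (fun A => p (Φ (A ∩ T))) := by
    rw [← cubeProb_symmDiff _ Neg]
    simp only [← hΦT]
    rfl
  rw [e1, cubeProb_inter_eq T (fun A => p (Φ A))]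
  set 𝒜 := T.powerset.filter fun A => p (Φ A) with h𝒜
  have hmem : ∀ A ∈ 𝒜, A ⊆ T ∧ p (Φ A) := fun A hA => by
    obtain ⟨h1, h2⟩ := Finset.mem_filter.1 hA
    exact ⟨Finset.mem_powerset.1 h1, h2⟩
  have key := card_le_of_small_weights (𝒜 := 𝒜) hT (fun A hA => (hmem A hA).1)
    (y := fun A => y (Φ A)) (fun A i => hy _ i) (fun A hA => hsum _ (hmem A hA).2) (by
      intro A hA A' hA' hAA'
      by_contra! hcon
      set R := A' \ A with hR
      have hRT : R ⊆ T := Finset.sdiff_subset.trans (hmem A' hA').1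
      have hRne : R.Nonempty := Finset.sdiff_nonempty.2 hAA'.2
      have hflip : Φ A' = symmDiff (Φ A) R := by
        ext x
        have h1 : x ∈ A → x ∈ A' := fun hx => hAA'.1 hx
        have h2 : x ∈ A' → x ∈ T := fun hx => (hmem A' hA').1 hx
        simp only [hΦ, hR, mem_glue, Finset.mem_symmDiff, Finset.mem_sdiff]
        by_cases c1 : x ∈ A <;> by_cases c2 : x ∈ A' <;> by_cases c3 : x ∈ T <;>
          by_cases c4 : x ∈ Neg <;> simp [c1, c2, c3, c4] at h1 h2 ⊢
      have hspin : ∀ i ∈ R, - spin (Φ A) i = if i ∈ Neg then -1 else 1 := by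
        intro i hi
        have hiA : i ∉ A := (Finset.mem_sdiff.1 hi).2
        have hiT := hRT hi
        rw [hΦ, spin_glue_of_mem hiT]
        by_cases hN : i ∈ Neg <;> simp [spin, Finset.mem_symmDiff, hiA, hN]
      have hmid := h.sub_symmDiff (hRT.trans hTU) (Φ A)
      rw [← hflip, ← Finset.sum_neg_distrib] at hmid
      have e2 : ∑ i ∈ R, -(spin (Φ A) i * (slopeAt r b (Φ A) i + slopeAt r b (Φ A') i)) =
          ∑ i ∈ R, (if i ∈ Neg then -1 else 1) * slopeAt r b (Φ A) i +
          ∑ i ∈ R, (if i ∈ Neg then -1 else 1) * slopeAt r b (Φ A') i := by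
        rw [← Finset.sum_add_distrib]
        refine Finset.sum_congr rfl fun i hi => ?_
        rw [← hspin i hi]; ring
      rw [e2] at hmid
      have := hpos _ (hmem A hA).2 R hRT hRne hcon.1
      have := hpos _ (hmem A' hA').2 R hRT hRne hcon.2
      have := hp _ _ (hmem A hA).2 (hmem A' hA').2
      linarith)
  rw [div_le_iff₀ (by positivity)]
  calc (𝒜.card : ℝ) ≤ 6 * (2 ^ T.card / √T.card) := key
    _ = _ := by ring

/-- The bound `c` holds for the point probabilities of all quadratic functions on the cube with at
least `n` active directions, each of whose slopes depends on at least `n` coordinates. -/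
def AnticoncentrationBound (ι : Type) [Fintype ι] [DecidableEq ι] (n : ℕ) (c : ℝ) : Prop :=
  ∀ (Y : Finset ι → ℝ) (U : Finset ι) (r : ι → ι → ℤ) (b : ι → ℝ), IsQuadraticOn Y U r b →
    n ≤ U.card → (∀ i ∈ U, n ≤ (rowSupport r i).card) → ∀ ℓ : ℝ, cubeProb (fun A => Y A = ℓ) ≤ c

/-- Freezing the coordinates off S keeps the mixed coefficients within S and moves the frozen part
of each slope into its constant term. The constant terms are therefore left arbitrary throughout. -/
theorem IsQuadraticOn.restrict {Y : Finset ι → ℝ} {U : Finset ι} {r : ι → ι → ℤ}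
    {b : ι → ℝ} (h : IsQuadraticOn Y U r b) {S U' : Finset ι} (hU' : U' ⊆ U) (hS : U' ⊆ S)
    (B : Finset ι) :
    IsQuadraticOn (fun A => Y (glue S A B)) U' (fun i u => if u ∈ S then r i u else 0)
      (fun i => b i + ∑ u ∈ Sᶜ, (r i u : ℝ) * spin B u) where
  bound i hi u := by
    split_ifs
    · exact h.bound i (hU' hi) u
    · simp
  diag i hi := by simp [h.diag i (hU' hi)]
  symm i hi j hj := by simp [hS hi, hS hj, h.symm i (hU' hi) j (hU' hj)]
  deriv i hi A := by
    have e1 : glue S (insert i A) B = insert i (glue S A B) := by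
      ext x
      have := hS hi
      by_cases hx : x = i
      · subst hx; simp [mem_glue, this]
      · simp [mem_glue, hx]
    have e2 : glue S (A.erase i) B = (glue S A B).erase i := by
      ext x
      have := hS hi
      by_cases hx : x = i
      · subst hx; simp [mem_glue, this]
      · simp [mem_glue, hx]
    rw [e1, e2, h.deriv i (hU' hi)]
    unfold slopeAt
    rw [← Finset.sum_add_sum_compl S]
    have e3 : ∑ u ∈ S, (r i u : ℝ) * spin (glue S A B) u =
        ∑ u, ((if u ∈ S then r i u else 0 : ℤ) : ℝ) * spin A u := by
      simp only [Int.cast_ite, Int.cast_zero, ite_mul, zero_mul, Finset.sum_ite_mem,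
        Finset.univ_inter]
      exact Finset.sum_congr rfl fun u hu => by rw [spin_glue_of_mem hu]
    have e4 : ∑ u ∈ Sᶜ, (r i u : ℝ) * spin (glue S A B) u = ∑ u ∈ Sᶜ, (r i u : ℝ) * spin B u :=
      Finset.sum_congr rfl fun u hu => by rw [spin_glue_of_notMem (Finset.mem_compl.1 hu)]
    rw [e3, e4]
    ring

/-- Point probabilities on an event that does not depend on the coordinates in `S` are controlled
by those of the restriction to `S`. -/
theorem IsQuadraticOn.cubeProb_and_le {Y : Finset ι → ℝ} {U : Finset ι} {r : ι → ι → ℤ}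
    {b : ι → ℝ} (h : IsQuadraticOn Y U r b) {n : ℕ} {c : ℝ} (hn : AnticoncentrationBound ι n c)
    {S U' : Finset ι} (hU' : U' ⊆ U) (hS : U' ⊆ S) (hcard : n ≤ U'.card)
    (hrow : ∀ i ∈ U', n ≤ (rowSupport r i ∩ S).card) {p : Finset ι → Prop}
    (hp : ∀ A B, p (glue S A B) ↔ p B) (ℓ : ℝ) :
    cubeProb (fun A => p A ∧ Y A = ℓ) ≤ cubeProb p * c := by
  refine _root_.cubeProb_and_le S hp fun B _ => ?_
  refine hn _ U' _ _ (h.restrict hU' hS B) hcard (fun i hi => ?_) ℓ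
  refine (hrow i hi).trans (Finset.card_le_card fun u hu => ?_)
  simp only [Finset.mem_inter, mem_rowSupport] at hu ⊢
  simp [hu.1, hu.2]

theorem linear_insert_sub_erase (β : ℝ) (c : ι → ℝ) {s : Finset ι} {u : ι} (hu : u ∈ s)
    (A : Finset ι) :
    (β + ∑ v ∈ s, c v * spin (insert u A) v) - (β + ∑ v ∈ s, c v * spin (A.erase u) v)
      = 2 * c u := by
  have h : ∀ v ∈ s, c v * spin (insert u A) v - c v * spin (A.erase u) v =
      if v = u then 2 * c u else 0 := by
    intro v _
    by_cases hv : v = u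
    · subst hv; simp [spin]; ring
    · by_cases hA : v ∈ A <;> simp [spin, hv, hA]
  rw [add_sub_add_left_eq_sub, ← Finset.sum_sub_distrib, Finset.sum_congr rfl h]
  simp [hu]

/-- The Erdős–Littlewood–Offord inequality. -/
theorem cubeProb_abs_le {f : Finset ι → ℝ} {s : Finset ι} (hs : s.Nonempty) {c : ι → ℝ}
    (hf : ∀ u ∈ s, ∀ A, f (insert u A) - f (A.erase u) = 2 * c u) (hc : ∀ u ∈ s, 1 ≤ |c u|)
    {t : ℝ} (ht : 0 ≤ t) : cubeProb (fun A => |f A| ≤ t) ≤ 12 * (1 + t) / √s.card := by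
  have hq : IsQuadraticOn f s (fun _ _ => 0) c :=
    { bound := by simp
      diag := by simp
      symm := by simp
      deriv := fun i hi A => by simp [slopeAt, hf i hi A] }
  have hint : ∀ a : ℝ, cubeProb (fun A => a ≤ f A ∧ f A ≤ a + 1) ≤ 6 / √s.card := by
    intro a
    refine cubeProb_le_of_glue s fun B => ?_
    -- The slopes are constants of size at least 1, so zero weights suffice: no comparable pair is
    -- exceptional, and every nonempty signed sum exceeds g / 2 = 1 / 2.
    refine hq.cubeProb_le_of_pattern hs subset_rfl (s.filter fun u => c u < 0)
      (p := fun A => a ≤ f A ∧ f A ≤ a + 1) (g := 1)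
      (fun A A' hA hA' => by linarith [hA.1, hA'.2]) (y := fun _ _ => 0) (fun _ _ => le_rfl)
      (fun A _ => by simp) (fun A _ R hR hne _ => ?_) B
    have h1 : ∀ i ∈ R, (1 : ℝ) ≤ (if i ∈ s.filter (fun u => c u < 0) then -1 else 1) *
        slopeAt (fun _ _ => 0) c A i := by
      intro i hi
      have := hc i (hR hi)
      by_cases hneg : c i < 0
      · rw [abs_of_neg hneg] at this
        simp [slopeAt, hR hi, hneg, this]
      · rw [abs_of_nonneg (not_lt.1 hneg)] at this
        simp [slopeAt, hneg, this]
    have h2 := Finset.card_nsmul_le_sum R _ _ h1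
    have h3 : (1 : ℝ) ≤ R.card := by exact_mod_cast hne.card_pos
    simp only [nsmul_eq_mul, mul_one] at h2
    linarith
  have hcover : ∀ m : ℕ, cubeProb (fun A => -t ≤ f A ∧ f A ≤ -t + m) ≤ m * (6 / √s.card) +
      6 / √s.card := by
    intro m
    induction m with
    | zero =>
      simp only [Nat.cast_zero, zero_mul, zero_add, add_zero]
      exact (cubeProb_mono fun A hA => ⟨hA.1, by linarith [hA.2]⟩).trans (hint (-t))
    | succ m ih =>
      refine (cubeProb_le_add (q := fun A => -t ≤ f A ∧ f A ≤ -t + m)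
        (r := fun A => -t + m ≤ f A ∧ f A ≤ -t + m + 1) fun A hA => ?_).trans
        ((add_le_add ih (hint (-t + m))).trans ?_)
      · push_cast at hA
        rcases le_total (f A) (-t + m) with h | h
        · exact Or.inl ⟨hA.1, h⟩
        · exact Or.inr ⟨h, by linarith [hA.2]⟩
      · push_cast; linarith
  have hceil := Nat.ceil_lt_add_one (show 0 ≤ 2 * t by linarith)
  have hle := Nat.le_ceil (2 * t)
  -- The interval [-t, t] is covered by ⌈2t⌉ + 1 ≤ 2 (1 + t) unit intervals, each of probability at
  -- most 6 / √|s|.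
  refine (cubeProb_mono fun A hA => ?_).trans ((hcover ⌈2 * t⌉₊).trans ?_)
  · have := abs_le.1 hA
    exact ⟨this.1, by linarith [this.2]⟩
  · have hpos : 0 ≤ 6 / √(s.card : ℝ) := by positivity
    have : 12 * (1 + t) / √(s.card : ℝ) = (2 * t + 1) * (6 / √s.card) + 6 / √s.card := by ring
    rw [this]
    nlinarith

end Quadratic

/-! ### Bernoulli random subsets: a balanced bisection and a sparse generic split. -/

section Bernoulli

variable {ι : Type} [Fintype ι] [DecidableEq ι]

/-- The mean of `f` over a random set containing each element independently with probability
`q`. -/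
noncomputable def bernoulliMean (q : ℝ) (f : Finset ι → ℝ) : ℝ :=
  ∑ P : Finset ι, ((∏ _i ∈ P, q) * ∏ _i ∈ Pᶜ, (1 - q)) * f P

theorem bernoulliMean_add (q : ℝ) (f g : Finset ι → ℝ) :
    bernoulliMean q (fun P => f P + g P) = bernoulliMean q f + bernoulliMean q g := by
  simp only [bernoulliMean, mul_add, Finset.sum_add_distrib]

theorem bernoulliMean_const_mul (q a : ℝ) (f : Finset ι → ℝ) :
    bernoulliMean q (fun P => a * f P) = a * bernoulliMean q f := by
  simp only [bernoulliMean, Finset.mul_sum]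
  exact Finset.sum_congr rfl fun P _ => by ring

theorem bernoulliMean_sum {κ : Type*} (q : ℝ) (s : Finset κ) (f : κ → Finset ι → ℝ) :
    bernoulliMean q (fun P => ∑ k ∈ s, f k P) = ∑ k ∈ s, bernoulliMean q (f k) := by
  simp only [bernoulliMean, Finset.mul_sum]
  exact Finset.sum_comm

theorem bernoulliMean_mono {q : ℝ} (h0 : 0 ≤ q) (h1 : q ≤ 1) {f g : Finset ι → ℝ}
    (h : ∀ P, f P ≤ g P) : bernoulliMean q f ≤ bernoulliMean q g := by
  refine Finset.sum_le_sum fun P _ => mul_le_mul_of_nonneg_left (h P) ?_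
  exact mul_nonneg (Finset.prod_nonneg fun _ _ => h0)
    (Finset.prod_nonneg fun _ _ => by linarith)

theorem bernoulliMean_subset (q : ℝ) (S : Finset ι) :
    bernoulliMean q (fun P => if S ⊆ P then 1 else 0) = q ^ S.card := by
  classical
  have h := Finset.prod_add (fun _ : ι => q) (fun u => if u ∈ S then 0 else 1 - q) Finset.univ
  have e1 : ∏ u : ι, (q + if u ∈ S then 0 else 1 - q) = q ^ S.card := by
    have : ∀ u : ι, (q + if u ∈ S then 0 else 1 - q) = if u ∈ S then q else 1 := by
      intro u; split_ifs <;> ring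
    simp only [this, Finset.prod_ite_mem, Finset.univ_inter, Finset.prod_const]
  rw [e1, Finset.powerset_univ] at h
  rw [h, bernoulliMean]
  refine Finset.sum_congr rfl fun P _ => ?_
  rw [mul_assoc, ← Finset.compl_eq_univ_sdiff]
  congr 1
  split_ifs with hS
  · rw [mul_one]
    refine Finset.prod_congr rfl fun u hu => ?_
    rw [if_neg fun h => Finset.mem_compl.1 hu (hS h)]
  · obtain ⟨u, hu, hP⟩ := Finset.not_subset.1 hS
    rw [mul_zero]
    exact (Finset.prod_eq_zero (Finset.mem_compl.2 hP) (by simp [hu])).symm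

theorem bernoulliMean_const (q a : ℝ) : bernoulliMean q (fun _ : Finset ι => a) = a := by
  have h := bernoulliMean_const_mul q a (fun P : Finset ι => if ∅ ⊆ P then 1 else 0)
  rw [bernoulliMean_subset] at h
  simpa using h

theorem exists_of_bernoulliMean_lt_one {q : ℝ} (h0 : 0 ≤ q) (h1 : q ≤ 1) {f : Finset ι → ℝ}
    (h : bernoulliMean q f < 1) : ∃ P, f P < 1 := by
  by_contra! hcon
  have := bernoulliMean_mono h0 h1 hcon
  rw [bernoulliMean_const] at this
  linarith

theorem card_inter_eq_sum (S P : Finset ι) :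
    ((S ∩ P).card : ℝ) = ∑ u ∈ S, if {u} ⊆ P then (1 : ℝ) else 0 := by
  simp only [Finset.singleton_subset_iff, ← Finset.filter_mem_eq_inter, Finset.sum_boole]

theorem bernoulliMean_card_inter (q : ℝ) (S : Finset ι) :
    bernoulliMean q (fun P => ((S ∩ P).card : ℝ)) = q * S.card := by
  simp only [card_inter_eq_sum, bernoulliMean_sum, bernoulliMean_subset]
  simp [mul_comm]

/-- Disjointness makes the event Q ⊆ P independent of S ∩ P, so only the diagonal terms of the
expanded square survive. -/
theorem bernoulliMean_variance_le {q : ℝ} (h0 : 0 ≤ q) {Q S : Finset ι} (hQS : Disjoint Q S) :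
    bernoulliMean q (fun P => (if Q ⊆ P then 1 else 0) * (((S ∩ P).card : ℝ) - q * S.card) ^ 2) ≤
      q ^ Q.card * (q * S.card) := by
  classical
  set χ : Finset ι → Finset ι → ℝ := fun T P => if T ⊆ P then 1 else 0 with hχ
  have hmul : ∀ T T' P, χ T P * χ T' P = χ (T ∪ T') P := by
    intro T T' P
    by_cases h : T ⊆ P <;> by_cases h' : T' ⊆ P <;> simp [hχ, Finset.union_subset_iff, h, h']
  have hmean : ∀ T, bernoulliMean q (χ T) = q ^ T.card := fun T => bernoulliMean_subset q T
  have hexp : ∀ P, (if Q ⊆ P then 1 else 0) * (((S ∩ P).card : ℝ) - q * S.card) ^ 2 =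
      ∑ u ∈ S, ∑ v ∈ S, (χ (Q ∪ {u} ∪ {v}) P + (-q) * χ (Q ∪ {u}) P + (-q) * χ (Q ∪ {v}) P +
        q ^ 2 * χ Q P) := by
    intro P
    have e : ((S ∩ P).card : ℝ) - q * S.card = ∑ u ∈ S, (χ {u} P - q) := by
      rw [Finset.sum_sub_distrib, card_inter_eq_sum]; simp [hχ, mul_comm]
    rw [e, sq, Finset.sum_mul_sum, Finset.mul_sum]
    refine Finset.sum_congr rfl fun u _ => ?_
    rw [Finset.mul_sum]
    refine Finset.sum_congr rfl fun v _ => ?_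
    rw [← hmul, ← hmul, ← hmul]
    change χ Q P * _ = _
    ring
  simp only [hexp, bernoulliMean_sum, bernoulliMean_add, bernoulliMean_const_mul, hmean]
  have hterm : ∀ u ∈ S, ∑ v ∈ S, (q ^ (Q ∪ {u} ∪ {v}).card + -q * q ^ (Q ∪ {u}).card +
      -q * q ^ (Q ∪ {v}).card + q ^ 2 * q ^ Q.card) ≤ q ^ Q.card * q := by
    intro u hu
    have hc : ∀ w ∈ S, (Q ∪ {w}).card = Q.card + 1 := fun w hw => by
      rw [Finset.card_union_of_disjoint (Finset.disjoint_singleton_right.2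
        (Finset.disjoint_right.1 hQS hw)), Finset.card_singleton]
    rw [Finset.sum_eq_single_of_mem u hu]
    · rw [hc u hu, Finset.union_assoc, Finset.union_self, hc u hu]
      have : 0 ≤ q ^ Q.card * q ^ 2 := by positivity
      nlinarith [this, pow_succ q Q.card]
    · intro v hv hvu
      have : (Q ∪ {u} ∪ {v}).card = Q.card + 2 := by
        rw [Finset.card_union_of_disjoint, hc u hu, Finset.card_singleton]
        simp only [Finset.disjoint_singleton_right, Finset.mem_union, Finset.mem_singleton, not_or]
        exact ⟨Finset.disjoint_right.1 hQS hv, hvu⟩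
      rw [this, hc u hu, hc v hv]
      ring
  calc _ ≤ ∑ u ∈ S, q ^ Q.card * q := Finset.sum_le_sum hterm
    _ = _ := by rw [Finset.sum_const, nsmul_eq_mul]; ring

theorem bernoulliMean_variance_le' {q : ℝ} (h0 : 0 ≤ q) (S : Finset ι) :
    bernoulliMean q (fun P => (((S ∩ P).card : ℝ) - q * S.card) ^ 2) ≤ q * S.card := by
  simpa using bernoulliMean_variance_le h0 (Finset.disjoint_empty_left S)

/-- A balanced bisection. -/
theorem exists_bisection {U : Finset ι} {N : ι → Finset ι} {n : ℕ} (hn : 200 ≤ n)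
    (hU : U.card = n) (hN : ∀ i ∈ U, n ≤ (N i).card) :
    ∃ V : Finset ι,
      (n : ℝ) / 4 ≤ ((U ∩ V).filter fun i => (n : ℝ) / 4 ≤ (N i ∩ V).card).card ∧
      (n : ℝ) / 4 ≤ ((U ∩ Vᶜ).filter fun i => (n : ℝ) / 4 ≤ (N i ∩ Vᶜ).card).card := by
  classical
  have hnr : (200 : ℝ) ≤ n := by exact_mod_cast hn
  have hn0 : (0 : ℝ) < n := by linarith
  set F : ι → Finset ι → ℝ := fun i P =>
    (((N i ∩ P).card : ℝ) - 1 / 2 * (N i).card) ^ 2 with hF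
  -- If X < 1, then |U ∩ P| is within n / 8 of n / 2. Each badly split row contributes at least 16 /
  -- n, so there are at most n / 16 of these, and each half retains 3n / 8 - n / 16 ≥ n / 4 good
  -- rows.
  set X : Finset ι → ℝ := fun P => 64 / n ^ 2 * (((U ∩ P).card : ℝ) - 1 / 2 * U.card) ^ 2 +
    ∑ i ∈ U, 256 / (n * ((N i).card : ℝ) ^ 2) * F i P with hX
  have hmean : bernoulliMean (1 / 2) X < 1 := by
    rw [hX, bernoulliMean_add, bernoulliMean_const_mul, bernoulliMean_sum]
    simp only [bernoulliMean_const_mul]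
    have h1 := bernoulliMean_variance_le' (q := 1 / 2) (by norm_num) U
    have h2 : ∀ i ∈ U, 256 / (n * ((N i).card : ℝ) ^ 2) * bernoulliMean (1 / 2) (F i) ≤
        128 / n ^ 2 := by
      intro i hi
      have hd : (n : ℝ) ≤ (N i).card := by exact_mod_cast hN i hi
      have h3 := bernoulliMean_variance_le' (q := 1 / 2) (by norm_num) (N i)
      have h4 : (0 : ℝ) < (N i).card := by linarith
      calc _ ≤ 256 / (n * ((N i).card : ℝ) ^ 2) * (1 / 2 * (N i).card) := by gcongr
        _ = 128 / (n * (N i).card) := by field_simp; norm_num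
        _ ≤ _ := by rw [sq]; gcongr
    have h3 := Finset.sum_le_sum h2
    rw [Finset.sum_const, hU, nsmul_eq_mul] at h3
    rw [hU] at h1
    have h4 : 64 / (n : ℝ) ^ 2 * bernoulliMean (1 / 2)
        (fun P => (((U ∩ P).card : ℝ) - 1 / 2 * U.card) ^ 2) ≤ 64 / n ^ 2 * (1 / 2 * n) := by
      rw [hU]; gcongr
    have h5 : 64 / (n : ℝ) ^ 2 * (1 / 2 * n) + n * (128 / n ^ 2) = 160 / n := by
      field_simp; norm_num
    have h6 : 160 / (n : ℝ) < 1 := by rw [div_lt_one hn0]; linarith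
    linarith
  obtain ⟨V, hV⟩ := exists_of_bernoulliMean_lt_one (by norm_num) (by norm_num) hmean
  have hF0 : ∀ i ∈ U, 0 ≤ 256 / (n * ((N i).card : ℝ) ^ 2) * F i V := fun i _ => by positivity
  have hs0 := Finset.sum_nonneg hF0
  have hU1 : 64 / (n : ℝ) ^ 2 * (((U ∩ V).card : ℝ) - 1 / 2 * n) ^ 2 < 1 := by
    have := hV; rw [hX] at this; simp only [hU] at this; linarith
  have hs1 : ∑ i ∈ U, 256 / (n * ((N i).card : ℝ) ^ 2) * F i V < 1 := by
    have : 0 ≤ 64 / (n : ℝ) ^ 2 * (((U ∩ V).card : ℝ) - 1 / 2 * U.card) ^ 2 := by positivity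
    have := hV; rw [hX] at this; linarith
  have hU2 : |((U ∩ V).card : ℝ) - 1 / 2 * n| ≤ n / 8 := by
    refine abs_le_of_sq_le_sq ?_ (by positivity)
    rw [div_mul_eq_mul_div, div_lt_one (by positivity)] at hU1
    linarith
  have hcompl : ∀ S : Finset ι, ((S ∩ Vᶜ).card : ℝ) = S.card - (S ∩ V).card := by
    intro S
    have : (S ∩ V).card + (S ∩ Vᶜ).card = S.card := by
      rw [← Finset.sdiff_eq_inter_compl]; exact Finset.card_inter_add_card_sdiff S V
    rw [← this]; push_cast; ring
  set Bad := U.filter fun i => ¬ |((N i ∩ V).card : ℝ) - 1 / 2 * (N i).card| ≤ (N i).card / 4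
  have hBad : (Bad.card : ℝ) ≤ n / 16 := by
    have h1 : ∑ i ∈ Bad, (16 / n : ℝ) ≤ ∑ i ∈ U, 256 / (n * ((N i).card : ℝ) ^ 2) * F i V := by
      refine (Finset.sum_le_sum fun i hi => ?_).trans
        (Finset.sum_le_sum_of_subset_of_nonneg (Finset.filter_subset _ _) fun i hi _ => hF0 i hi)
      obtain ⟨hiU, hi⟩ := Finset.mem_filter.1 hi
      have hd : (n : ℝ) ≤ (N i).card := by exact_mod_cast hN i hiU
      have hd0 : (0 : ℝ) < (N i).card := by linarith
      have h2 : (((N i).card : ℝ) / 4) ^ 2 ≤ F i V := by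
        simp only [hF]
        rw [← sq_abs (((N i ∩ V).card : ℝ) - _)]
        exact pow_le_pow_left₀ (by positivity) (not_le.1 hi).le 2
      calc (16 / n : ℝ) = 256 / (n * ((N i).card : ℝ) ^ 2) * (((N i).card : ℝ) / 4) ^ 2 := by
            field_simp; norm_num
        _ ≤ _ := by gcongr
    rw [Finset.sum_const, nsmul_eq_mul] at h1
    have h2 : (Bad.card : ℝ) * (16 / n) ≤ 1 := h1.trans hs1.le
    rw [mul_div_assoc', div_le_one hn0] at h2
    linarith
  have hgood : ∀ i ∈ U, i ∉ Bad → (n : ℝ) / 4 ≤ (N i ∩ V).card ∧ (n : ℝ) / 4 ≤ (N i ∩ Vᶜ).card := by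
    intro i hi hib
    have h1 : |((N i ∩ V).card : ℝ) - 1 / 2 * (N i).card| ≤ (N i).card / 4 := by
      by_contra h; exact hib (Finset.mem_filter.2 ⟨hi, h⟩)
    have hd : (n : ℝ) ≤ (N i).card := by exact_mod_cast hN i hi
    rw [hcompl]
    have := abs_le.1 h1
    constructor <;> linarith
  have hfin : ∀ W : Finset ι, (n : ℝ) * 3 / 8 ≤ (U ∩ W).card →
      (∀ i ∈ U, i ∉ Bad → (n : ℝ) / 4 ≤ (N i ∩ W).card) →
      (n : ℝ) / 4 ≤ ((U ∩ W).filter fun i => (n : ℝ) / 4 ≤ (N i ∩ W).card).card := by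
    intro W h1 h2
    have h3 : (U ∩ W).card ≤ ((U ∩ W).filter fun i => (n : ℝ) / 4 ≤ (N i ∩ W).card).card +
        Bad.card := by
      refine (Finset.card_le_card fun i hi => ?_).trans (Finset.card_union_le _ _)
      by_cases hb : i ∈ Bad
      · exact Finset.mem_union_right _ hb
      · exact Finset.mem_union_left _ (Finset.mem_filter.2 ⟨hi, h2 i (Finset.mem_inter.1 hi).1 hb⟩)
    have h4 : ((U ∩ W).card : ℝ) ≤ ((U ∩ W).filter fun i =>
      (n : ℝ) / 4 ≤ (N i ∩ W).card).card + Bad.card := by exact_mod_cast h3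
    linarith
  have := abs_le.1 hU2
  refine ⟨V, hfin V (by linarith) fun i h1 h2 => (hgood i h1 h2).1,
    hfin Vᶜ ?_ fun i h1 h2 => (hgood i h1 h2).2⟩
  rw [hcompl, hU]; linarith

set_option maxHeartbeats 1600000 in
open Classical in
/-- A sparse set of coordinates that is generic with respect to the rows `N i`, a distinguished row,
a sparse set of pairs, and a family of weights. -/
theorem exists_sparse_split {γ : Type*} {U : Finset ι} {N : ι → Finset ι} {n : ℕ} {ε ρ : ℝ}
    (hε : 0 < ε) (hε1 : ε ≤ 1 / 64) (hn : 100 ≤ ε * n) (hU : U.card = n)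
    (hN : ∀ i ∈ U, n ≤ (N i).card) (hNi : ∀ i ∈ U, i ∉ N i) {s : ι} (hs : s ∈ U)
    (bad : ι → ι → Prop) (hρ : 0 < ρ)
    (hbad : (((U ×ˢ U).filter fun e => bad e.1 e.2).card : ℝ) ≤ ρ * n ^ 2)
    (Γ : Finset γ) (hΓ : Γ.card ≤ 6) (q : γ → ι → ι → ι → ℝ) (hq : ∀ c i j u, 0 ≤ q c i j u) :
    ∃ P R : Finset ι, R ⊆ U ∩ P ∧ ((U ∩ P).card : ℝ) ≤ 2 * (ε * n) ∧ ε * n / 4 ≤ R.card ∧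
      (∀ i ∈ R, ε * (N i).card / 2 ≤ (N i ∩ P).card ∧
        ((N i ∩ P).card : ℝ) ≤ 2 * ε * (N i).card) ∧
      (n : ℝ) / 2 ≤ ((U ∩ Pᶜ).filter fun i => (n : ℝ) / 2 ≤ (N i ∩ Pᶜ).card).card ∧
      ((N s ∩ P).card : ℝ) ≤ 8 * ε * (N s).card ∧
      ((((U ∩ P) ×ˢ (U ∩ P)).filter fun e => e.1 ≠ e.2 ∧ bad e.1 e.2).card : ℝ) ≤
        8 * ρ * (ε * n) ^ 2 ∧
      ((((U ∩ P) ×ˢ (U ∩ P)).filter fun e => e.1 ≠ e.2 ∧ ∃ c ∈ Γ,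
          (∑ u ∈ {e.1, e.2}ᶜ, q c e.1 e.2 u) / 2 < ∑ u ∈ {e.1, e.2}ᶜ ∩ P, q c e.1 e.2 u).card : ℝ) ≤
        96 * ε * (ε * n) ^ 2 := by
  classical
  have hn0 : (0 : ℝ) < n := by
    by_contra h
    have : (n : ℝ) ≤ 0 := not_lt.1 h
    nlinarith
  have hNr : ∀ i ∈ U, (n : ℝ) ≤ (N i).card := fun i hi => by exact_mod_cast hN i hi
  have hN0 : ∀ i ∈ U, (0 : ℝ) < (N i).card := fun i hi => hn0.trans_le (hNr i hi)
  set χ : Finset ι → Finset ι → ℝ := fun T P => if T ⊆ P then 1 else 0 with hχ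
  have hχ0 : ∀ T P, 0 ≤ χ T P := fun T P => by simp only [hχ]; split_ifs <;> norm_num
  have hmean : ∀ T, bernoulliMean ε (χ T) = ε ^ T.card := fun T => bernoulliMean_subset ε T
  set En := U.offDiag with hEn
  -- Each of the six quantities is normalized so that being at most 1 gives one requirement: the
  -- size of U ∩ P, rows of P with atypical trace on P, rows lying largely in P, the row s, bad
  -- pairs, and pairs whose weight concentrates on P. In X2 the membership of i in P is independent
  -- of the trace of row i because i ∉ N i. In X6 the endpoints are excluded from the weight, so the
  -- triples are genuine and have probability ε³.
  set X1 : Finset ι → ℝ := fun P => 4 / (ε * n) ^ 2 * (((U ∩ P).card : ℝ) - ε * U.card) ^ 2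
  set X2 : Finset ι → ℝ := fun P => ∑ i ∈ U, 16 / ((ε * n) * (ε * (N i).card) ^ 2) *
    (χ {i} P * (((N i ∩ P).card : ℝ) - ε * (N i).card) ^ 2)
  set X3 : Finset ι → ℝ := fun P => ∑ i ∈ U, 8 / (n * (N i).card) * ((N i ∩ P).card : ℝ)
  set X4 : Finset ι → ℝ := fun P => 1 / (8 * ε * (N s).card) * ((N s ∩ P).card : ℝ)
  set X5 : Finset ι → ℝ := fun P => ∑ e ∈ En with bad e.1 e.2,
    1 / (8 * ρ * (ε * n) ^ 2) * χ {e.1, e.2} P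
  set X6 : Finset ι → ℝ := fun P => ∑ e ∈ En, ∑ c ∈ Γ, ∑ u ∈ {e.1, e.2}ᶜ,
    1 / (48 * ε * (ε * n) ^ 2) * (q c e.1 e.2 u / ∑ v ∈ {e.1, e.2}ᶜ, q c e.1 e.2 v) *
      χ {e.1, e.2, u} P
  have m1 : bernoulliMean ε X1 ≤ 4 / 100 := by
    have h1 := bernoulliMean_variance_le' hε.le U
    rw [bernoulliMean_const_mul]
    calc _ ≤ 4 / (ε * n) ^ 2 * (ε * U.card) := by gcongr
      _ = 4 / (ε * n) := by rw [hU]; field_simp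
      _ ≤ _ := by gcongr
  have m2 : bernoulliMean ε X2 ≤ 16 / 100 := by
    rw [bernoulliMean_sum]
    simp only [bernoulliMean_const_mul]
    have h2 : ∀ i ∈ U, 16 / ((ε * n) * (ε * (N i).card) ^ 2) * bernoulliMean ε
        (fun P => χ {i} P * (((N i ∩ P).card : ℝ) - ε * (N i).card) ^ 2) ≤
        16 / (ε * n) / n := by
      intro i hi
      have h3 := bernoulliMean_variance_le hε.le (Finset.disjoint_singleton_left.2 (hNi i hi))
      rw [Finset.card_singleton, pow_one] at h3
      have := hN0 i hi
      calc _ ≤ 16 / ((ε * n) * (ε * (N i).card) ^ 2) * (ε * (ε * (N i).card)) := by gcongr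
        _ = 16 / (ε * n) / (N i).card := by field_simp
        _ ≤ _ := by gcongr; exact hN i hi
    have h3 := Finset.sum_le_sum h2
    rw [Finset.sum_const, hU, nsmul_eq_mul] at h3
    refine h3.trans ?_
    rw [mul_div_cancel₀ _ hn0.ne']
    gcongr
  have m3 : bernoulliMean ε X3 ≤ 8 / 64 := by
    rw [bernoulliMean_sum]
    simp only [bernoulliMean_const_mul, bernoulliMean_card_inter]
    have h2 : ∀ i ∈ U, 8 / (n * (N i).card) * (ε * (N i).card) = 8 * ε / n := by
      intro i hi
      have := (hN0 i hi).ne'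
      field_simp
    rw [Finset.sum_congr rfl h2, Finset.sum_const, hU, nsmul_eq_mul, mul_div_cancel₀ _ hn0.ne']
    linarith
  have m4 : bernoulliMean ε X4 ≤ 1 / 8 := by
    rw [bernoulliMean_const_mul, bernoulliMean_card_inter]
    have := (hN0 s hs).ne'
    have : 1 / (8 * ε * ((N s).card : ℝ)) * (ε * (N s).card) = 1 / 8 := by field_simp
    exact this.le
  have m5 : bernoulliMean ε X5 ≤ 1 / 8 := by
    rw [bernoulliMean_sum]
    simp only [bernoulliMean_const_mul, hmean]
    have h2 : ∀ e ∈ En.filter (fun e => bad e.1 e.2), 1 / (8 * ρ * (ε * n) ^ 2) *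
        ε ^ ({e.1, e.2} : Finset ι).card = 1 / (8 * ρ * n ^ 2) := by
      intro e he
      have := (Finset.mem_offDiag.1 (Finset.mem_filter.1 he).1).2.2
      rw [Finset.card_pair this]
      field_simp
    rw [Finset.sum_congr rfl h2, Finset.sum_const, nsmul_eq_mul]
    have h3 : ((En.filter fun e => bad e.1 e.2).card : ℝ) ≤ ρ * n ^ 2 := by
      refine le_trans ?_ hbad
      norm_cast
      refine Finset.card_le_card (Finset.filter_subset_filter _ fun e he => ?_)
      have := Finset.mem_offDiag.1 he
      exact Finset.mem_product.2 ⟨this.1, this.2.1⟩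
    calc _ ≤ ρ * n ^ 2 * (1 / (8 * ρ * n ^ 2)) := by gcongr
      _ = _ := by field_simp
  have m6 : bernoulliMean ε X6 ≤ 1 / 8 := by
    simp only [X6, bernoulliMean_sum, bernoulliMean_const_mul, hmean]
    have h2 : ∀ e ∈ En, ∀ c ∈ Γ, ∑ u ∈ {e.1, e.2}ᶜ, 1 / (48 * ε * (ε * n) ^ 2) *
        (q c e.1 e.2 u / ∑ v ∈ {e.1, e.2}ᶜ, q c e.1 e.2 v) *
          ε ^ ({e.1, e.2, u} : Finset ι).card ≤ 1 / (48 * (n : ℝ) ^ 2) := by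
      intro e he c _
      have hne := (Finset.mem_offDiag.1 he).2.2
      have h3 : ∀ u ∈ ({e.1, e.2}ᶜ : Finset ι), 1 / (48 * ε * (ε * n) ^ 2) *
        (q c e.1 e.2 u / ∑ v ∈ {e.1, e.2}ᶜ, q c e.1 e.2 v) *
          ε ^ ({e.1, e.2, u} : Finset ι).card =
          1 / (48 * n ^ 2) * (q c e.1 e.2 u / ∑ v ∈ {e.1, e.2}ᶜ, q c e.1 e.2 v) := by
        intro u hu
        simp only [Finset.mem_compl, Finset.mem_insert, Finset.mem_singleton, not_or] at hu
        rw [Finset.card_eq_three.2 ⟨e.1, e.2, u, hne, fun h => hu.1 h.symm,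
          fun h => hu.2 h.symm, rfl⟩]
        field_simp
      rw [Finset.sum_congr rfl h3, ← Finset.mul_sum, ← Finset.sum_div]
      exact mul_le_of_le_one_right (by positivity) (div_self_le_one _)
    have h3 : ∀ e ∈ En, ∑ c ∈ Γ, ∑ u ∈ {e.1, e.2}ᶜ, 1 / (48 * ε * (ε * n) ^ 2) *
        (q c e.1 e.2 u / ∑ v ∈ {e.1, e.2}ᶜ, q c e.1 e.2 v) *
          ε ^ ({e.1, e.2, u} : Finset ι).card ≤ 6 * (1 / (48 * (n : ℝ) ^ 2)) := by
      intro e he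
      refine (Finset.sum_le_sum (h2 e he)).trans ?_
      rw [Finset.sum_const, nsmul_eq_mul]
      gcongr
      exact_mod_cast hΓ
    refine (Finset.sum_le_sum h3).trans ?_
    rw [Finset.sum_const, nsmul_eq_mul]
    have h4 : (En.card : ℝ) ≤ n ^ 2 := by
      rw [hEn, Finset.offDiag_card, hU]
      have : n * n - n ≤ n ^ 2 := by rw [sq]; exact Nat.sub_le _ _
      exact_mod_cast this
    calc _ ≤ (n : ℝ) ^ 2 * (6 * (1 / (48 * n ^ 2))) := by gcongr
      _ = _ := by field_simp; norm_num
  -- The means add up to at most 0.04 + 0.16 + 4 · 0.125 = 0.7, so a single P satisfies all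
  -- requirements.
  have htot : bernoulliMean ε (fun P => X1 P + (X2 P + (X3 P + (X4 P + (X5 P + X6 P))))) < 1 := by
    rw [bernoulliMean_add, bernoulliMean_add, bernoulliMean_add, bernoulliMean_add,
      bernoulliMean_add]
    linarith
  obtain ⟨P, hP⟩ := exists_of_bernoulliMean_lt_one hε.le (by linarith) htot
  have z1 : 0 ≤ X1 P := by positivity
  have t2 : ∀ i ∈ U, 0 ≤ 16 / ((ε * n) * (ε * (N i).card) ^ 2) *
    (χ {i} P * (((N i ∩ P).card : ℝ) - ε * (N i).card) ^ 2) := fun i _ =>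
      mul_nonneg (by positivity) (mul_nonneg (hχ0 _ _) (sq_nonneg _))
  have z2 : 0 ≤ X2 P := Finset.sum_nonneg t2
  have t3 : ∀ i ∈ U, 0 ≤ 8 / (n * (N i).card) * ((N i ∩ P).card : ℝ) := fun i _ => by positivity
  have z3 : 0 ≤ X3 P := Finset.sum_nonneg t3
  have z4 : 0 ≤ X4 P := by positivity
  have z5 : 0 ≤ X5 P := Finset.sum_nonneg fun e _ => mul_nonneg (by positivity) (hχ0 _ _)
  have t6 : ∀ e ∈ En, ∀ c ∈ Γ, 0 ≤ ∑ u ∈ {e.1, e.2}ᶜ, 1 / (48 * ε * (ε * n) ^ 2) *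
      (q c e.1 e.2 u / ∑ v ∈ {e.1, e.2}ᶜ, q c e.1 e.2 v) * χ {e.1, e.2, u} P := by
    intro e _ c _
    refine Finset.sum_nonneg fun u _ => mul_nonneg (mul_nonneg (by positivity) ?_) (hχ0 _ _)
    exact div_nonneg (hq _ _ _ _) (Finset.sum_nonneg fun v _ => hq _ _ _ _)
  have z6 : 0 ≤ X6 P := Finset.sum_nonneg fun e he => Finset.sum_nonneg fun c hc => t6 e he c hc
  set R := (U ∩ P).filter fun i => |((N i ∩ P).card : ℝ) - ε * (N i).card| ≤ ε * (N i).card / 2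
    with hR
  have c1 : |((U ∩ P).card : ℝ) - ε * n| ≤ ε * n / 2 := by
    refine abs_le_of_sq_le_sq ?_ (by positivity)
    have h1 : X1 P < 1 := by linarith
    simp only [X1, hU] at h1
    rw [div_mul_eq_mul_div, div_lt_one (by positivity)] at h1
    linarith
  have c1' := abs_le.1 c1
  have c2 : (((U ∩ P) \ R).card : ℝ) ≤ ε * n / 4 := by
    have h1 : ∑ i ∈ (U ∩ P) \ R, (4 / (ε * n) : ℝ) ≤ X2 P := by
      refine (Finset.sum_le_sum fun i hi => ?_).trans
        (Finset.sum_le_sum_of_subset_of_nonneg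
          (Finset.sdiff_subset.trans Finset.inter_subset_left) fun i hi _ => t2 i hi)
      obtain ⟨hi1, hi2⟩ := Finset.mem_sdiff.1 hi
      obtain ⟨hiU, hiP⟩ := Finset.mem_inter.1 hi1
      have hd := hN0 i hiU
      have h3 : ε * (N i).card / 2 < |((N i ∩ P).card : ℝ) - ε * (N i).card| := by
        by_contra h; exact hi2 (Finset.mem_filter.2 ⟨hi1, not_lt.1 h⟩)
      have h2 : (ε * ((N i).card : ℝ) / 2) ^ 2 ≤ (((N i ∩ P).card : ℝ) - ε * (N i).card) ^ 2 := by
        rw [← sq_abs (((N i ∩ P).card : ℝ) - _)]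
        exact pow_le_pow_left₀ (by positivity) h3.le 2
      have h4 : χ {i} P = 1 := by simp [hχ, hiP]
      rw [h4, one_mul]
      calc (4 / (ε * n) : ℝ) = 16 / ((ε * n) * (ε * (N i).card) ^ 2) *
            (ε * ((N i).card : ℝ) / 2) ^ 2 := by field_simp; norm_num
        _ ≤ _ := by gcongr
    rw [Finset.sum_const, nsmul_eq_mul] at h1
    have h2 : (((U ∩ P) \ R).card : ℝ) * (4 / (ε * n)) ≤ 1 := by linarith
    rw [mul_div_assoc', div_le_one (by positivity)] at h2
    linarith
  have hRsub : R ⊆ U ∩ P := Finset.filter_subset _ _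
  have c3 : ε * n / 4 ≤ R.card := by
    have : (((U ∩ P) \ R).card : ℝ) = (U ∩ P).card - R.card := by
      rw [Finset.card_sdiff_of_subset hRsub, Nat.cast_sub (Finset.card_le_card hRsub)]
    linarith
  have hcompl : ∀ S : Finset ι, ((S ∩ Pᶜ).card : ℝ) = S.card - (S ∩ P).card := by
    intro S
    have : (S ∩ P).card + (S ∩ Pᶜ).card = S.card := by
      rw [← Finset.sdiff_eq_inter_compl]; exact Finset.card_inter_add_card_sdiff S P
    rw [← this]; push_cast; ring
  refine ⟨P, R, hRsub, by linarith, c3, ?_, ?_, ?_, ?_, ?_⟩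
  · intro i hi
    have := abs_le.1 (Finset.mem_filter.1 hi).2
    have := hN0 i (Finset.mem_inter.1 (hRsub hi)).1
    have : 0 < ε * (N i).card := by positivity
    constructor <;> linarith
  · set G := (U ∩ Pᶜ).filter fun i => (n : ℝ) / 2 ≤ (N i ∩ Pᶜ).card with hG
    set H := (U ∩ Pᶜ) \ G with hH
    have h1 : (H.card : ℝ) ≤ n / 4 := by
      have h1 : ∑ i ∈ H, (4 / n : ℝ) ≤ X3 P := by
        refine (Finset.sum_le_sum fun i hi => ?_).trans
          (Finset.sum_le_sum_of_subset_of_nonneg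
            (Finset.sdiff_subset.trans Finset.inter_subset_left) fun i hi _ => t3 i hi)
        obtain ⟨hi1, hi2⟩ := Finset.mem_sdiff.1 hi
        have hiU := (Finset.mem_inter.1 hi1).1
        have hd := hN0 i hiU
        have h3 : ((N i ∩ Pᶜ).card : ℝ) < n / 2 := by
          by_contra h; exact hi2 (Finset.mem_filter.2 ⟨hi1, not_lt.1 h⟩)
        rw [hcompl] at h3
        have h4 := hNr i hiU
        rw [div_mul_eq_mul_div, div_le_div_iff₀ hn0 (by positivity)]
        have : ((N i).card : ℝ) / 2 ≤ (N i ∩ P).card := by linarith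
        nlinarith
      rw [Finset.sum_const, nsmul_eq_mul] at h1
      have h2 : (H.card : ℝ) * (4 / n) ≤ 1 := by linarith
      rw [mul_div_assoc', div_le_one (by positivity)] at h2
      linarith
    have h2 : (H.card : ℝ) = (U ∩ Pᶜ).card - G.card := by
      rw [hH, Finset.card_sdiff_of_subset (Finset.filter_subset _ _),
        Nat.cast_sub (Finset.card_le_card (Finset.filter_subset _ _))]
    rw [hcompl, hU] at h2
    have : ε * n ≤ 1 / 64 * n := by gcongr
    linarith
  · have h1 : X4 P ≤ 1 := by linarith
    simp only [X4] at h1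
    have := hN0 s hs
    rw [one_div_mul_eq_div, div_le_one (by positivity)] at h1
    exact h1
  · have h1 : X5 P ≤ 1 := by linarith
    simp only [X5] at h1
    rw [← Finset.mul_sum, one_div_mul_eq_div, div_le_one (by positivity)] at h1
    refine le_trans ?_ h1
    simp only [hχ, Finset.sum_boole, Finset.filter_filter]
    norm_cast
    refine Finset.card_le_card fun e he => ?_
    simp only [Finset.mem_filter, Finset.mem_product, Finset.mem_inter, hEn, Finset.mem_offDiag,
      Finset.insert_subset_iff, Finset.singleton_subset_iff] at he ⊢
    tauto
  · set Ex := ((U ∩ P) ×ˢ (U ∩ P)).filter fun e => e.1 ≠ e.2 ∧ ∃ c ∈ Γ,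
          (∑ u ∈ {e.1, e.2}ᶜ, q c e.1 e.2 u) / 2 < ∑ u ∈ {e.1, e.2}ᶜ ∩ P, q c e.1 e.2 u with hEx
    have h1 : X6 P ≤ 1 := by linarith
    have h2 : ∑ e ∈ Ex, 1 / (96 * ε * (ε * n) ^ 2) ≤ X6 P := by
      have hsub : Ex ⊆ En := by
        intro e he
        simp only [hEx, Finset.mem_filter, Finset.mem_product, Finset.mem_inter] at he
        exact Finset.mem_offDiag.2 ⟨he.1.1.1, he.1.2.1, he.2.1⟩
      refine (Finset.sum_le_sum fun e he => ?_).trans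
        (Finset.sum_le_sum_of_subset_of_nonneg hsub fun e he _ =>
          Finset.sum_nonneg fun c hc => t6 e he c hc)
      have heEn := hsub he
      obtain ⟨he1, hne, c, hc, hlt⟩ := Finset.mem_filter.1 he
      refine le_trans ?_ (Finset.single_le_sum (fun c hc => t6 e heEn c hc) hc)
      obtain ⟨ha, hb⟩ := Finset.mem_product.1 he1
      have haP := (Finset.mem_inter.1 ha).2
      have hbP := (Finset.mem_inter.1 hb).2
      set tot := ∑ v ∈ {e.1, e.2}ᶜ, q c e.1 e.2 v with htotdef
      have htot0 : 0 < tot := by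
        have h5 : 0 ≤ tot := Finset.sum_nonneg fun v _ => hq _ _ _ _
        have h6 : ∑ u ∈ {e.1, e.2}ᶜ ∩ P, q c e.1 e.2 u ≤ tot :=
          Finset.sum_le_sum_of_subset_of_nonneg Finset.inter_subset_left fun _ _ _ => hq _ _ _ _
        rcases h5.lt_or_eq with h | h
        · exact h
        · rw [← h] at hlt h6; linarith
      have h5 : ∑ u ∈ {e.1, e.2}ᶜ, 1 / (48 * ε * (ε * n) ^ 2) * (q c e.1 e.2 u / tot) *
          χ {e.1, e.2, u} P = 1 / (48 * ε * (ε * n) ^ 2) *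
            ((∑ u ∈ {e.1, e.2}ᶜ ∩ P, q c e.1 e.2 u) / tot) := by
        rw [Finset.sum_div, Finset.mul_sum, ← Finset.filter_mem_eq_inter, Finset.sum_filter]
        refine Finset.sum_congr rfl fun u _ => ?_
        by_cases hu : u ∈ P <;> simp [hχ, Finset.insert_subset_iff, haP, hbP, hu]
      rw [h5]
      have h6 : 1 / 2 ≤ (∑ u ∈ {e.1, e.2}ᶜ ∩ P, q c e.1 e.2 u) / tot := by
        rw [le_div_iff₀ htot0]; linarith
      calc 1 / (96 * ε * (ε * n) ^ 2) = 1 / (48 * ε * (ε * n) ^ 2) * (1 / 2) := by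
            field_simp; norm_num
        _ ≤ _ := by gcongr
    rw [Finset.sum_const, nsmul_eq_mul] at h2
    have h3 : (Ex.card : ℝ) * (1 / (96 * ε * (ε * n) ^ 2)) ≤ 1 := by linarith
    rw [mul_one_div, div_le_one (by positivity)] at h3
    exact h3

end Bernoulli

/-! ### Small ball probabilities for one slope and jointly for two slopes. -/

section Pairs

variable {ι : Type} [Fintype ι] [DecidableEq ι]

theorem glue_insert {S : Finset ι} {u : ι} (hu : u ∈ S) (A B : Finset ι) :
    glue S (insert u A) B = insert u (glue S A B) := by
  ext x
  by_cases hx : x = u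
  · subst hx; simp [mem_glue, hu]
  · simp [mem_glue, hx]

theorem glue_erase {S : Finset ι} {u : ι} (hu : u ∈ S) (A B : Finset ι) :
    glue S (A.erase u) B = (glue S A B).erase u := by
  ext x
  by_cases hx : x = u
  · subst hx; simp [mem_glue, hu]
  · simp [mem_glue, hx]

/-- Small ball estimate for a linear form, conditionally on an event that does not depend on the
coordinates in `s'`. -/
theorem cubeProb_and_abs_linear_le {s s' : Finset ι} (hs' : s' ⊆ s) (hne : s'.Nonempty)
    {c : ι → ℝ} (hc : ∀ u ∈ s', 1 ≤ |c u|) (β : ℝ) {t : ℝ} (ht : 0 ≤ t) {q : Finset ι → Prop}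
    (hq : ∀ A B, q (glue s' A B) ↔ q B) :
    cubeProb (fun A => q A ∧ |β + ∑ u ∈ s, c u * spin A u| ≤ t) ≤
      cubeProb q * (12 * (1 + t) / √s'.card) := by
  refine cubeProb_and_le s' hq fun B _ => ?_
  refine cubeProb_abs_le (f := fun A => β + ∑ u ∈ s, c u * spin (glue s' A B) u) hne (c := c)
    (fun u hu A => ?_) hc ht
  rw [glue_insert hu, glue_erase hu]
  exact linear_insert_sub_erase β c (hs' hu) _

theorem cubeProb_abs_linear_le {s s' : Finset ι} (hs' : s' ⊆ s) (hne : s'.Nonempty)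
    {c : ι → ℝ} (hc : ∀ u ∈ s', 1 ≤ |c u|) (β : ℝ) {t : ℝ} (ht : 0 ≤ t) :
    cubeProb (fun A => |β + ∑ u ∈ s, c u * spin A u| ≤ t) ≤ 12 * (1 + t) / √s'.card :=
  cubeProb_abs_le (f := fun A => β + ∑ u ∈ s, c u * spin A u) hne
    (fun _ hu _ => linear_insert_sub_erase β c (hs' hu) _) hc ht

theorem cubeProb_sq_linear_ge_le (s : Finset ι) (β : ℝ) (c : ι → ℝ) {t : ℝ} (ht : 0 < t) :
    cubeProb (fun A => t ≤ |β + ∑ u ∈ s, c u * spin A u|) ≤ (β ^ 2 + ∑ u ∈ s, c u ^ 2) / t ^ 2 := by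
  rw [← cubeMean_linear_sq]
  refine cubeProb_le_cubeMean_div (fun _ => sq_nonneg _) (by positivity) fun A hA => ?_
  rw [← sq_abs (β + _)]
  exact pow_le_pow_left₀ ht.le hA 2

/-- Anticoncentration of an affine form in terms of its second moment. -/
theorem cubeProb_abs_linear_le_of_variance {s : Finset ι} {c : ι → ℝ}
    (hc : ∀ u ∈ s, c u ≠ 0 → 1 / 2 ≤ |c u|) (hb : ∀ u ∈ s, |c u| ≤ 6) {β η t W : ℝ} (hη : 0 < η)
    (hη1 : η ≤ 1 / 2) (ht : 1 ≤ t) (hW : 0 < W) (h : W ^ 2 ≤ β ^ 2 + ∑ u ∈ s, c u ^ 2) :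
    cubeProb (fun A => |β + ∑ u ∈ s, c u * spin A u| ≤ t) ≤ 16 * η + 216 * t / (√η * W) := by
  have hη' : 0 < √η := Real.sqrt_pos.2 hη
  have hη2 : √η ≤ 1 := Real.sqrt_le_one.2 (by linarith)
  have hnn : 0 ≤ 216 * t / (√η * W) := by positivity
  rcases lt_or_ge (W / 4) t with htW | htW
  · refine (cubeProb_le_one _).trans ?_
    have : 1 ≤ 216 * t / (√η * W) := by
      rw [le_div_iff₀ (by positivity)]
      have : √η * W ≤ 1 * W := by gcongr
      linarith
    linarith
  -- Either the coefficients carry a share η of the second moment, so many are nonzero and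
  -- Littlewood–Offord applies, or the constant term dominates and Chebyshev's inequality keeps the
  -- form away from 0.
  rcases le_or_gt (η * W ^ 2) (∑ u ∈ s, c u ^ 2) with hV | hV
  · set s' := s.filter fun u => c u ≠ 0 with hs'
    have h1 : ∑ u ∈ s, c u ^ 2 ≤ 36 * s'.card := by
      have : ∑ u ∈ s, c u ^ 2 = ∑ u ∈ s', c u ^ 2 := by
        rw [hs', Finset.sum_filter_of_ne]
        intro u _ hu h0
        exact hu (by rw [h0]; norm_num)
      rw [this, mul_comm, ← nsmul_eq_mul]
      refine Finset.sum_le_card_nsmul _ _ _ fun u hu => ?_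
      have := hb u (Finset.mem_filter.1 hu).1
      rw [← sq_abs]
      nlinarith [abs_nonneg (c u)]
    have h2 : (√η * W / 6) ^ 2 ≤ s'.card := by
      rw [div_pow, mul_pow, Real.sq_sqrt hη.le]; linarith
    have hpos : (0 : ℝ) < s'.card := lt_of_lt_of_le (by positivity) h2
    have hne : s'.Nonempty := Finset.card_pos.1 (by exact_mod_cast hpos)
    have h3 := cubeProb_abs_linear_le (c := fun u => 2 * c u) (Finset.filter_subset _ s) hne
      (fun u hu => by
        have := hc u (Finset.mem_filter.1 hu).1 (Finset.mem_filter.1 hu).2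
        rw [abs_mul, abs_two]; linarith) (2 * β) (t := 2 * t) (by linarith)
    have h4 : √η * W / 6 ≤ √(s'.card : ℝ) := Real.le_sqrt_of_sq_le h2
    refine (cubeProb_mono fun A hA => ?_).trans (h3.trans ?_)
    · have : 2 * β + ∑ u ∈ s, 2 * c u * spin A u = 2 * (β + ∑ u ∈ s, c u * spin A u) := by
        rw [mul_add, Finset.mul_sum]; simp only [mul_assoc]
      rw [this, abs_mul, abs_two]; linarith
    · calc 12 * (1 + 2 * t) / √(s'.card : ℝ) ≤ 12 * (3 * t) / (√η * W / 6) := by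
            gcongr; linarith
        _ = 216 * t / (√η * W) := by field_simp; norm_num
        _ ≤ _ := by linarith
  · have hβ : W / 2 ≤ |β| := by
      refine le_of_sq_le_sq ?_ (abs_nonneg β) |> fun h => h
      rw [sq_abs]
      nlinarith [sq_nonneg W]
    have h1 := cubeProb_sq_linear_ge_le s 0 c (t := W / 4) (by linarith)
    refine (cubeProb_mono fun A hA => ?_).trans (h1.trans ?_)
    · rw [zero_add]
      have := abs_sub_abs_le_abs_sub β (β + ∑ u ∈ s, c u * spin A u)
      rw [sub_add_cancel_left, abs_neg] at this
      linarith
    · have : (0 ^ 2 + ∑ u ∈ s, c u ^ 2) / (W / 4) ^ 2 ≤ 16 * η := by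
        rw [div_le_iff₀ (by positivity)]; nlinarith
      linarith

/-- The possible quotients of two nonzero integers in `[-2, 2]`. -/
noncomputable def smallRatios : Finset ℝ := {1, -1, 2, -2, 1 / 2, -1 / 2}

theorem card_smallRatios : smallRatios.card ≤ 6 := Finset.card_le_six

theorem exists_smallRatio {x y : ℤ} (hx : x ≠ 0) (hy : y ≠ 0) (hx2 : |x| ≤ 2) (hy2 : |y| ≤ 2) :
    ∃ c ∈ smallRatios, (x : ℝ) = c * y := by
  obtain ⟨h1, h2⟩ := abs_le.1 hx2
  obtain ⟨h3, h4⟩ := abs_le.1 hy2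
  refine ⟨x / y, ?_, by field_simp⟩
  interval_cases x <;> interval_cases y <;> simp_all [smallRatios] <;> norm_num

theorem smallRatio_spec {c : ℝ} (hc : c ∈ smallRatios) :
    |c| ≤ 2 ∧ 1 / 2 ≤ |c| ∧ ∃ m : ℤ, 2 * c = m := by
  simp only [smallRatios, Finset.mem_insert, Finset.mem_singleton] at hc
  rcases hc with rfl | rfl | rfl | rfl | rfl | rfl
  · exact ⟨by norm_num, by norm_num, 2, by norm_num⟩
  · exact ⟨by norm_num, by norm_num, -2, by norm_num⟩
  · exact ⟨by norm_num, by norm_num, 4, by norm_num⟩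
  · exact ⟨by norm_num, by norm_num, -4, by norm_num⟩
  · exact ⟨by norm_num [abs_of_pos], by norm_num [abs_of_pos], 1, by norm_num⟩
  · exact ⟨by norm_num [abs_div], by norm_num [abs_div], -1, by norm_num⟩

/-- The part of the affine form `slopeAt` that involves only the coordinates in `S`. -/
noncomputable def slopeOn (r : ι → ι → ℤ) (b : ι → ℝ) (S A : Finset ι) (i : ι) : ℝ :=
  b i + ∑ u ∈ S, (r i u : ℝ) * spin A u

theorem one_le_abs_intCast {x : ℤ} (hx : x ≠ 0) : (1 : ℝ) ≤ |(x : ℝ)| := by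
  exact_mod_cast Int.one_le_abs hx

/-- Littlewood–Offord on the at least d / 2 coordinates of the support that lie in S. The assumption
1 ≤ κ √d absorbs the additive 1, and 17/12 exceeds √2. -/
theorem cubeProb_abs_slopeOn_le {r : ι → ι → ℤ} {b : ι → ℝ} {S : Finset ι} {i : ι} {κ : ℝ}
    (hd : 0 < (rowSupport r i).card)
    (hi : ((rowSupport r i).card : ℝ) / 2 ≤ (rowSupport r i ∩ S).card)
    (hκ : 1 ≤ κ * √(rowSupport r i).card) :
    cubeProb (fun A => |slopeOn r b S A i| ≤ κ * √(rowSupport r i).card) ≤ 34 * κ := by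
  have hd' : (0 : ℝ) < (rowSupport r i).card := by exact_mod_cast hd
  have hpos : (0 : ℝ) < (rowSupport r i ∩ S).card := lt_of_lt_of_le (by positivity) hi
  have h := cubeProb_abs_linear_le (c := fun u => (r i u : ℝ)) (s := S)
    (s' := rowSupport r i ∩ S) Finset.inter_subset_right (Finset.card_pos.1 (by exact_mod_cast hpos))
    (fun u hu => one_le_abs_intCast (mem_rowSupport.1 (Finset.mem_inter.1 hu).1)) (b i)
    (t := κ * √(rowSupport r i).card) (by linarith)
  refine h.trans ?_
  set d : ℝ := ((rowSupport r i).card : ℝ)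
  have hs : 0 < √d := Real.sqrt_pos.2 hd'
  have hκ0 : 0 < κ := by
    by_contra hneg
    nlinarith
  have h1 : √d / (17 / 12) ≤ √((rowSupport r i ∩ S).card : ℝ) := by
    refine Real.le_sqrt_of_sq_le ?_
    rw [div_pow, Real.sq_sqrt hd'.le, div_le_iff₀ (by norm_num)]
    linarith
  calc _ ≤ 12 * (2 * (κ * √d)) / (√d / (17 / 12)) := by gcongr; linarith
    _ = 34 * κ := by field_simp; norm_num

/-- On the support of row i, the quotient of the two coefficients takes one of seven values (∞ or a
member of `smallRatios`), so some value c occurs on a fraction 1/14. For c = ∞ those coordinates do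
not affect L_j. Otherwise they do not affect L_i - c L_j, which must be small too and is rarely so,
being of large second moment. In both cases those coordinates then make L_i small with conditional
probability only O(κ), so the joint bound is a product. -/
theorem cubeProb_pair_le {r : ι → ι → ℤ} {b : ι → ℝ} {S : Finset ι} {i j : ι} {κ z η : ℝ}
    (hri : ∀ u, |r i u| ≤ 2) (hrj : ∀ u, |r j u| ≤ 2)
    (hdi : 0 < (rowSupport r i).card) (hdj : 0 < (rowSupport r j).card)
    (hi : ((rowSupport r i).card : ℝ) / 2 ≤ (rowSupport r i ∩ S).card)
    (hj : ((rowSupport r j).card : ℝ) / 2 ≤ (rowSupport r j ∩ S).card)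
    (hκi : 1 ≤ κ * √(rowSupport r i).card) (hκj : 1 ≤ κ * √(rowSupport r j).card)
    (hz : 0 < z) (hη : 0 < η) (hη1 : η ≤ 1 / 2)
    (hW : ∀ c ∈ smallRatios, (z * (√(rowSupport r i).card + √(rowSupport r j).card) / 2) ^ 2 ≤
      (b i - c * b j) ^ 2 + ∑ u ∈ S, ((r i u : ℝ) - c * r j u) ^ 2) :
    cubeProb (fun A => |slopeOn r b S A i| ≤ κ * √(rowSupport r i).card ∧
        |slopeOn r b S A j| ≤ κ * √(rowSupport r j).card) ≤
      90 * κ * (16 * η + 864 * (κ / z) / √η) + 3060 * κ ^ 2 := by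
  have hPj := cubeProb_abs_slopeOn_le (b := b) hdj hj hκj
  have hdi' : (0 : ℝ) < (rowSupport r i).card := by exact_mod_cast hdi
  have hdj' : (0 : ℝ) < (rowSupport r j).card := by exact_mod_cast hdj
  set di : ℝ := ((rowSupport r i).card : ℝ) with hdi_def
  set dj : ℝ := ((rowSupport r j).card : ℝ) with hdj_def
  have hsi : 0 < √di := Real.sqrt_pos.2 hdi'
  have hsj : 0 < √dj := Real.sqrt_pos.2 hdj'
  have hκ0 : 0 < κ := by
    by_contra hneg
    nlinarith
  have hη' : 0 < √η := Real.sqrt_pos.2 hη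
  have hball : ∀ T ⊆ rowSupport r i ∩ S, di / 14 ≤ T.card → T.Nonempty ∧
      12 * (1 + κ * √di) / √(T.card : ℝ) ≤ 90 * κ := by
    intro T _ hT
    have hpos : (0 : ℝ) < T.card := lt_of_lt_of_le (by positivity) hT
    refine ⟨Finset.card_pos.1 (by exact_mod_cast hpos), ?_⟩
    -- Here 15/4 exceeds √14.
    have h1 : √di / (15 / 4) ≤ √(T.card : ℝ) := by
      refine Real.le_sqrt_of_sq_le ?_
      rw [div_pow, Real.sq_sqrt hdi'.le, div_le_iff₀ (by norm_num)]
      linarith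
    calc _ ≤ 12 * (2 * (κ * √di)) / (√di / (15 / 4)) := by gcongr; linarith
      _ = 90 * κ := by field_simp; norm_num
  set Sinf := (rowSupport r i ∩ S).filter fun u => r j u = 0 with hSinf
  set Sc : ℝ → Finset ι := fun c => (rowSupport r i ∩ S).filter fun u => (r i u : ℝ) = c * r j u
    with hSc
  rcases le_or_gt (di / 14) Sinf.card with hcase | hcase
  · obtain ⟨hne, hle⟩ := hball Sinf (Finset.filter_subset _ _) hcase
    have h := cubeProb_and_abs_linear_le (c := fun u => (r i u : ℝ)) (s := S) (s' := Sinf)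
      ((Finset.filter_subset _ _).trans Finset.inter_subset_right) hne
      (fun u hu => one_le_abs_intCast (mem_rowSupport.1
        (Finset.mem_inter.1 (Finset.mem_filter.1 hu).1).1)) (b i) (t := κ * √di) (by linarith)
      (q := fun A => |slopeOn r b S A j| ≤ κ * √dj) (fun A B => by
        have : slopeOn r b S (glue Sinf A B) j = slopeOn r b S B j := by
          unfold slopeOn
          congr 1
          refine Finset.sum_congr rfl fun u _ => ?_
          by_cases hu : u ∈ Sinf
          · rw [(Finset.mem_filter.1 hu).2]; simp
          · rw [spin_glue_of_notMem hu]
        rw [this])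
    refine (cubeProb_mono fun A hA => ⟨hA.2, hA.1⟩).trans (h.trans ?_)
    calc _ ≤ 34 * κ * (90 * κ) := by
          refine mul_le_mul hPj hle (by positivity) (by positivity)
      _ = 3060 * κ ^ 2 := by ring
      _ ≤ _ := by
        have : 0 ≤ 90 * κ * (16 * η + 864 * (κ / z) / √η) := by positivity
        linarith
  -- Otherwise seven classes, each of size below di / 14 (∞ included), would cover at least di / 2
  -- coordinates.
  have hex : ∃ c ∈ smallRatios, di / 14 ≤ (Sc c).card := by
    by_contra! hcon
    have hcover : rowSupport r i ∩ S ⊆ Sinf ∪ smallRatios.biUnion Sc := by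
      intro u hu
      by_cases h0 : r j u = 0
      · exact Finset.mem_union_left _ (Finset.mem_filter.2 ⟨hu, h0⟩)
      · obtain ⟨c, hc, hcu⟩ := exists_smallRatio (mem_rowSupport.1 (Finset.mem_inter.1 hu).1) h0
          (hri u) (hrj u)
        exact Finset.mem_union_right _ (Finset.mem_biUnion.2 ⟨c, hc, Finset.mem_filter.2 ⟨hu, hcu⟩⟩)
    have h1 : ((rowSupport r i ∩ S).card : ℝ) ≤ Sinf.card + ∑ c ∈ smallRatios, ((Sc c).card : ℝ) := by
      exact_mod_cast (Finset.card_le_card hcover).trans ((Finset.card_union_le _ _).trans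
        (Nat.add_le_add_left Finset.card_biUnion_le _))
    have h2 : ∑ c ∈ smallRatios, ((Sc c).card : ℝ) ≤ 6 * (di / 14) := by
      refine (Finset.sum_le_card_nsmul _ _ _ fun c hc => (hcon c hc).le).trans ?_
      rw [nsmul_eq_mul]
      gcongr
      exact_mod_cast card_smallRatios
    linarith
  obtain ⟨c, hc, hcard⟩ := hex
  obtain ⟨hc2, hc1, m, hm⟩ := smallRatio_spec hc
  obtain ⟨hne, hle⟩ := hball (Sc c) (Finset.filter_subset _ _) hcard
  set e : ι → ℝ := fun u => (r i u : ℝ) - c * r j u with he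
  have hrir : ∀ u, |(r i u : ℝ)| ≤ 2 := fun u => by exact_mod_cast hri u
  have hrjr : ∀ u, |(r j u : ℝ)| ≤ 2 := fun u => by exact_mod_cast hrj u
  have hE := cubeProb_abs_linear_le_of_variance (s := S) (c := e) (β := b i - c * b j) (η := η)
    (t := κ * √di + 2 * (κ * √dj)) (W := z * (√di + √dj) / 2)
    (fun u _ hu => by
      -- Since 2c is an integer, the coefficients of L_i - c L_j are half-integers, so the nonzero
      -- ones have size at least 1/2.
      have : e u = ((2 * r i u - m * r j u : ℤ) : ℝ) / 2 := by
        rw [he]; push_cast; rw [← hm]; ring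
      have h0 : (2 * r i u - m * r j u : ℤ) ≠ 0 := by
        intro h0; rw [h0] at this; simp at this; exact hu this
      rw [this, abs_div, abs_two]
      have := one_le_abs_intCast h0
      linarith)
    (fun u _ => by
      calc |e u| ≤ |(r i u : ℝ)| + |c * r j u| := abs_sub _ _
        _ ≤ 2 + 2 * 2 := by
          rw [abs_mul]
          exact add_le_add (hrir u) (mul_le_mul hc2 (hrjr u) (abs_nonneg _) (by norm_num))
        _ = 6 := by norm_num)
    hη hη1 (by nlinarith) (by positivity) (hW c hc)
  have h := cubeProb_and_abs_linear_le (c := fun u => (r i u : ℝ)) (s := S) (s' := Sc c)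
    ((Finset.filter_subset _ _).trans Finset.inter_subset_right) hne
    (fun u hu => one_le_abs_intCast (mem_rowSupport.1
      (Finset.mem_inter.1 (Finset.mem_filter.1 hu).1).1)) (b i) (t := κ * √di) (by linarith)
    (q := fun A => |b i - c * b j + ∑ u ∈ S, e u * spin A u| ≤ κ * √di + 2 * (κ * √dj))
    (fun A B => by
      have : ∑ u ∈ S, e u * spin (glue (Sc c) A B) u = ∑ u ∈ S, e u * spin B u := by
        refine Finset.sum_congr rfl fun u _ => ?_
        by_cases hu : u ∈ Sc c
        · have : e u = 0 := by rw [he]; simp [(Finset.mem_filter.1 hu).2]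
          rw [this]; simp
        · rw [spin_glue_of_notMem hu]
      rw [this])
  have hsub : ∀ A, |slopeOn r b S A i| ≤ κ * √di ∧ |slopeOn r b S A j| ≤ κ * √dj →
      |b i - c * b j + ∑ u ∈ S, e u * spin A u| ≤ κ * √di + 2 * (κ * √dj) := by
    intro A hA
    have h1 : b i - c * b j + ∑ u ∈ S, e u * spin A u =
        slopeOn r b S A i - c * slopeOn r b S A j := by
      simp only [slopeOn, he, sub_mul, Finset.sum_sub_distrib, mul_add, Finset.mul_sum, mul_assoc]
      ring
    rw [h1]
    calc _ ≤ |slopeOn r b S A i| + |c * slopeOn r b S A j| := abs_sub _ _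
      _ ≤ κ * √di + 2 * (κ * √dj) := by
        rw [abs_mul]
        exact add_le_add hA.1 (mul_le_mul hc2 hA.2 (abs_nonneg _) (by norm_num))
  refine (cubeProb_mono fun A hA => ⟨hsub A hA, hA.1⟩).trans (h.trans ?_)
  have h2 : 216 * (κ * √di + 2 * (κ * √dj)) / (√η * (z * (√di + √dj) / 2)) ≤
        864 * (κ / z) / √η := by
      have h3 : 864 * (κ / z) / √η = 216 * (2 * (κ * (√di + √dj))) /
          (√η * (z * (√di + √dj) / 2)) := by field_simp; norm_num
      rw [h3]
      gcongr
      nlinarith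
  calc _ ≤ (16 * η + 864 * (κ / z) / √η) * (90 * κ) := by
          refine mul_le_mul (hE.trans (by linarith)) hle (by positivity) (by positivity)
      _ ≤ _ := by nlinarith [sq_nonneg κ]

open Classical in
/-- First moment bound for the probability that a quarter of the events `p i` happen. -/
theorem cubeProb_quarter_le {R : Finset ι} (hR : R.Nonempty) (p : ι → Finset ι → Prop) {c : ℝ}
    (h : ∀ i ∈ R, cubeProb (p i) ≤ c) :
    cubeProb (fun A => (R.card : ℝ) / 4 ≤ (R.filter fun i => p i A).card) ≤ 4 * c := by
  have hpos : (0 : ℝ) < R.card := by exact_mod_cast hR.card_pos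
  have h1 := cubeProb_le_cubeMean_div (f := fun A => ((R.filter fun i => p i A).card : ℝ))
    (p := fun A => (R.card : ℝ) / 4 ≤ (R.filter fun i => p i A).card)
    (fun A => Nat.cast_nonneg _) (t := R.card / 4) (by positivity) (fun A hA => hA)
  refine h1.trans ?_
  rw [div_le_iff₀ (by positivity)]
  have h2 : cubeMean (fun A => ((R.filter fun i => p i A).card : ℝ)) = ∑ i ∈ R, cubeProb (p i) := by
    simp only [Finset.card_filter, Nat.cast_sum, cubeMean_sum, cubeProb]
    refine Finset.sum_congr rfl fun i _ => ?_
    congr 1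
    ext A
    simp
  rw [h2]
  calc _ ≤ R.card • c := Finset.sum_le_card_nsmul _ _ _ h
    _ = _ := by rw [nsmul_eq_mul]; ring

open Classical in
/-- Second moment bound for the probability that a quarter of the events `p i` happen. -/
theorem cubeProb_quarter_le_of_pairs {R : Finset ι} (hR : R.Nonempty) (p : ι → Finset ι → Prop)
    {c c' f : ℝ} (hc : 0 ≤ c) (hc' : 0 ≤ c') (h1 : ∀ i ∈ R, cubeProb (p i) ≤ c) (Ex : Finset (ι × ι))
    (hEx : (Ex.card : ℝ) ≤ f * (R.card : ℝ) ^ 2)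
    (h2 : ∀ i ∈ R, ∀ j ∈ R, (i, j) ∉ Ex → cubeProb (fun A => p i A ∧ p j A) ≤ c') :
    cubeProb (fun A => (R.card : ℝ) / 4 ≤ (R.filter fun i => p i A).card) ≤
      16 * (c * f + c') := by
  have hpos : (0 : ℝ) < R.card := by exact_mod_cast hR.card_pos
  have h3 := cubeProb_le_cubeMean_div (f := fun A => ((R.filter fun i => p i A).card : ℝ) ^ 2)
    (p := fun A => (R.card : ℝ) / 4 ≤ (R.filter fun i => p i A).card)
    (fun A => sq_nonneg _) (t := (R.card / 4) ^ 2) (by positivity)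
    (fun A hA => pow_le_pow_left₀ (by positivity) hA 2)
  refine h3.trans ?_
  rw [div_le_iff₀ (by positivity)]
  have h4 : cubeMean (fun A => ((R.filter fun i => p i A).card : ℝ) ^ 2) =
      ∑ e ∈ R ×ˢ R, cubeProb (fun A => p e.1 A ∧ p e.2 A) := by
    simp only [Finset.card_filter, Nat.cast_sum, sq, Finset.sum_mul_sum, ← Finset.sum_product',
      cubeMean_sum, cubeProb]
    refine Finset.sum_congr rfl fun e _ => ?_
    congr 1
    ext A
    by_cases ha : p e.1 A <;> by_cases hb : p e.2 A <;> simp [ha, hb]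
  rw [h4]
  have h5 : ∀ e ∈ R ×ˢ R, cubeProb (fun A => p e.1 A ∧ p e.2 A) ≤
      (if e ∈ Ex then c else 0) + c' := by
    intro e he
    obtain ⟨ha, hb⟩ := Finset.mem_product.1 he
    by_cases hE : e ∈ Ex
    · rw [if_pos hE]
      have := (cubeProb_mono fun A (hA : p e.1 A ∧ p e.2 A) => hA.1).trans (h1 _ ha)
      linarith
    · rw [if_neg hE, zero_add]
      exact h2 _ ha _ hb hE
  refine (Finset.sum_le_sum h5).trans ?_
  rw [Finset.sum_add_distrib, Finset.sum_ite_mem, Finset.sum_const, Finset.sum_const,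
    Finset.card_product]
  have h6 : (((R ×ˢ R) ∩ Ex).card : ℝ) ≤ f * (R.card : ℝ) ^ 2 := by
    refine le_trans ?_ hEx
    exact_mod_cast Finset.card_le_card Finset.inter_subset_right
  simp only [nsmul_eq_mul]
  push_cast
  calc _ ≤ f * (R.card : ℝ) ^ 2 * c + R.card * R.card * c' := by gcongr
    _ = _ := by ring

end Pairs

/-! ### Tools for exposing coordinates in stages. -/

section Exposure

variable {ι : Type} [Fintype ι] [DecidableEq ι]

theorem glue_glue_of_subset {S T : Finset ι} (hTS : T ⊆ S) (A B B' : Finset ι) :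
    glue S (glue T A B') B = glue T A (glue S B' B) := by
  ext x
  have := @hTS x
  simp only [mem_glue]
  by_cases h1 : x ∈ T <;> by_cases h2 : x ∈ S <;> simp_all

/-- A version of `IsQuadraticOn.cubeProb_le_of_pattern` in which the set of directions and the
sign pattern may depend on the coordinates outside of `S`. -/
theorem IsQuadraticOn.cubeProb_le_of_adaptive_pattern {Y : Finset ι → ℝ} {U : Finset ι}
    {r : ι → ι → ℤ} {b : ι → ℝ} (h : IsQuadraticOn Y U r b) {S : Finset ι} (hSU : S ⊆ U)
    (T Neg : Finset ι → Finset ι) (hT : ∀ A B, T (glue S A B) = T B)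
    (hNeg : ∀ A B, Neg (glue S A B) = Neg B) (hTS : ∀ A, T A ⊆ S) {p q : Finset ι → Prop}
    (hpq : ∀ A, p A → q A) (hq : ∀ A B, q (glue S A B) ↔ q B) {ℓ : ℝ} (hY : ∀ A, p A → Y A = ℓ)
    {t : ℝ} (ht : 0 < t) (hcard : ∀ A, p A → t ≤ (T A).card) {y : Finset ι → ι → ℝ}
    (hy : ∀ A i, 0 ≤ y A i) (hsum : ∀ A, p A → 400 * ∑ i ∈ T A, y A i ≤ (T A).card)
    (hpos : ∀ A, p A → ∀ R ⊆ T A, R.Nonempty → ∏ i ∈ R, y A i < 1 →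
      0 < ∑ i ∈ R, (if i ∈ Neg A then -1 else 1) * slopeAt r b A i) :
    cubeProb p ≤ cubeProb q * (6 / √t) := by
  refine (cubeProb_mono fun A hA => ⟨hpq A hA, hA⟩).trans
    (_root_.cubeProb_and_le S (q := p) hq fun B _ => ?_)
  -- An empty fibre is trivial; a point of p in the fibre supplies the lower bound on the size of T
  -- B, which is constant along the fibre.
  by_cases hex : ∃ A, p (glue S A B)
  swap
  · rw [cubeProb_eq_zero fun A hA => hex ⟨A, hA⟩]
    positivity
  obtain ⟨A₀, hA₀⟩ := hex
  have hc := hcard _ hA₀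
  rw [hT] at hc
  have hne : (T B).Nonempty := by
    have : (0 : ℝ) < (T B).card := by linarith
    exact Finset.card_pos.1 (by exact_mod_cast this)
  have hle : 6 / √((T B).card : ℝ) ≤ 6 / √t := by
    have := Real.sqrt_pos.2 ht
    gcongr
  refine le_trans (cubeProb_le_of_glue (T B) fun B' => ?_) hle
  simp only [glue_glue_of_subset (hTS B)]
  refine (cubeProb_mono fun A hA => ?_).trans
    (h.cubeProb_le_of_pattern hne ((hTS B).trans hSU) (Neg B)
      (p := fun A => p A ∧ T A = T B ∧ Neg A = Neg B) (g := 0)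
      (fun A A' hA hA' => by rw [hY _ hA.1, hY _ hA'.1, add_zero]) (y := y) hy
      (fun A hA => by have := hsum A hA.1; rwa [hA.2.1] at this)
      (fun A hA R hR hRne hprod => ?_) (glue S B' B))
  · refine ⟨hA, ?_, ?_⟩
    · rw [← glue_glue_of_subset (hTS B), hT]
    · rw [← glue_glue_of_subset (hTS B), hNeg]
  · have := hpos A hA.1 R (by rw [hA.2.1]; exact hR) hRne hprod
    rw [hA.2.2] at this
    linarith

/-- The form in which induction is used: an event depending only on coordinates off S keeps its own
probability as a factor, while the randomness in S gives the bound for ⌈αn⌉, which is below n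
because α ≤ 1/2 and n ≥ 2. -/
theorem IsQuadraticOn.cubeProb_and_le_of_lt {Y : Finset ι → ℝ} {U : Finset ι} {r : ι → ι → ℤ}
    {b : ι → ℝ} (h : IsQuadraticOn Y U r b) {n : ℕ} {C : ℝ} (hC : 0 ≤ C)
    (hind : ∀ m : ℕ, 1 ≤ m → m < n → AnticoncentrationBound ι m (C / √m))
    {S U' : Finset ι} (hU' : U' ⊆ U) (hS : U' ⊆ S) {α : ℝ} (hα : 0 < α) (hα1 : α ≤ 1 / 2)
    (hn : 2 ≤ n) (hcard : α * n ≤ U'.card) (hrow : ∀ i ∈ U', α * n ≤ (rowSupport r i ∩ S).card)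
    {p : Finset ι → Prop} (hp : ∀ A B, p (glue S A B) ↔ p B) (ℓ : ℝ) :
    cubeProb (fun A => p A ∧ Y A = ℓ) ≤ cubeProb p * (C / √(α * n)) := by
  have hn' : (2 : ℝ) ≤ n := by exact_mod_cast hn
  have hαn : 0 < α * n := by positivity
  have h1 : 1 ≤ ⌈α * n⌉₊ := Nat.one_le_ceil_iff.2 hαn
  have h2 : ⌈α * n⌉₊ < n := by
    have := Nat.ceil_lt_add_one hαn.le
    have : (⌈α * n⌉₊ : ℝ) < n := by
      rcases hn.lt_or_eq with h | h
      · have : (3 : ℝ) ≤ n := by exact_mod_cast h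
        nlinarith
      · have : ⌈α * n⌉₊ ≤ 1 := Nat.ceil_le.2 (by rw [← h]; push_cast; linarith)
        have : (⌈α * n⌉₊ : ℝ) ≤ 1 := by exact_mod_cast this
        linarith
    exact_mod_cast this
  refine (h.cubeProb_and_le (hind _ h1 h2) hU' hS (Nat.ceil_le.2 hcard)
    (fun i hi => Nat.ceil_le.2 (hrow i hi)) hp ℓ).trans ?_
  have := Real.sqrt_pos.2 hαn
  have := cubeProb_nonneg p
  have := Nat.le_ceil (α * n)
  gcongr

/-- Markov's inequality for the sum of the exponential moments. The purpose is to control the total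
of the weights in the robust Sperner bound, which are exponentials of the error terms of the slopes.
-/
theorem cubeProb_exp_sum_gt_le {R : Finset ι} (hR : R.Nonempty) (s : Finset ι) (β : ι → ℝ)
    (c : ι → ι → ℝ) {t a : ℝ} (ht : 0 ≤ t)
    (h : ∀ i ∈ R, t * |β i| + t ^ 2 * (∑ u ∈ s, c i u ^ 2) / 2 ≤ 2) :
    cubeProb (fun A => R.card * Real.exp a <
      ∑ i ∈ R, Real.exp (t * |β i + ∑ u ∈ s, c i u * spin A u|)) ≤ 2 * Real.exp (2 - a) := by
  have hpos : (0 : ℝ) < R.card := by exact_mod_cast hR.card_pos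
  have h1 := cubeProb_le_cubeMean_div
    (f := fun A => ∑ i ∈ R, Real.exp (t * |β i + ∑ u ∈ s, c i u * spin A u|))
    (p := fun A => R.card * Real.exp a <
      ∑ i ∈ R, Real.exp (t * |β i + ∑ u ∈ s, c i u * spin A u|))
    (fun A => Finset.sum_nonneg fun i _ => (Real.exp_pos _).le) (t := R.card * Real.exp a)
    (by positivity) (fun A hA => le_of_lt hA)
  refine h1.trans ?_
  rw [div_le_iff₀ (by positivity), cubeMean_sum]
  have h2 : ∀ i ∈ R, cubeMean (fun A => Real.exp (t * |β i + ∑ u ∈ s, c i u * spin A u|)) ≤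
      2 * Real.exp 2 := fun i hi =>
    (cubeMean_exp_abs_linear_le s (β i) t ht (c i)).trans (by
      have := h i hi
      gcongr)
  refine (Finset.sum_le_card_nsmul _ _ _ h2).trans_eq ?_
  rw [nsmul_eq_mul, Real.exp_sub]
  field_simp

theorem sum_mul_spin_glue_of_disjoint {S s : Finset ι} (h : Disjoint s S) (c : ι → ℝ)
    (A B : Finset ι) :
    ∑ u ∈ s, c u * spin (glue S A B) u = ∑ u ∈ s, c u * spin B u :=
  Finset.sum_congr rfl fun u hu => by
    rw [spin_glue_of_notMem (Finset.disjoint_left.1 h hu)]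

theorem slopeOn_glue_of_disjoint {S s : Finset ι} (h : Disjoint s S) (r : ι → ι → ℤ) (b : ι → ℝ)
    (A B : Finset ι) (i : ι) : slopeOn r b s (glue S A B) i = slopeOn r b s B i := by
  unfold slopeOn
  rw [sum_mul_spin_glue_of_disjoint h]

theorem sum_sq_le_card {r : ι → ι → ℤ} {i : ι} (hr : ∀ u, |r i u| ≤ 2) (s : Finset ι) :
    ∑ u ∈ s, (r i u : ℝ) ^ 2 ≤ 4 * (rowSupport r i ∩ s).card := by
  have h1 : ∑ u ∈ s, (r i u : ℝ) ^ 2 = ∑ u ∈ rowSupport r i ∩ s, (r i u : ℝ) ^ 2 := by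
    refine (Finset.sum_subset Finset.inter_subset_right fun u hu hu' => ?_).symm
    have : r i u = 0 := by
      by_contra h
      exact hu' (Finset.mem_inter.2 ⟨mem_rowSupport.2 h, hu⟩)
    simp [this]
  rw [h1, mul_comm, ← nsmul_eq_mul]
  refine Finset.sum_le_card_nsmul _ _ _ fun u _ => ?_
  have h2 : |(r i u : ℝ)| ≤ 2 := by exact_mod_cast hr u
  rw [← sq_abs]
  nlinarith [abs_nonneg (r i u : ℝ)]

/-- Each signed x i is at least w₀ - |g i|. The product condition says exactly that the |g i| are
below w₀ on average over R, so weights of this exponential form detect every set of directions whose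
signed slope sum could fail to be positive. -/
theorem sum_pos_of_dominated {R Neg : Finset ι} {x y g : ι → ℝ} {t w₀ : ℝ} (ht : 0 < t)
    (hw₀ : 0 < w₀) (hprod : ∏ i ∈ R, Real.exp (t * (|g i| / w₀ - 1)) < 1)
    (hx : ∀ i ∈ R, x i = y i + g i)
    (hy : ∀ i ∈ R, w₀ ≤ (if i ∈ Neg then -1 else 1) * y i) :
    0 < ∑ i ∈ R, (if i ∈ Neg then -1 else 1) * x i := by
  rw [← Real.exp_sum, Real.exp_lt_one_iff, ← Finset.mul_sum] at hprod
  have h1 : ∑ i ∈ R, (|g i| / w₀ - 1) < 0 := by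
    by_contra hneg
    have := mul_nonneg ht.le (not_lt.1 hneg)
    linarith
  have h2 : ∑ i ∈ R, (|g i| - w₀) < 0 := by
    have : ∑ i ∈ R, (|g i| - w₀) = w₀ * ∑ i ∈ R, (|g i| / w₀ - 1) := by
      rw [Finset.mul_sum]
      refine Finset.sum_congr rfl fun i _ => ?_
      field_simp
    rw [this]
    exact mul_neg_of_pos_of_neg hw₀ h1
  have h3 : ∑ i ∈ R, (w₀ - |g i|) ≤ ∑ i ∈ R, (if i ∈ Neg then -1 else 1) * x i := by
    refine Finset.sum_le_sum fun i hi => ?_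
    rw [hx i hi, mul_add]
    have h4 := hy i hi
    have h5 := neg_abs_le (g i)
    have h6 := le_abs_self (g i)
    split_ifs at h4 ⊢ <;> linarith
  have h7 : ∑ i ∈ R, (w₀ - |g i|) = -∑ i ∈ R, (|g i| - w₀) := by
    rw [← Finset.sum_neg_distrib]; simp
  linarith

end Exposure

/-! ### Nearly proportional rows, and the rarity of many small slopes off a sparse set. -/

section Exposure

variable {ι : Type} [Fintype ι] [DecidableEq ι]

/-- The rows `i` and `j` are nearly proportional, to within `z` times their size. -/
def NearlyProportional (r : ι → ι → ℤ) (b : ι → ℝ) (z : ℝ) (i j : ι) : Prop :=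
  ∃ c ∈ smallRatios, (b i - c * b j) ^ 2 + ∑ u, ((r i u : ℝ) - c * r j u) ^ 2 <
    (z * (√(rowSupport r i).card + √(rowSupport r j).card)) ^ 2

theorem sq_sub_smallRatio_mul_le {x y : ℤ} (hx : |x| ≤ 2) (hy : |y| ≤ 2) {c : ℝ}
    (hc : c ∈ smallRatios) : ((x : ℝ) - c * y) ^ 2 ≤ 36 := by
  have h1 : |(x : ℝ)| ≤ 2 := by exact_mod_cast hx
  have h2 : |(y : ℝ)| ≤ 2 := by exact_mod_cast hy
  have h3 : |(x : ℝ) - c * y| ≤ 6 := by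
    calc _ ≤ |(x : ℝ)| + |c * y| := abs_sub _ _
      _ ≤ 2 + 2 * 2 := by
        rw [abs_mul]
        exact add_le_add h1 (mul_le_mul (smallRatio_spec hc).1 h2 (abs_nonneg _) (by norm_num))
      _ = 6 := by norm_num
  rw [← sq_abs]
  nlinarith [abs_nonneg ((x : ℝ) - c * y)]

/-- The second moment of `L i - c * L j` survives the removal of a set of coordinates that carries
at most half of its mass. -/
theorem sq_le_of_not_nearlyProportional {r : ι → ι → ℤ} {b : ι → ℝ} {z : ℝ} {i j : ι} {P : Finset ι}
    (hri : ∀ u, |r i u| ≤ 2) (hrj : ∀ u, |r j u| ≤ 2) (hi : i ∈ P) (hj : j ∈ P) (hij : i ≠ j)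
    (hfar : ¬ NearlyProportional r b z i j)
    (hz : 144 ≤ (z * (√(rowSupport r i).card + √(rowSupport r j).card)) ^ 2) {c : ℝ}
    (hc : c ∈ smallRatios)
    (hP : ∑ u ∈ {i, j}ᶜ ∩ P, ((r i u : ℝ) - c * r j u) ^ 2 ≤
      (∑ u ∈ {i, j}ᶜ, ((r i u : ℝ) - c * r j u) ^ 2) / 2) :
    (z * (√(rowSupport r i).card + √(rowSupport r j).card) / 2) ^ 2 ≤
      (b i - c * b j) ^ 2 + ∑ u ∈ Pᶜ, ((r i u : ℝ) - c * r j u) ^ 2 := by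
  set q : ι → ℝ := fun u => ((r i u : ℝ) - c * r j u) ^ 2 with hq
  have h1 : (z * (√(rowSupport r i).card + √(rowSupport r j).card)) ^ 2 ≤
      (b i - c * b j) ^ 2 + ∑ u, q u := by
    by_contra hcon
    exact hfar ⟨c, hc, not_le.1 hcon⟩
  have h2 : ∑ u, q u = ∑ u ∈ {i, j}ᶜ, q u + (q i + q j) := by
    rw [← Finset.sum_pair hij, add_comm, Finset.sum_add_sum_compl]
  have h3 : ∑ u ∈ {i, j}ᶜ, q u = ∑ u ∈ {i, j}ᶜ ∩ P, q u + ∑ u ∈ Pᶜ, q u := by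
    have e : ({i, j}ᶜ : Finset ι) \ P = Pᶜ := by
      ext u
      simp only [Finset.mem_sdiff, Finset.mem_compl, Finset.mem_insert, Finset.mem_singleton]
      constructor
      · exact fun h => h.2
      · exact fun h => ⟨by rintro (rfl | rfl) <;> exact h ‹_›, h⟩
    rw [← e, Finset.sum_inter_add_sum_sdiff]
  have h4 : q i ≤ 36 := sq_sub_smallRatio_mul_le (hri i) (hrj i) hc
  have h5 : q j ≤ 36 := sq_sub_smallRatio_mul_le (hri j) (hrj j) hc
  have h6 : 0 ≤ (b i - c * b j) ^ 2 := sq_nonneg _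
  rw [div_pow]
  change ∑ u ∈ {i, j}ᶜ ∩ P, q u ≤ (∑ u ∈ {i, j}ᶜ, q u) / 2 at hP
  change _ ≤ _ + ∑ u ∈ Pᶜ, q u
  linarith

/-- The layers in order of exposure: the main term off P, then P \ U, and last U ∩ P, where the
derivatives of Y are under control and Sperner is applied. -/
theorem slopeAt_eq_add (r : ι → ι → ℤ) (b : ι → ℝ) (U P A : Finset ι) (i : ι) :
    slopeAt r b A i = slopeOn r b Pᶜ A i + ∑ u ∈ P \ U, (r i u : ℝ) * spin A u +
      ∑ u ∈ U ∩ P, (r i u : ℝ) * spin A u := by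
  unfold slopeAt slopeOn
  rw [← Finset.sum_add_sum_compl P, Finset.inter_comm, ← Finset.sum_inter_add_sum_sdiff P U]
  ring

theorem exp_neg_eight_le : 800 * Real.exp (-8) ≤ 1 := by
  have h := Real.exp_one_gt_d9
  have h1 : Real.exp 8 = Real.exp 1 ^ 8 := by rw [← Real.exp_nat_mul]; norm_num
  have h2 : (2.7 : ℝ) ^ 8 ≤ Real.exp 8 := by
    rw [h1]; exact pow_le_pow_left₀ (by norm_num) (by linarith) 8
  rw [Real.exp_neg, ← div_eq_mul_inv, div_le_one (Real.exp_pos _)]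
  norm_num at h2
  linarith

theorem exp_neg_ten_le : Real.exp (-10) ≤ 1 / 1000 := by
  have h := Real.exp_one_gt_d9
  have h1 : Real.exp 10 = Real.exp 1 ^ 10 := by rw [← Real.exp_nat_mul]; norm_num
  have h2 : (2 : ℝ) ^ 10 ≤ Real.exp 10 := by
    rw [h1]; exact pow_le_pow_left₀ (by norm_num) (by linarith) 10
  rw [Real.exp_neg, ← one_div]
  refine one_div_le_one_div_of_le (by norm_num) ?_
  norm_num at h2
  linarith

open Classical in
/-- The event that many of the rows in `R` have a small part outside of `P` is unlikely. -/
theorem cubeProb_many_small_le {r : ι → ι → ℤ} {b : ι → ℝ} {P R : Finset ι} {n : ℕ} {z : ℝ}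
    (hz : 0 < z) (hz1 : z ≤ 1 / 8) (hn : 10 ^ 51 ≤ z ^ 2 * n) (hRP : R ⊆ P)
    (hr : ∀ i ∈ R, ∀ u, |r i u| ≤ 2) (hrow : ∀ i ∈ R, n ≤ (rowSupport r i).card)
    (hcol : ∀ i ∈ R, ((rowSupport r i).card : ℝ) / 2 ≤ (rowSupport r i ∩ Pᶜ).card)
    (hR : z ^ 2 / 10 ^ 40 * n / 4 ≤ R.card)
    (hbad : ((R ×ˢ R).filter fun e => e.1 ≠ e.2 ∧ NearlyProportional r b z e.1 e.2).card ≤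
      8 * (1 / 10 ^ 12) * (z ^ 2 / 10 ^ 40 * n) ^ 2)
    (hexc : ((R ×ˢ R).filter fun e => e.1 ≠ e.2 ∧ ∃ c ∈ smallRatios,
          (∑ u ∈ {e.1, e.2}ᶜ, ((r e.1 u : ℝ) - c * r e.2 u) ^ 2) / 2 <
            ∑ u ∈ {e.1, e.2}ᶜ ∩ P, ((r e.1 u : ℝ) - c * r e.2 u) ^ 2).card ≤
        96 * (z ^ 2 / 10 ^ 40) * (z ^ 2 / 10 ^ 40 * n) ^ 2) :
    cubeProb (fun A => (R.card : ℝ) / 4 ≤ (R.filter fun i => |slopeOn r b Pᶜ A i| ≤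
      2 * z / 10 ^ 18 * √(rowSupport r i).card).card) ≤ z / 10 ^ 22 := by
  set ε : ℝ := z ^ 2 / 10 ^ 40 with hε
  set κ : ℝ := 2 * z / 10 ^ 18 with hκ
  have hκ0 : 0 < κ := by positivity
  have hn0 : (0 : ℝ) < n := by
    by_contra h
    have : z ^ 2 * n ≤ 0 := mul_nonpos_of_nonneg_of_nonpos (sq_nonneg z) (not_lt.1 h)
    linarith [show (0 : ℝ) < 10 ^ 51 by positivity]
  have hεn : 10 ^ 11 ≤ ε * n := by
    have : ε * n = z ^ 2 * n / 10 ^ 40 := by rw [hε]; ring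
    rw [this, le_div_iff₀ (by positivity)]
    linarith
  have hRpos : (0 : ℝ) < R.card := by linarith
  have hRne : R.Nonempty := Finset.card_pos.1 (by exact_mod_cast hRpos)
  have hd : ∀ i ∈ R, (n : ℝ) ≤ (rowSupport r i).card := fun i hi => by exact_mod_cast hrow i hi
  have hd0 : ∀ i ∈ R, 0 < (rowSupport r i).card := fun i hi => by
    have := hd i hi
    have : (0 : ℝ) < (rowSupport r i).card := by linarith
    exact_mod_cast this
  have hκn : 1 ≤ κ * √n := by
    refine (one_le_sq_iff₀ (by positivity)).1 ?_
    rw [mul_pow, Real.sq_sqrt hn0.le, hκ, div_pow, mul_pow, div_mul_eq_mul_div,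
      le_div_iff₀ (by positivity)]
    linarith
  have hκd : ∀ i ∈ R, 1 ≤ κ * √(rowSupport r i).card := fun i hi => by
    refine hκn.trans ?_
    have := hd i hi
    gcongr
  -- Pairs for which the joint bound is unavailable: the diagonal, nearly proportional rows, and
  -- rows whose difference loses over half of its mass to P.
  set Ex := (R ×ˢ R).filter (fun e => e.1 = e.2) ∪
    ((R ×ˢ R).filter (fun e => e.1 ≠ e.2 ∧ NearlyProportional r b z e.1 e.2) ∪
     (R ×ˢ R).filter fun e => e.1 ≠ e.2 ∧ ∃ c ∈ smallRatios,
          (∑ u ∈ {e.1, e.2}ᶜ, ((r e.1 u : ℝ) - c * r e.2 u) ^ 2) / 2 <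
            ∑ u ∈ {e.1, e.2}ᶜ ∩ P, ((r e.1 u : ℝ) - c * r e.2 u) ^ 2) with hEx
  have hdiag : ((R ×ˢ R).filter fun e => e.1 = e.2).card ≤ R.card := by
    refine (Finset.card_le_card (t := R.image fun i => (i, i)) fun e he => ?_).trans
      Finset.card_image_le
    obtain ⟨h1, h2⟩ := Finset.mem_filter.1 he
    exact Finset.mem_image.2 ⟨e.1, (Finset.mem_product.1 h1).1, Prod.ext rfl h2⟩
  have hExcard : (Ex.card : ℝ) ≤ 1 / 10 ^ 9 * (R.card : ℝ) ^ 2 := by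
    have h1 : (Ex.card : ℝ) ≤ R.card + (8 * (1 / 10 ^ 12) * (ε * n) ^ 2 +
        96 * ε * (ε * n) ^ 2) := by
      have h2 := (Finset.card_union_le ((R ×ˢ R).filter (fun e => e.1 = e.2)) _).trans
        (Nat.add_le_add_left (Finset.card_union_le ((R ×ˢ R).filter (fun e => e.1 ≠ e.2 ∧
          NearlyProportional r b z e.1 e.2)) ((R ×ˢ R).filter fun e => e.1 ≠ e.2 ∧
          ∃ c ∈ smallRatios, (∑ u ∈ {e.1, e.2}ᶜ, ((r e.1 u : ℝ) - c * r e.2 u) ^ 2) / 2 <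
            ∑ u ∈ {e.1, e.2}ᶜ ∩ P, ((r e.1 u : ℝ) - c * r e.2 u) ^ 2)) _)
      have h3 : (Ex.card : ℝ) ≤ _ := Nat.cast_le.2 h2
      push_cast at h3
      have h4 : (((R ×ˢ R).filter fun e => e.1 = e.2).card : ℝ) ≤ R.card := by exact_mod_cast hdiag
      linarith
    have h2 : (ε * n) ^ 2 ≤ 16 * (R.card : ℝ) ^ 2 := by
      have : ε * n ≤ 4 * R.card := by linarith
      calc (ε * n) ^ 2 ≤ (4 * R.card) ^ 2 := by gcongr
        _ = _ := by ring
    have h3 : (R.card : ℝ) ≤ 1 / 10 ^ 10 * (R.card : ℝ) ^ 2 := by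
      have : (10 : ℝ) ^ 10 ≤ R.card := by linarith
      rw [one_div_mul_eq_div, le_div_iff₀ (by positivity)]
      nlinarith
    have h4 : ε ≤ 1 / 10 ^ 40 := by
      rw [hε]
      gcongr
      nlinarith
    have h5 : 96 * ε * (ε * n) ^ 2 ≤ 96 * (1 / 10 ^ 40) * (16 * (R.card : ℝ) ^ 2) := by gcongr
    have h6 : (0 : ℝ) < (R.card : ℝ) ^ 2 := by positivity
    nlinarith
  -- A first moment bound of order κ would not survive the factor 2 · 10^20 / z lost later by
  -- induction on P. The second moment gains the small numerical factor needed; with √η = 10⁻⁵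
  -- below, both error terms of `cubeProb_pair_le` are small enough.
  refine (cubeProb_quarter_le_of_pairs hRne _ (c := 34 * κ) (c' := κ * (2 / 10 ^ 7)) (by positivity)
    (by positivity) (fun i hi => cubeProb_abs_slopeOn_le (hd0 i hi) (hcol i hi) (hκd i hi)) Ex
    hExcard ?_).trans ?_
  · intro i hi j hj hij
    have hP := cubeProb_pair_le (b := b) (S := Pᶜ) (i := i) (j := j) (z := z) (κ := κ)
      (η := (1 / 10 ^ 5) ^ 2) (hr i hi) (hr j hj)
      (hd0 i hi) (hd0 j hj) (hcol i hi) (hcol j hj) (hκd i hi) (hκd j hj) hz (by positivity)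
      (by norm_num) ?_
    · refine hP.trans ?_
      rw [Real.sqrt_sq (by positivity)]
      have h1 : κ / z = 2 / 10 ^ 18 := by rw [hκ]; field_simp
      have h2 : κ ≤ 1 / 10 ^ 18 := by rw [hκ]; gcongr; linarith
      rw [h1]
      have h3 : 3060 * κ ^ 2 ≤ 3060 * (κ * (1 / 10 ^ 18)) := by rw [sq]; gcongr
      have h4 : 90 * κ * (16 * (1 / 10 ^ 5) ^ 2 + 864 * (2 / 10 ^ 18) / (1 / 10 ^ 5)) +
          3060 * (κ * (1 / 10 ^ 18)) ≤ κ * (2 / 10 ^ 7) := by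
        have : 90 * κ * (16 * (1 / 10 ^ 5) ^ 2 + 864 * (2 / 10 ^ 18) / (1 / 10 ^ 5)) +
          3060 * (κ * (1 / 10 ^ 18)) = κ * (90 * (16 * (1 / 10 ^ 5) ^ 2 + 864 * (2 / 10 ^ 18) /
            (1 / 10 ^ 5)) + 3060 * (1 / 10 ^ 18)) := by ring
        rw [this]
        gcongr
        norm_num
      linarith
    · intro c hc
      simp only [hEx, Finset.mem_union, Finset.mem_filter, Finset.mem_product, hi, hj, true_and,
        not_or, not_and, not_exists, not_lt] at hij
      obtain ⟨hne, hfar, hex⟩ := hij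
      refine sq_le_of_not_nearlyProportional (hr i hi) (hr j hj) (hRP hi) (hRP hj) hne (hfar hne)
        ?_ hc (hex hne c hc)
      have h1 := Real.sqrt_le_sqrt (hd i hi)
      have h2 : z * √n ≤ z * (√(rowSupport r i).card + √(rowSupport r j).card) := by
        have := Real.sqrt_nonneg ((rowSupport r j).card : ℝ)
        gcongr
        linarith
      have h3 := pow_le_pow_left₀ (by positivity) h2 2
      rw [mul_pow, Real.sq_sqrt hn0.le] at h3
      linarith
  · rw [hκ]
    have : 16 * (34 * (2 * z / 10 ^ 18) * (1 / 10 ^ 9) + 2 * z / 10 ^ 18 * (2 / 10 ^ 7)) =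
      z * (16 * (34 * (2 / 10 ^ 18) * (1 / 10 ^ 9) + 2 / 10 ^ 18 * (2 / 10 ^ 7))) := by ring
    rw [this, div_eq_mul_one_div z]
    exact mul_le_mul_of_nonneg_left (by norm_num) hz.le

end Exposure

/-! ### The incoherent case: a sparse set of coordinates exposed last. -/

section Exposure

variable {ι : Type} [Fintype ι] [DecidableEq ι]

open Classical in
set_option maxHeartbeats 1000000 in
/-- If few pairs of rows are nearly proportional, then exposing a sparse random set of coordinates
last shows that a prescribed value of `Y` is unlikely, up to terms that are controlled by
induction, even in conjunction with the event that one of the slopes is small. -/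
theorem IsQuadraticOn.cubeProb_eq_and_slope_lt_le {Y : Finset ι → ℝ} {U : Finset ι}
    {r : ι → ι → ℤ} {b : ι → ℝ} (h : IsQuadraticOn Y U r b) {n : ℕ} (hU : U.card = n)
    (hrow : ∀ i ∈ U, n ≤ (rowSupport r i).card) {C : ℝ} (hC : 0 ≤ C)
    (hind : ∀ m : ℕ, 1 ≤ m → m < n → AnticoncentrationBound ι m (C / √m))
    {z : ℝ} (hz : 0 < z) (hz1 : z ≤ 1 / 8) (hn : 10 ^ 51 ≤ z ^ 2 * n)
    (hfar : (((U ×ˢ U).filter fun e => NearlyProportional r b z e.1 e.2).card : ℝ) ≤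
      1 / 10 ^ 12 * n ^ 2)
    {s : ι} (hs : s ∈ U) {W : ℝ} (hW : 0 < W) (hWs : z ^ 2 * (rowSupport r s).card ≤ W ^ 2)
    {q₀ : ℝ} (hq₀ : ∀ S : Finset ι, ((rowSupport r s).card : ℝ) / 2 ≤ (rowSupport r s ∩ S).card →
      cubeProb (fun A => |slopeOn r b S A s| < 2 * W) ≤ q₀) (ℓ : ℝ) :
    cubeProb (fun A => Y A = ℓ ∧ |slopeAt r b A s| < W) ≤
      q₀ * (2 * 10 ^ 21 / (z * √n)) + 1 / 4 * (C / √n) := by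
  -- With density ε, the part of L_i on P has size about √ε √d = 10⁻²⁰ z √d, well below the
  -- threshold κ √d for the part off P. Induction on P loses 1 / √(ε / 4) = 2 · 10^20 / z, which the
  -- bound z / 10^22 for the event `Ec` outweighs.
  set ε : ℝ := z ^ 2 / 10 ^ 40 with hε
  set κ : ℝ := 2 * z / 10 ^ 18 with hκ
  have hκ0 : 0 < κ := by positivity
  have hε0 : 0 < ε := by positivity
  have hε1 : ε ≤ 1 / 10 ^ 40 := by
    rw [hε]
    gcongr
    nlinarith
  have hn0 : (0 : ℝ) < n := by
    by_contra h
    have : z ^ 2 * n ≤ 0 := mul_nonpos_of_nonneg_of_nonpos (sq_nonneg z) (not_lt.1 h)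
    linarith [show (0 : ℝ) < 10 ^ 51 by positivity]
  have hsn : 0 < √(n : ℝ) := Real.sqrt_pos.2 hn0
  have hεn : 10 ^ 11 ≤ ε * n := by
    have : ε * n = z ^ 2 * n / 10 ^ 40 := by rw [hε]; ring
    rw [this, le_div_iff₀ (by positivity)]
    linarith
  have hn2 : 2 ≤ n := by
    have h1 : ε * n ≤ 1 * n := by gcongr; linarith
    have : (2 : ℝ) ≤ n := by linarith
    exact_mod_cast this
  have hNi : ∀ i ∈ U, i ∉ rowSupport r i := fun i hi hmem =>
    (mem_rowSupport.1 hmem) (h.diag i hi)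
  obtain ⟨P, R, hRsub, hUP, hR, hRrow, hout, hsP, hbad, hexc⟩ := exists_sparse_split hε0
    (by linarith) (by linarith) hU hrow hNi hs (NearlyProportional r b z)
    (show (0 : ℝ) < 1 / 10 ^ 12 by positivity) hfar smallRatios card_smallRatios
    (fun c i j u => ((r i u : ℝ) - c * r j u) ^ 2) (fun _ _ _ _ => sq_nonneg _)
  have hRU : R ⊆ U := hRsub.trans Finset.inter_subset_left
  have hRP : R ⊆ P := hRsub.trans Finset.inter_subset_right
  have hRpos : (0 : ℝ) < R.card := by linarith
  have hRne : R.Nonempty := Finset.card_pos.1 (by exact_mod_cast hRpos)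
  have hr2 : ∀ i ∈ U, ∀ u, |r i u| ≤ 2 := h.bound
  have hd : ∀ i ∈ U, (n : ℝ) ≤ (rowSupport r i).card := fun i hi => by exact_mod_cast hrow i hi
  have hd0 : ∀ i ∈ U, (0 : ℝ) < (rowSupport r i).card := fun i hi => hn0.trans_le (hd i hi)
  have hcompl : ∀ N : Finset ι, ((N ∩ Pᶜ).card : ℝ) = N.card - (N ∩ P).card := by
    intro N
    have : (N ∩ P).card + (N ∩ Pᶜ).card = N.card := by
      rw [← Finset.sdiff_eq_inter_compl]; exact Finset.card_inter_add_card_sdiff N P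
    rw [← this]; push_cast; ring
  have hRR : R ×ˢ R ⊆ (U ∩ P) ×ˢ (U ∩ P) := Finset.product_subset_product hRsub hRsub
  set w : ℝ := κ * √n / 2 with hw
  have hw0 : 0 < w := by positivity
  have hw2 : w ^ 2 = z ^ 2 * n / 10 ^ 36 := by
    rw [hw, div_pow, mul_pow, Real.sq_sqrt hn0.le, hκ]; ring
  -- the exceptional events
  set Ea : Finset ι → Prop := fun A => R.card * Real.exp 12 <
    ∑ i ∈ R, Real.exp (20 / w * |0 + ∑ u ∈ U ∩ P, (r i u : ℝ) * spin A u|) with hEa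
  set Eb : Finset ι → Prop := fun A => (R.card : ℝ) / 4 ≤ (R.filter fun i =>
    κ * √(rowSupport r i).card / 2 ≤ |0 + ∑ u ∈ P \ U, (r i u : ℝ) * spin A u|).card with hEb
  set Ec : Finset ι → Prop := fun A => (R.card : ℝ) / 4 ≤ (R.filter fun i =>
    |slopeOn r b Pᶜ A i| ≤ κ * √(rowSupport r i).card).card with hEc
  set Ee : Finset ι → Prop := fun A => W ≤ |0 + ∑ u ∈ P, (r s u : ℝ) * spin A u| with hEe
  have ha : cubeProb Ea ≤ 1 / 500 := by
    refine (cubeProb_exp_sum_gt_le hRne (U ∩ P) (fun _ => 0) (fun i u => (r i u : ℝ))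
      (by positivity) fun i hi => ?_).trans ?_
    · have h1 : ∑ u ∈ U ∩ P, (r i u : ℝ) ^ 2 ≤ 4 * (2 * (ε * n)) := by
        refine (sum_sq_le_card (hr2 i (hRU hi)) _).trans ?_
        have : ((rowSupport r i ∩ (U ∩ P)).card : ℝ) ≤ (U ∩ P).card := by
          exact_mod_cast Finset.card_le_card Finset.inter_subset_right
        linarith
      have h2 : (20 / w) ^ 2 * (∑ u ∈ U ∩ P, (r i u : ℝ) ^ 2) / 2 ≤
          (20 / w) ^ 2 * (4 * (2 * (ε * n))) / 2 := by gcongr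
      have h3 : (20 / w) ^ 2 * (4 * (2 * (ε * n))) / 2 = 1600 / 10 ^ 4 := by
        rw [div_pow, hw2, hε]; field_simp; norm_num
      rw [abs_zero, mul_zero, zero_add]
      linarith
    · have := exp_neg_ten_le
      norm_num at this ⊢
      linarith
  have hb : cubeProb Eb ≤ 4 * (1 / 1000) := by
    refine cubeProb_quarter_le hRne _ fun i hi => ?_
    have hdi := hd0 i (hRU hi)
    refine (cubeProb_sq_linear_ge_le (P \ U) 0 (fun u => (r i u : ℝ)) (by positivity)).trans ?_
    have h1 : ∑ u ∈ P \ U, (r i u : ℝ) ^ 2 ≤ 4 * (2 * ε * (rowSupport r i).card) := by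
      refine (sum_sq_le_card (hr2 i (hRU hi)) _).trans ?_
      have h2 : ((rowSupport r i ∩ (P \ U)).card : ℝ) ≤ (rowSupport r i ∩ P).card := by
        exact_mod_cast Finset.card_le_card
          (Finset.inter_subset_inter_left Finset.sdiff_subset)
      have := (hRrow i hi).2
      linarith
    rw [div_le_iff₀ (by positivity), div_pow, mul_pow, Real.sq_sqrt hdi.le]
    have h3 : 1 / 1000 * (κ ^ 2 * ((rowSupport r i).card : ℝ) / 2 ^ 2) =
        10 * (ε * (rowSupport r i).card) := by rw [hκ, hε]; ring
    rw [h3]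
    have : 0 < ε * (rowSupport r i).card := by positivity
    linarith
  have he : cubeProb Ee ≤ 1 / 1000 := by
    refine (cubeProb_sq_linear_ge_le P 0 (fun u => (r s u : ℝ)) hW).trans ?_
    have h1 : ∑ u ∈ P, (r s u : ℝ) ^ 2 ≤ 4 * (8 * ε * (rowSupport r s).card) := by
      have := sum_sq_le_card (hr2 s hs) P
      linarith
    rw [div_le_iff₀ (by positivity)]
    have h2 : ε * (rowSupport r s).card = z ^ 2 * (rowSupport r s).card / 10 ^ 40 := by
      rw [hε]; ring
    have h3 : z ^ 2 * (rowSupport r s).card / 10 ^ 40 ≤ W ^ 2 / 10 ^ 40 := by gcongr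
    have h4 : 0 < W ^ 2 := by positivity
    rw [← h2] at h3
    linarith
  have hc : cubeProb Ec ≤ z / 10 ^ 22 := by
    refine cubeProb_many_small_le hz hz1 hn hRP (fun i hi => hr2 i (hRU hi))
      (fun i hi => hrow i (hRU hi)) (fun i hi => ?_) hR ?_ ?_
    · rw [hcompl]
      have h1 := (hRrow i hi).2
      have := hd0 i (hRU hi)
      have h2 : 2 * ε * ((rowSupport r i).card : ℝ) ≤ 1 / 2 * (rowSupport r i).card := by
        gcongr; linarith
      linarith
    · refine le_trans ?_ hbad
      exact_mod_cast Finset.card_le_card (Finset.filter_subset_filter _ hRR)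
    · refine le_trans ?_ hexc
      exact_mod_cast Finset.card_le_card (Finset.filter_subset_filter _ hRR)
  -- the events that are handled by induction
  have hglueP : ∀ s' ⊆ P, ∀ (c : ι → ℝ) (A B : Finset ι), ∑ u ∈ s', c u * spin (glue Pᶜ A B) u =
      ∑ u ∈ s', c u * spin B u := fun s' hs' c A B =>
    sum_mul_spin_glue_of_disjoint (Finset.disjoint_left.2 fun u hu hu' =>
      Finset.mem_compl.1 hu' (hs' hu)) c A B
  -- These events depend only on coordinates in P, and at least n / 2 good directions remain off P.
  -- The loss is only √2, so a small constant probability is enough.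
  have hind1 : cubeProb (fun A => (Ea A ∨ Eb A ∨ Ee A) ∧ Y A = ℓ) ≤
      1 / 50 * (C / √(1 / 2 * n)) := by
    refine (h.cubeProb_and_le_of_lt hC hind (S := Pᶜ)
      (U' := (U ∩ Pᶜ).filter fun i => (n : ℝ) / 2 ≤ (rowSupport r i ∩ Pᶜ).card)
      ((Finset.filter_subset _ _).trans Finset.inter_subset_left)
      ((Finset.filter_subset _ _).trans Finset.inter_subset_right)
      (α := 1 / 2) (by norm_num) le_rfl hn2 (by linarith) (fun i hi => ?_) (fun A B => ?_) ℓ).trans ?_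
    · have := (Finset.mem_filter.1 hi).2
      linarith
    · simp only [hEa, hEb, hEe, hglueP _ Finset.inter_subset_right, hglueP _ Finset.sdiff_subset,
        hglueP _ subset_rfl]
    · have h1 := (cubeProb_or_le Ea (fun A => Eb A ∨ Ee A)).trans
        (add_le_add_right (cubeProb_or_le Eb Ee) _)
      have h2 : cubeProb (fun A => Ea A ∨ Eb A ∨ Ee A) ≤ 1 / 50 := by linarith
      gcongr
  -- This event depends only on coordinates off P, so induction must run inside P, where only about
  -- εn / 4 directions are available.
  have hind2 : cubeProb (fun A => Ec A ∧ Y A = ℓ) ≤ z / 10 ^ 22 * (C / √(ε / 4 * n)) := by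
    refine (h.cubeProb_and_le_of_lt hC hind (S := P) hRU hRP (α := ε / 4) (by positivity)
      (by linarith) hn2 (by linarith) (fun i hi => ?_) (fun A B => ?_) ℓ).trans ?_
    · have h1 := (hRrow i hi).1
      have h2 : ε * n ≤ ε * (rowSupport r i).card := by gcongr; exact hrow i (hRU hi)
      have : 0 < ε * n := by positivity
      linarith
    · have hdis : Disjoint (Pᶜ : Finset ι) P :=
        Finset.disjoint_left.2 fun u hu => Finset.mem_compl.1 hu
      simp only [hEc, slopeOn_glue_of_disjoint hdis]
    · gcongr
  -- the main event
  set G : Finset ι → Prop := fun A => (Y A = ℓ ∧ |slopeAt r b A s| < W) ∧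
    ¬ (Ea A ∨ Eb A ∨ Ee A) ∧ ¬ Ec A with hG
  have hmain : cubeProb G ≤ q₀ * (6 / √(ε / 8 * n)) := by
    set Zi : Finset ι → ι → ℝ := fun A i => ∑ u ∈ P \ U, (r i u : ℝ) * spin A u with hZi
    set gi : Finset ι → ι → ℝ := fun A i => ∑ u ∈ U ∩ P, (r i u : ℝ) * spin A u with hgi
    have hdis1 : Disjoint (Pᶜ : Finset ι) (U ∩ P) := Finset.disjoint_left.2 fun u hu hu' =>
      Finset.mem_compl.1 hu (Finset.mem_inter.1 hu').2
    have hdis2 : Disjoint (P \ U) (U ∩ P) := Finset.disjoint_left.2 fun u hu hu' =>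
      (Finset.mem_sdiff.1 hu).2 (Finset.mem_inter.1 hu').1
    have hLglue : ∀ A B i, slopeOn r b Pᶜ (glue (U ∩ P) A B) i = slopeOn r b Pᶜ B i :=
      fun A B i => slopeOn_glue_of_disjoint hdis1 r b A B i
    have hZglue : ∀ A B i, Zi (glue (U ∩ P) A B) i = Zi B i :=
      fun A B i => sum_mul_spin_glue_of_disjoint hdis2 _ A B
    have hslope : ∀ A i, slopeAt r b A i = (slopeOn r b Pᶜ A i + Zi A i) + gi A i :=
      fun A i => slopeAt_eq_add r b U P A i
    -- Rows whose part off P is large and is not cancelled by the part on P \ U. The latter is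
    -- measured against √d because a row may have support far larger than n; the part on U ∩ P
    -- involves at most 2εn signs and is measured against w, of order κ √n.
    set T : Finset ι → Finset ι := fun A => R.filter fun i =>
      ¬ |slopeOn r b Pᶜ A i| ≤ κ * √(rowSupport r i).card ∧
      ¬ κ * √(rowSupport r i).card / 2 ≤ |Zi A i| with hT
    have hTR : ∀ A, T A ⊆ R := fun A => Finset.filter_subset _ _
    have hTcard : ∀ A, G A → (R.card : ℝ) / 2 ≤ (T A).card := by
      intro A hA
      have h1 : ¬ Eb A := fun hE => hA.2.1 (Or.inr (Or.inl hE))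
      have h2 : ¬ Ec A := hA.2.2
      simp only [hEb, zero_add, not_le] at h1
      simp only [hEc, not_le] at h2
      have h3 : R ⊆ T A ∪ (R.filter (fun i => κ * √(rowSupport r i).card / 2 ≤ |Zi A i|) ∪
          R.filter fun i => |slopeOn r b Pᶜ A i| ≤ κ * √(rowSupport r i).card) := by
        intro i hi
        simp only [hT, Finset.mem_union, Finset.mem_filter, hi, true_and]
        tauto
      have h4 := (Finset.card_le_card h3).trans ((Finset.card_union_le _ _).trans
        (Nat.add_le_add_left (Finset.card_union_le _ _) _))
      have h5 : (R.card : ℝ) ≤ (T A).card +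
          ((R.filter (fun i => κ * √(rowSupport r i).card / 2 ≤ |Zi A i|)).card +
          (R.filter fun i => |slopeOn r b Pᶜ A i| ≤ κ * √(rowSupport r i).card).card) := by
        exact_mod_cast h4
      linarith
    refine (h.cubeProb_le_of_adaptive_pattern (S := U ∩ P) Finset.inter_subset_left T
      (fun A => Finset.univ.filter fun i => slopeOn r b Pᶜ A i + Zi A i < 0)
      (fun A B => by simp only [hT, hLglue, hZglue]) (fun A B => by simp only [hLglue, hZglue])
      (fun A => (hTR A).trans hRsub) (p := G) (q := fun A => |slopeOn r b Pᶜ A s| < 2 * W)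
      (fun A hA => ?_) (fun A B => by simp only [hLglue]) (ℓ := ℓ) (fun A hA => hA.1.1)
      (t := ε / 8 * n) (by positivity) (fun A hA => by have := hTcard A hA; linarith)
      (y := fun A i => Real.exp (20 * (|gi A i| / w - 1))) (fun A i => (Real.exp_pos _).le)
      (fun A hA => ?_) (fun A hA R' hR' hne hprod => ?_)).trans ?_
    -- A small slope at s together with a small part on P forces a small part off P. That condition
    -- does not involve U ∩ P, so it contributes the factor q₀.
    · have h1 : ¬ Ee A := fun hE => hA.2.1 (Or.inr (Or.inr hE))
      simp only [hEe, not_le, zero_add] at h1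
      have h2 : slopeAt r b A s = slopeOn r b Pᶜ A s + ∑ u ∈ P, (r s u : ℝ) * spin A u := by
        unfold slopeAt slopeOn
        rw [← Finset.sum_add_sum_compl P]; ring
      have h3 := hA.1.2
      rw [h2] at h3
      have h4 := abs_sub_abs_le_abs_sub (slopeOn r b Pᶜ A s) (-∑ u ∈ P, (r s u : ℝ) * spin A u)
      rw [abs_neg, sub_neg_eq_add] at h4
      linarith
    · have h1 : ¬ Ea A := fun hE => hA.2.1 (Or.inl hE)
      simp only [hEa, not_lt, zero_add] at h1
      -- Off `Ea` the exponential sum is at most |R| e^12, and the shift contributes e^(-20). Since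
      -- 800 e^(-8) ≤ 1 and |T| ≥ |R| / 2, the weights meet the requirement with factor 400.
      have h2 : ∑ i ∈ T A, Real.exp (20 * (|gi A i| / w - 1)) ≤ R.card * Real.exp (-8) := by
        refine (Finset.sum_le_sum_of_subset_of_nonneg (hTR A) fun i _ _ =>
          (Real.exp_pos _).le).trans ?_
        have h3 : ∀ i ∈ R, Real.exp (20 * (|gi A i| / w - 1)) =
            Real.exp (20 / w * |gi A i|) * Real.exp (-20) := by
          intro i _
          rw [← Real.exp_add]; congr 1; ring
        rw [Finset.sum_congr rfl h3, ← Finset.sum_mul]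
        have h4 : R.card * Real.exp (-8) = R.card * Real.exp 12 * Real.exp (-20) := by
          rw [mul_assoc, ← Real.exp_add]; norm_num
        rw [h4]
        exact mul_le_mul_of_nonneg_right h1 (Real.exp_pos _).le
      have h3 := hTcard A hA
      have h4 := mul_le_mul_of_nonneg_left exp_neg_eight_le hRpos.le
      linarith
    · refine sum_pos_of_dominated (by norm_num) hw0 hprod (fun i _ => hslope A i) fun i hi => ?_
      obtain ⟨hiR, hi1, hi2⟩ := Finset.mem_filter.1 (hR' hi)
      have h1 : w ≤ κ * √(rowSupport r i).card / 2 := by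
        rw [hw]; have := hd i (hRU hiR); gcongr
      have h2 : w ≤ |slopeOn r b Pᶜ A i + Zi A i| := by
        have h4 := abs_sub_abs_le_abs_sub (slopeOn r b Pᶜ A i) (-Zi A i)
        rw [abs_neg, sub_neg_eq_add] at h4
        linarith [not_le.1 hi1, not_le.1 hi2]
      simp only [Finset.mem_filter, Finset.mem_univ, true_and]
      split_ifs with hneg
      · rw [abs_of_neg hneg] at h2; linarith
      · rw [abs_of_nonneg (not_lt.1 hneg)] at h2; linarith
    · have h1 := hq₀ Pᶜ (by
        rw [hcompl]
        have h2 : 8 * ε * ((rowSupport r s).card : ℝ) ≤ 1 / 2 * (rowSupport r s).card := by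
          gcongr; linarith
        linarith)
      gcongr
  have htot : cubeProb (fun A => Y A = ℓ ∧ |slopeAt r b A s| < W) ≤ cubeProb G +
      (cubeProb (fun A => (Ea A ∨ Eb A ∨ Ee A) ∧ Y A = ℓ) + cubeProb (fun A => Ec A ∧ Y A = ℓ)) := by
    refine (cubeProb_le_add (q := G) (r := fun A => ((Ea A ∨ Eb A ∨ Ee A) ∧ Y A = ℓ) ∨
      (Ec A ∧ Y A = ℓ)) fun A hA => ?_).trans (add_le_add_right (cubeProb_or_le _ _) _)
    by_cases h1 : Ea A ∨ Eb A ∨ Ee A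
    · exact Or.inr (Or.inl ⟨h1, hA.1⟩)
    · by_cases h2 : Ec A
      · exact Or.inr (Or.inr ⟨h2, hA.1⟩)
      · exact Or.inl ⟨hA, h1, h2⟩
  have hq₀0 : 0 ≤ q₀ := by
    by_contra hneg
    have h1 := hmain
    have h2 := hq₀ Finset.univ (by
      rw [Finset.inter_univ]
      have := hd0 s hs
      linarith)
    exact hneg ((cubeProb_nonneg _).trans h2)
  have s1 : 1 / 2 * √(n : ℝ) ≤ √(1 / 2 * n) := by
    refine Real.le_sqrt_of_sq_le ?_
    rw [mul_pow, Real.sq_sqrt hn0.le]; linarith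
  have s2 : z / (2 * 10 ^ 20) * √(n : ℝ) ≤ √(ε / 4 * n) := by
    refine Real.le_sqrt_of_sq_le ?_
    rw [mul_pow, Real.sq_sqrt hn0.le, hε]
    exact le_of_eq (by ring)
  have s3 : z * √(n : ℝ) / (1 / 3 * 10 ^ 21) ≤ √(ε / 8 * n) := by
    refine Real.le_sqrt_of_sq_le ?_
    rw [div_pow, mul_pow, Real.sq_sqrt hn0.le, hε, div_le_iff₀ (by positivity)]
    have : 0 < z ^ 2 * n := by positivity
    have e : z ^ 2 / 10 ^ 40 / 8 * n * (1 / 3 * 10 ^ 21) ^ 2 = z ^ 2 * n * (100 / 72) := by ring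
    rw [e]; linarith
  have f1 : C / √(1 / 2 * n) ≤ 2 * (C / √n) := by
    calc _ ≤ C / (1 / 2 * √n) := by gcongr
      _ = _ := by field_simp
  have f2 : z / 10 ^ 22 * (C / √(ε / 4 * n)) ≤ 2 / 100 * (C / √n) := by
    calc _ ≤ z / 10 ^ 22 * (C / (z / (2 * 10 ^ 20) * √n)) := by gcongr
      _ = _ := by field_simp; ring
  have f3 : 6 / √(ε / 8 * n) ≤ 2 * 10 ^ 21 / (z * √n) := by
    calc _ ≤ 6 / (z * √n / (1 / 3 * 10 ^ 21)) := by gcongr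
      _ = _ := by field_simp; norm_num
  have f4 : q₀ * (6 / √(ε / 8 * n)) ≤ q₀ * (2 * 10 ^ 21 / (z * √n)) := by gcongr
  have f5 : 0 ≤ C / √(n : ℝ) := by positivity
  linarith

end Exposure

/-! ### The coherent case: many rows nearly proportional to one row. -/

section Coherent

variable {ι : Type} [Fintype ι] [DecidableEq ι]

theorem exp_add_le_half (x y : ℝ) : Real.exp (x + y) ≤ (Real.exp (2 * x) + Real.exp (2 * y)) / 2 := by
  have h1 : Real.exp (2 * x) = Real.exp x ^ 2 := by rw [← Real.exp_nat_mul]; norm_num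
  have h2 : Real.exp (2 * y) = Real.exp y ^ 2 := by rw [← Real.exp_nat_mul]; norm_num
  rw [Real.exp_add, h1, h2]
  nlinarith [sq_nonneg (Real.exp x - Real.exp y)]

/-- If many rows are nearly proportional to the row `s`, then on the event that the slope of `s`
is large all these slopes have prescribed signs. -/
theorem IsQuadraticOn.cubeProb_eq_and_le_slope_le {Y : Finset ι → ℝ} {U : Finset ι}
    {r : ι → ι → ℤ} {b : ι → ℝ} (h : IsQuadraticOn Y U r b) {n : ℕ} (hU : U.card = n)
    (hrow : ∀ i ∈ U, n ≤ (rowSupport r i).card) {C : ℝ} (hC : 0 ≤ C)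
    (hind : ∀ m : ℕ, 1 ≤ m → m < n → AnticoncentrationBound ι m (C / √m)) (hn : 200 ≤ n)
    (s : ι) {T : Finset ι} (hTU : T ⊆ U) {t : ℝ} (ht : 0 < t) (hT : t ≤ T.card) {c : ι → ℝ}
    (hc : ∀ j ∈ T, 1 / 2 ≤ |c j|) {W : ℝ} (hW : 0 < W)
    (hE : ∀ j ∈ T, (b j - c j * b s) ^ 2 + ∑ u, ((r j u : ℝ) - c j * r s u) ^ 2 ≤ (W / 100) ^ 2)
    (ℓ : ℝ) :
    cubeProb (fun A => Y A = ℓ ∧ W ≤ |slopeAt r b A s|) ≤ 12 / √t + 1 / 100 * (C / √n) := by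
  have hn0 : (0 : ℝ) < n := by
    have : 0 < n := by omega
    exact_mod_cast this
  have hTpos : (0 : ℝ) < T.card := by linarith
  have hTne : T.Nonempty := Finset.card_pos.1 (by exact_mod_cast hTpos)
  -- The errors L_j - c_j L_s may involve every coordinate, leaving none for induction. Splitting
  -- them over V and its complement gives two bad events, each handled by induction on the other
  -- half.
  obtain ⟨V, hV1, hV2⟩ := exists_bisection hn hU hrow
  set e : ι → ι → ℝ := fun j u => (r j u : ℝ) - c j * r s u with he
  set β : ι → ℝ := fun j => b j - c j * b s with hβ
  -- The rate 80 / W is twice the rate 40 / W in the weights, because `exp_add_le_half` doubles the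
  -- exponent when the halves are recombined. The constant term is assigned to the half V only.
  set F : Finset ι → (ι → ℝ) → Finset ι → Prop := fun S β' A => T.card * Real.exp 12 <
    ∑ j ∈ T, Real.exp (80 / W * |β' j + ∑ u ∈ S, e j u * spin A u|) with hF
  have hFprob : ∀ S (β' : ι → ℝ), (∀ j ∈ T, β' j ^ 2 ≤ β j ^ 2) → cubeProb (F S β') ≤ 1 / 500 := by
    intro S β' hβ'
    refine (cubeProb_exp_sum_gt_le hTne S β' e (by positivity) fun j hj => ?_).trans ?_
    · have h1 := hE j hj
      have h2 : ∑ u ∈ S, e j u ^ 2 ≤ ∑ u, e j u ^ 2 :=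
        Finset.sum_le_sum_of_subset_of_nonneg (Finset.subset_univ S) fun _ _ _ => sq_nonneg _
      have h3 := hβ' j hj
      have h4 : 0 ≤ ∑ u ∈ S, e j u ^ 2 := Finset.sum_nonneg fun _ _ => sq_nonneg _
      have h5 : β' j ^ 2 + ∑ u ∈ S, e j u ^ 2 ≤ (W / 100) ^ 2 := by
        change β j ^ 2 + ∑ u, e j u ^ 2 ≤ _ at h1
        linarith
      have h6 : |β' j| ≤ W / 100 := abs_le_of_sq_le_sq (by linarith) (by positivity)
      have h7 : 80 / W * |β' j| ≤ 80 / W * (W / 100) := by gcongr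
      have h8 : (80 / W) ^ 2 * (∑ u ∈ S, e j u ^ 2) / 2 ≤ (80 / W) ^ 2 * (W / 100) ^ 2 / 2 := by
        gcongr
        linarith [sq_nonneg (β' j)]
      have h9 : 80 / W * (W / 100) = 8 / 10 := by field_simp; norm_num
      have h10 : (80 / W) ^ 2 * (W / 100) ^ 2 / 2 = 32 / 100 := by field_simp; norm_num
      linarith
    · have := exp_neg_ten_le
      norm_num at this ⊢
      linarith
  have hfall : ∀ S (β' : ι → ℝ), (∀ j ∈ T, β' j ^ 2 ≤ β j ^ 2) →
      (n : ℝ) / 4 ≤ ((U ∩ Sᶜ).filter fun i => (n : ℝ) / 4 ≤ (rowSupport r i ∩ Sᶜ).card).card →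
      cubeProb (fun A => F S β' A ∧ Y A = ℓ) ≤ 1 / 500 * (2 * (C / √n)) := by
    intro S β' hβ' hS
    have hdis : Disjoint S (Sᶜ : Finset ι) := Finset.disjoint_left.2 fun u hu hu' =>
      Finset.mem_compl.1 hu' hu
    refine (h.cubeProb_and_le_of_lt hC hind (S := Sᶜ)
      (U' := (U ∩ Sᶜ).filter fun i => (n : ℝ) / 4 ≤ (rowSupport r i ∩ Sᶜ).card)
      ((Finset.filter_subset _ _).trans Finset.inter_subset_left)
      ((Finset.filter_subset _ _).trans Finset.inter_subset_right)
      (α := 1 / 4) (by norm_num) (by norm_num) (by omega) (by linarith) (fun i hi => ?_)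
      (fun A B => ?_) ℓ).trans ?_
    · have := (Finset.mem_filter.1 hi).2
      linarith
    · simp only [hF, sum_mul_spin_glue_of_disjoint hdis]
    · have h1 : √(1 / 4 * n : ℝ) = 1 / 2 * √n := by
        rw [Real.sqrt_mul (by norm_num), show (1 / 4 : ℝ) = (1 / 2) ^ 2 by norm_num,
          Real.sqrt_sq (by norm_num)]
      have h2 : C / √(1 / 4 * n : ℝ) = 2 * (C / √n) := by rw [h1]; field_simp
      rw [h2]
      have := hFprob S β' hβ'
      gcongr
  have hf1 := hfall V β (fun _ _ => le_rfl) hV2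
  have hf2 := hfall Vᶜ (fun _ => 0) (fun j _ => by rw [zero_pow two_ne_zero]; exact sq_nonneg _)
    (by rw [compl_compl]; exact hV1)
  set E : Finset ι → ι → ℝ := fun A j => slopeAt r b A j - c j * slopeAt r b A s with hEdef
  have hEsplit : ∀ A j, E A j = (β j + ∑ u ∈ V, e j u * spin A u) +
      (0 + ∑ u ∈ Vᶜ, e j u * spin A u) := by
    intro A j
    rw [zero_add, add_assoc, Finset.sum_add_sum_compl]
    simp only [hEdef, he, hβ, slopeAt, sub_mul, Finset.sum_sub_distrib, mul_add, Finset.mul_sum,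
      mul_assoc]
    ring
  -- Once the sign σ of the slope at s is fixed, direction j has the sign of σ c_j, with main term
  -- at least W / 2 since |c_j| ≥ 1/2. The pattern is deterministic, so no coordinates need to be
  -- exposed first.
  have hmain : ∀ (σ : ℝ), |σ| = 1 → cubeProb (fun A => (Y A = ℓ ∧ W ≤ σ * slopeAt r b A s) ∧
      ¬ F V β A ∧ ¬ F Vᶜ (fun _ => 0) A) ≤ 6 / √t := by
    intro σ hσ
    refine (h.cubeProb_le_of_adaptive_pattern (S := T) hTU (fun _ => T)
      (fun _ => Finset.univ.filter fun j => σ * c j < 0) (fun _ _ => rfl) (fun _ _ => rfl)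
      (fun _ => subset_rfl) (q := fun _ => True) (fun _ _ => trivial) (fun _ _ => Iff.rfl) (ℓ := ℓ)
      (fun A hA => hA.1.1) ht (fun A _ => hT)
      (y := fun A j => Real.exp (20 * (|E A j| / (W / 2) - 1))) (fun A i => (Real.exp_pos _).le)
      (fun A hA => ?_) (fun A hA R' hR' hne hprod => ?_)).trans ?_
    · obtain ⟨_, h1, h2⟩ := hA
      simp only [hF, not_lt] at h1 h2
      have h3 : ∀ j ∈ T, Real.exp (20 * (|E A j| / (W / 2) - 1)) ≤
          (Real.exp (80 / W * |β j + ∑ u ∈ V, e j u * spin A u|) +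
          Real.exp (80 / W * |0 + ∑ u ∈ Vᶜ, e j u * spin A u|)) * (Real.exp (-20) / 2) := by
        intro j _
        set x := |β j + ∑ u ∈ V, e j u * spin A u|
        set y := |0 + ∑ u ∈ Vᶜ, e j u * spin A u|
        have h4 : |E A j| ≤ x + y := by rw [hEsplit]; exact abs_add_le _ _
        have h5 := exp_add_le_half (40 / W * x) (40 / W * y)
        have h6 : 20 * (|E A j| / (W / 2) - 1) ≤ (40 / W * x + 40 / W * y) + -20 := by
          have : 20 * (|E A j| / (W / 2) - 1) = 40 / W * |E A j| - 20 := by field_simp; ring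
          rw [this, ← mul_add]
          have : 40 / W * |E A j| ≤ 40 / W * (x + y) := by gcongr
          linarith
        calc _ ≤ Real.exp ((40 / W * x + 40 / W * y) + -20) := Real.exp_le_exp.2 h6
          _ = Real.exp (40 / W * x + 40 / W * y) * Real.exp (-20) := Real.exp_add _ _
          _ ≤ (Real.exp (2 * (40 / W * x)) + Real.exp (2 * (40 / W * y))) / 2 *
              Real.exp (-20) := by gcongr
          _ = _ := by
            rw [show 2 * (40 / W * x) = 80 / W * x by ring,
              show 2 * (40 / W * y) = 80 / W * y by ring]
            ring
      have h4 := Finset.sum_le_sum h3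
      rw [← Finset.sum_mul, Finset.sum_add_distrib] at h4
      have h5 : T.card * Real.exp (-8) = T.card * Real.exp 12 * Real.exp (-20) := by
        rw [mul_assoc, ← Real.exp_add]; norm_num
      have h6 := mul_le_mul_of_nonneg_right (add_le_add h1 h2)
        (div_nonneg (Real.exp_pos (-20)).le zero_le_two)
      have h7 := mul_le_mul_of_nonneg_left exp_neg_eight_le hTpos.le
      have h8 : (T.card * Real.exp 12 + T.card * Real.exp 12) * (Real.exp (-20) / 2) =
          T.card * Real.exp 12 * Real.exp (-20) := by ring
      linarith
    · refine sum_pos_of_dominated (y := fun j => c j * slopeAt r b A s) (g := E A) (by norm_num)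
        (half_pos hW) hprod (fun j _ => by simp [hEdef]) fun j hj => ?_
      have h1 := hc j (hR' hj)
      have h2 := hA.1.2
      have h3 : (if j ∈ (Finset.univ.filter fun j => σ * c j < 0) then (-1 : ℝ) else 1) *
          (c j * slopeAt r b A s) = |c j| * (σ * slopeAt r b A s) := by
        simp only [Finset.mem_filter, Finset.mem_univ, true_and]
        rcases eq_or_eq_neg_of_abs_eq hσ with rfl | rfl
        · split_ifs with hneg
          · rw [abs_of_neg (by linarith)]; ring
          · rw [abs_of_nonneg (by linarith)]; ring
        · split_ifs with hneg
          · rw [abs_of_pos (by linarith)]; ring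
          · rw [abs_of_nonpos (by linarith)]; ring
      rw [h3]
      calc W / 2 = 1 / 2 * W := by ring
        _ ≤ _ := by gcongr
    · exact mul_le_of_le_one_left (by positivity) (cubeProb_le_one _)
  have h1 := hmain 1 (by simp)
  have h2 := hmain (-1) (by simp)
  have htot : cubeProb (fun A => Y A = ℓ ∧ W ≤ |slopeAt r b A s|) ≤
      (6 / √t + 6 / √t) + (1 / 500 * (2 * (C / √n)) + 1 / 500 * (2 * (C / √n))) := by
    refine (cubeProb_le_add fun A hA => ?_).trans (add_le_add
      ((cubeProb_or_le _ _).trans (add_le_add h1 h2))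
      ((cubeProb_or_le _ _).trans (add_le_add hf1 hf2)))
    by_cases c1 : F V β A
    · exact Or.inr (Or.inl ⟨c1, hA.1⟩)
    by_cases c2 : F Vᶜ (fun _ => 0) A
    · exact Or.inr (Or.inr ⟨c2, hA.1⟩)
    left
    rcases abs_choice (slopeAt r b A s) with h3 | h3
    · exact Or.inl ⟨⟨hA.1, by have := hA.2; rw [h3] at this; linarith⟩, c1, c2⟩
    · exact Or.inr ⟨⟨hA.1, by have := hA.2; rw [h3] at this; linarith⟩, c1, c2⟩
  have : 0 ≤ C / √(n : ℝ) := by positivity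
  have e : 12 / √t = 6 / √t + 6 / √t := by ring
  rw [e]
  linarith

theorem exists_quantile {α : Type*} {E : Finset α} (f : α → ℝ) {m : ℝ} (hm : 0 < m)
    (hE : m ≤ E.card) : ∃ e₀ ∈ E, m ≤ (E.filter fun e => f e ≤ f e₀).card ∧
      ((E.filter fun e => f e < f e₀).card : ℝ) ≤ m := by
  have hpos : (0 : ℝ) < E.card := by linarith
  have hne : E.Nonempty := Finset.card_pos.1 (by exact_mod_cast hpos)
  set G := E.filter fun e₀ => m ≤ (E.filter fun e => f e ≤ f e₀).card with hG
  have hGne : G.Nonempty := by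
    obtain ⟨e, he, hmax⟩ := Finset.exists_max_image E f hne
    refine ⟨e, Finset.mem_filter.2 ⟨he, ?_⟩⟩
    rwa [Finset.filter_true_of_mem hmax]
  obtain ⟨e₀, he₀, hmin⟩ := Finset.exists_min_image G f hGne
  obtain ⟨h1, h2⟩ := Finset.mem_filter.1 he₀
  refine ⟨e₀, h1, h2, ?_⟩
  by_contra! hlt
  have hpos' : (0 : ℝ) < (E.filter fun e => f e < f e₀).card := by linarith
  obtain ⟨e₁, he₁, hmax⟩ := Finset.exists_max_image (E.filter fun e => f e < f e₀) f
    (Finset.card_pos.1 (by exact_mod_cast hpos'))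
  obtain ⟨h3, h4⟩ := Finset.mem_filter.1 he₁
  have : e₁ ∈ G := by
    refine Finset.mem_filter.2 ⟨h3, hlt.le.trans ?_⟩
    exact_mod_cast Finset.card_le_card fun e he =>
      Finset.mem_filter.2 ⟨(Finset.mem_filter.1 he).1, hmax e he⟩
  exact absurd (hmin e₁ this) (not_le.2 h4)

/-- Every coordinate in the support of row i but not of row j adds at least 1 to the distance, so
closeness with z ≤ 1/8 forces d_i ≤ 2 d_j. The error is thereby measured by row j alone, which
serves as common reference for all rows close to it. -/
theorem rowSupport_card_le_of_close {r : ι → ι → ℤ} {b : ι → ℝ} {i j : ι} {c z : ℝ} (hz : 0 ≤ z)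
    (hz1 : z ≤ 1 / 8) (h : (b i - c * b j) ^ 2 + ∑ u, ((r i u : ℝ) - c * r j u) ^ 2 ≤
      (z * (√(rowSupport r i).card + √(rowSupport r j).card)) ^ 2) :
    (b i - c * b j) ^ 2 + ∑ u, ((r i u : ℝ) - c * r j u) ^ 2 ≤
      6 * z ^ 2 * (rowSupport r j).card := by
  set x : ℝ := ((rowSupport r i).card : ℝ) with hx
  set y : ℝ := ((rowSupport r j).card : ℝ) with hy
  have hx0 : 0 ≤ x := Nat.cast_nonneg _
  have hy0 : 0 ≤ y := Nat.cast_nonneg _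
  have h1 : (√x + √y) ^ 2 ≤ 2 * (x + y) := by
    nlinarith [Real.sq_sqrt hx0, Real.sq_sqrt hy0, sq_nonneg (√x - √y)]
  have h2 : (z * (√x + √y)) ^ 2 ≤ z ^ 2 * (2 * (x + y)) := by rw [mul_pow]; gcongr
  have h3 : x - y ≤ ∑ u, ((r i u : ℝ) - c * r j u) ^ 2 := by
    have h4 : ((rowSupport r i \ rowSupport r j).card : ℝ) ≤
        ∑ u ∈ rowSupport r i \ rowSupport r j, ((r i u : ℝ) - c * r j u) ^ 2 := by
      rw [← nsmul_one, ← Finset.sum_const]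
      refine Finset.sum_le_sum fun u hu => ?_
      obtain ⟨hu1, hu2⟩ := Finset.mem_sdiff.1 hu
      have h0 : r j u = 0 := by
        by_contra hne; exact hu2 (mem_rowSupport.2 hne)
      have := one_le_abs_intCast (mem_rowSupport.1 hu1)
      rw [h0, Int.cast_zero, mul_zero, sub_zero, ← sq_abs]
      nlinarith
    have h5 : ∑ u ∈ rowSupport r i \ rowSupport r j, ((r i u : ℝ) - c * r j u) ^ 2 ≤
        ∑ u, ((r i u : ℝ) - c * r j u) ^ 2 :=
      Finset.sum_le_sum_of_subset_of_nonneg (Finset.subset_univ _) fun _ _ _ => sq_nonneg _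
    have h6 : x ≤ (rowSupport r i \ rowSupport r j).card + y := by
      rw [hx, hy]
      exact_mod_cast (Nat.sub_le_iff_le_add.1 (Finset.le_card_sdiff _ _))
    linarith
  have h4 : z ^ 2 ≤ 1 / 64 := by nlinarith
  have h5 : x ≤ 2 * y := by
    have : z ^ 2 * (2 * (x + y)) ≤ 1 / 64 * (2 * (x + y)) := by gcongr
    have := sq_nonneg (b i - c * b j)
    linarith
  calc _ ≤ _ := h
    _ ≤ z ^ 2 * (2 * (x + y)) := h2
    _ ≤ z ^ 2 * (2 * (2 * y + y)) := by gcongr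
    _ = _ := by ring

theorem IsQuadraticOn.mono {Y : Finset ι → ℝ} {U U' : Finset ι} {r : ι → ι → ℤ} {b : ι → ℝ}
    (h : IsQuadraticOn Y U r b) (hU : U' ⊆ U) : IsQuadraticOn Y U' r b where
  bound i hi := h.bound i (hU hi)
  diag i hi := h.diag i (hU hi)
  symm i hi j hj := h.symm i (hU hi) j (hU hj)
  deriv i hi := h.deriv i (hU hi)

theorem cubeProb_abs_slopeOn_le' {r : ι → ι → ℤ} {b : ι → ℝ} {S : Finset ι} {i : ι} {t : ℝ}
    (hd : 0 < (rowSupport r i).card)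
    (hi : ((rowSupport r i).card : ℝ) / 2 ≤ (rowSupport r i ∩ S).card) (ht : 1 ≤ t) :
    cubeProb (fun A => |slopeOn r b S A i| ≤ t) ≤ 34 * (t / √(rowSupport r i).card) := by
  have hd' : 0 < √((rowSupport r i).card : ℝ) := Real.sqrt_pos.2 (by exact_mod_cast hd)
  have e : t / √(rowSupport r i).card * √(rowSupport r i).card = t := div_mul_cancel₀ _ hd'.ne'
  have := cubeProb_abs_slopeOn_le (b := b) hd hi (κ := t / √(rowSupport r i).card) (by rw [e]; exact ht)
  rwa [e] at this

end Coherent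

/-! ### The quadratic Littlewood–Offord theorem by induction. -/

section Main

variable {ι : Type} [Fintype ι] [DecidableEq ι]

theorem abs_slopeAt_le {r : ι → ι → ℤ} {b : ι → ℝ} {i : ι} (hr : ∀ u, |r i u| ≤ 2) (A : Finset ι) :
    |slopeAt r b A i| ≤ |b i| + 2 * Fintype.card ι := by
  unfold slopeAt
  refine (abs_add_le _ _).trans (add_le_add_right ((Finset.abs_sum_le_sum_abs _ _).trans ?_) _)
  have h : ∀ u ∈ Finset.univ, |(r i u : ℝ) * spin A u| ≤ 2 := fun u _ => by
    rw [abs_mul, abs_spin, mul_one]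
    exact_mod_cast hr u
  refine (Finset.sum_le_card_nsmul _ _ _ h).trans_eq ?_
  rw [nsmul_eq_mul, Finset.card_univ, mul_comm]

open Classical in
-- The induction step. The scale z is chosen so that nearly proportional pairs are rare below it and
-- numerous up to it, making both the exposure and the coherent argument available at the same z.
theorem IsQuadraticOn.cubeProb_eq_le_of_lt {Y : Finset ι → ℝ} {U : Finset ι}
    {r : ι → ι → ℤ} {b : ι → ℝ} (h : IsQuadraticOn Y U r b) {n : ℕ} (hU : U.card = n)
    (hrow : ∀ i ∈ U, n ≤ (rowSupport r i).card) (hn : 10 ^ 60 ≤ n)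
    (hind : ∀ m : ℕ, 1 ≤ m → m < n → AnticoncentrationBound ι m (10 ^ 32 / √m)) (ℓ : ℝ) :
    cubeProb (fun A => Y A = ℓ) ≤ 10 ^ 32 / √n := by
  have hnr : (10 : ℝ) ^ 60 ≤ n := by exact_mod_cast hn
  have hn0 : (0 : ℝ) < n := by linarith [show (0 : ℝ) < 10 ^ 60 by positivity]
  have hsn : 0 < √(n : ℝ) := Real.sqrt_pos.2 hn0
  have hr2 : ∀ i ∈ U, ∀ u, |r i u| ≤ 2 := h.bound
  have hd : ∀ i ∈ U, (n : ℝ) ≤ (rowSupport r i).card := fun i hi => by exact_mod_cast hrow i hi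
  have hd0 : ∀ i ∈ U, (0 : ℝ) < (rowSupport r i).card := fun i hi => hn0.trans_le (hd i hi)
  have hrat : smallRatios.Nonempty := ⟨1, by simp [smallRatios]⟩
  set M : ι → ι → ℝ → ℝ := fun i j c =>
    (b i - c * b j) ^ 2 + ∑ u, ((r i u : ℝ) - c * r j u) ^ 2 with hM
  have hM0 : ∀ i j c, 0 ≤ M i j c := fun i j c =>
    add_nonneg (sq_nonneg _) (Finset.sum_nonneg fun _ _ => sq_nonneg _)
  set X : ι → ι → ℝ := fun i j => √(rowSupport r i).card + √(rowSupport r j).card with hX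
  have hX0 : ∀ i ∈ U, ∀ j, 0 < X i j := fun i hi j =>
    add_pos_of_pos_of_nonneg (Real.sqrt_pos.2 (hd0 i hi)) (Real.sqrt_nonneg _)
  set f : ι × ι → ℝ := fun e => smallRatios.inf' hrat fun c => √(M e.1 e.2 c) / X e.1 e.2 with hf
  have hf0 : ∀ e, 0 ≤ f e := fun e => by
    refine Finset.le_inf' _ _ fun c _ => ?_
    exact div_nonneg (Real.sqrt_nonneg _) (add_nonneg (Real.sqrt_nonneg _) (Real.sqrt_nonneg _))
  have hf1 : ∀ i ∈ U, ∀ j z, 0 ≤ z → NearlyProportional r b z i j → f (i, j) < z := by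
    rintro i hi j z hz ⟨c, hc, hlt⟩
    refine (Finset.inf'_lt_iff _).2 ⟨c, hc, ?_⟩
    rw [div_lt_iff₀ (hX0 i hi j)]
    exact (Real.sqrt_lt' (lt_of_le_of_ne (mul_nonneg hz (hX0 i hi j).le) fun h0 => by
      have : M i j c < 0 := by
        have h1 : M i j c < (z * X i j) ^ 2 := hlt
        rw [← h0] at h1
        simpa using h1
      linarith [hM0 i j c])).2 hlt
  have hf2 : ∀ i ∈ U, ∀ j z, f (i, j) ≤ z → ∃ c ∈ smallRatios, M i j c ≤ (z * X i j) ^ 2 := by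
    intro i hi j z hz
    obtain ⟨c, hc, hle⟩ := (Finset.inf'_le_iff _).1 hz
    refine ⟨c, hc, ?_⟩
    rw [div_le_iff₀ (hX0 i hi j)] at hle
    have h1 : √(M i j c) ^ 2 ≤ (z * X i j) ^ 2 := pow_le_pow_left₀ (Real.sqrt_nonneg _) hle 2
    rwa [Real.sq_sqrt (hM0 i j c)] at h1
  have hUU : ((U ×ˢ U).card : ℝ) = (n : ℝ) ^ 2 := by rw [Finset.card_product, hU]; push_cast; ring
  -- f is the least relative distance from one row to an allowed multiple of the other, and z is its
  -- quantile at level 10⁻¹².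
  obtain ⟨e₀, -, hq1, hq2⟩ := exists_quantile (E := U ×ˢ U) f (m := 1 / 10 ^ 12 * (n : ℝ) ^ 2)
    (by positivity) (by rw [hUU]; exact mul_le_of_le_one_left (sq_nonneg _) (by norm_num))
  set z := f e₀ with hz
  have hz0 : 0 ≤ z := hf0 e₀
  have hfew : ∀ z' ≤ z, 0 ≤ z' → (((U ×ˢ U).filter fun e => NearlyProportional r b z' e.1 e.2).card : ℝ) ≤
      1 / 10 ^ 12 * n ^ 2 := by
    intro z' hz' hz'0
    refine le_trans ?_ hq2
    refine Nat.cast_le.2 (Finset.card_le_card fun e he => ?_)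
    obtain ⟨h1, h2⟩ := Finset.mem_filter.1 he
    exact Finset.mem_filter.2 ⟨h1, (hf1 e.1 (Finset.mem_product.1 h1).1 e.2 z' hz'0 h2).trans_le hz'⟩
  rcases le_or_gt (1 / 8) z with hcase | hcase
  · have hUne : U.Nonempty := by
      refine Finset.card_pos.1 ?_
      rw [hU]
      exact_mod_cast hn0
    obtain ⟨s, hs⟩ := hUne
    -- W exceeds every value of the slope at s, so the condition on that slope is void and q₀ = 1 is
    -- affordable, z being replaced by the constant 1/8.
    set W : ℝ := 1 + |b s| + 2 * Fintype.card ι + √(rowSupport r s).card with hW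
    have hsq := Real.sqrt_nonneg ((rowSupport r s).card : ℝ)
    have hW1 : √((rowSupport r s).card : ℝ) ≤ W := by
      have := abs_nonneg (b s)
      have : (0 : ℝ) ≤ 2 * Fintype.card ι := by positivity
      linarith
    have hW2 : ∀ A, |slopeAt r b A s| < W := fun A => by
      have := abs_slopeAt_le (b := b) (hr2 s hs) A
      linarith
    have hex := h.cubeProb_eq_and_slope_lt_le hU hrow (C := 10 ^ 32) (by positivity) hind
      (z := 1 / 8) (by norm_num) le_rfl (by linarith) (hfew _ hcase (by norm_num)) hs (W := W)
      (by linarith [(abs_nonneg _).trans_lt (hW2 ∅)])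
      (by
        have h1 := pow_le_pow_left₀ hsq hW1 2
        rw [Real.sq_sqrt (hd0 s hs).le] at h1
        linarith [hd0 s hs]) (q₀ := 1) (fun _ _ => cubeProb_le_one _) ℓ
    refine (cubeProb_mono fun A hA => ⟨hA, hW2 A⟩).trans (hex.trans ?_)
    have e : 1 * (2 * 10 ^ 21 / (1 / 8 * √(n : ℝ))) + 1 / 4 * (10 ^ 32 / √n) =
        (16 * 10 ^ 21 + 1 / 4 * 10 ^ 32) / √n := by field_simp; norm_num
    rw [e]
    gcongr
    norm_num
  -- Pigeonhole over the second member of the close pairs.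
  · have hex : ∃ s ∈ U, (n : ℝ) / 10 ^ 12 ≤ (U.filter fun j => f (j, s) ≤ z).card := by
      by_contra! hcon
      have h1 : (((U ×ˢ U).filter fun e => f e ≤ z).card : ℝ) =
          ∑ s ∈ U, ((U.filter fun j => f (j, s) ≤ z).card : ℝ) := by
        simp only [Finset.card_filter]
        push_cast
        rw [Finset.sum_product_right]
      have hUne : U.Nonempty := by
        refine Finset.card_pos.1 ?_
        rw [hU]
        exact_mod_cast hn0
      have h2 := Finset.sum_lt_sum_of_nonempty hUne hcon
      rw [Finset.sum_const, hU, nsmul_eq_mul, ← h1] at h2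
      have h3 : (n : ℝ) * (n / 10 ^ 12) = 1 / 10 ^ 12 * (n : ℝ) ^ 2 := by ring
      rw [h3] at h2
      linarith
    obtain ⟨s, hs, hT⟩ := hex
    set T := U.filter fun j => f (j, s) ≤ z with hTdef
    have hTU : T ⊆ U := Finset.filter_subset _ _
    have hch : ∀ j, ∃ c : ℝ, j ∈ T → c ∈ smallRatios ∧ M j s c ≤ (z * X j s) ^ 2 := by
      intro j
      by_cases hj : j ∈ T
      · obtain ⟨c, hc, hle⟩ := hf2 j (hTU hj) s z (Finset.mem_filter.1 hj).2
        exact ⟨c, fun _ => ⟨hc, hle⟩⟩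
      · exact ⟨0, fun h => absurd h hj⟩
    choose c hc using hch
    have hds := hd0 s hs
    set D : ℝ := √((rowSupport r s).card : ℝ) with hD
    have hD2 : D ^ 2 = (rowSupport r s).card := Real.sq_sqrt hds.le
    have hDn : √(n : ℝ) ≤ D := Real.sqrt_le_sqrt (hd s hs)
    have hD0 : 0 < D := hsn.trans_le hDn
    -- W dominates the proportionality errors, whose root mean square is at most √6 z D, while |L_s|
    -- < W still has probability only O(z + 1/√n).
    set W : ℝ := 1000 * (1 + z * D) with hW
    have hzD : 0 ≤ z * D := by positivity
    have hW0 : 0 < W := by positivity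
    have hcoh := h.cubeProb_eq_and_le_slope_le hU hrow (C := 10 ^ 32) (by positivity) hind
      (by
        have : (200 : ℝ) ≤ n := by linarith [show (200 : ℝ) ≤ 10 ^ 60 by norm_num]
        exact_mod_cast this) s hTU (t := n / 10 ^ 12) (by positivity) hT (c := c)
      (fun j hj => (smallRatio_spec (hc j hj).1).2.1) hW0 (fun j hj => by
        have h1 := rowSupport_card_le_of_close hz0 hcase.le (hc j hj).2
        refine h1.trans ?_
        rw [← hD2, hW]
        nlinarith [sq_nonneg (z * D)]) ℓ
    have hcoh' : (12 : ℝ) / √(n / 10 ^ 12) = 12 * 10 ^ 6 / √n := by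
      rw [Real.sqrt_div hn0.le, show (10 : ℝ) ^ 12 = (10 ^ 6) ^ 2 by norm_num,
        Real.sqrt_sq (by positivity)]
      field_simp
    rw [hcoh'] at hcoh
    have hsplit := cubeProb_le_add (p := fun A => Y A = ℓ) (q := fun A => Y A = ℓ ∧ |slopeAt r b A s| < W)
      (r := fun A => Y A = ℓ ∧ W ≤ |slopeAt r b A s|) fun A hA =>
        (lt_or_ge |slopeAt r b A s| W).imp (fun h => ⟨hA, h⟩) fun h => ⟨hA, h⟩
    have hball : ∀ S : Finset ι, ((rowSupport r s).card : ℝ) / 2 ≤ (rowSupport r s ∩ S).card →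
        ∀ t, 1 ≤ t → cubeProb (fun A => |slopeOn r b S A s| < t) ≤ 34 * (t / D) := by
      intro S hS t ht
      exact (cubeProb_mono fun A hA => le_of_lt hA).trans
        (cubeProb_abs_slopeOn_le' (by exact_mod_cast hds) hS ht)
    have hWD : W / D ≤ 1000 * (1 / √n + z) := by
      have : W / D = 1000 * (1 / D + z) := by rw [hW]; field_simp
      rw [this]
      gcongr
    have hinc : cubeProb (fun A => Y A = ℓ ∧ |slopeAt r b A s| < W) ≤
        10 ^ 31 / √n + 1 / 4 * (10 ^ 32 / √n) := by
      -- For z well above 1/√n, the factor q₀ = O(z) cancels the 1/z of the exposure bound.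
      -- Otherwise the probability of a small slope is already O(1/√n).
      rcases le_or_gt (10 ^ 51) (z ^ 2 * n) with hzn | hzn
      · have hzpos : 0 < z := by
          rcases hz0.lt_or_eq with h0 | h0
          · exact h0
          · rw [← h0] at hzn; norm_num at hzn
        have hzs : 1 / √(n : ℝ) ≤ z := by
          rw [div_le_iff₀ hsn]
          refine (one_le_sq_iff₀ (by positivity)).1 ?_
          rw [mul_pow, Real.sq_sqrt hn0.le]
          linarith [show (1 : ℝ) ≤ 10 ^ 51 by norm_num]
        have hexp := h.cubeProb_eq_and_slope_lt_le hU hrow (C := 10 ^ 32) (by positivity) hind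
          hzpos hcase.le hzn (hfew z le_rfl hz0) hs hW0
          (by rw [← hD2, hW]; nlinarith [sq_nonneg (z * D)]) (q₀ := 34 * (4000 * z))
          (fun S hS => (hball S hS (2 * W) (by rw [hW]; linarith)).trans (by
            rw [mul_div_assoc]
            linarith)) ℓ
        refine hexp.trans (add_le_add_left ?_ _)
        have e : 34 * (4000 * z) * (2 * 10 ^ 21 / (z * √n)) = 34 * 4000 * 2 * 10 ^ 21 / √n := by
          field_simp
        rw [e]
        gcongr
        norm_num
      · have h1 : cubeProb (fun A => |slopeAt r b A s| < W) ≤ 34 * (W / D) := by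
          have h2 : ∀ A, slopeAt r b A s = slopeOn r b Finset.univ A s := fun A => rfl
          simp only [h2]
          refine hball _ ?_ W (by rw [hW]; linarith)
          rw [Finset.inter_univ]
          linarith
        have h2 : z ≤ 10 ^ 26 / √n := by
          rw [le_div_iff₀ hsn]
          refine abs_le_of_sq_le_sq ?_ (by positivity) |> (le_abs_self _).trans
          rw [mul_pow, Real.sq_sqrt hn0.le]
          linarith [show (10 : ℝ) ^ 51 ≤ (10 ^ 26) ^ 2 by norm_num]
        have h3 : 34 * (W / D) ≤ 10 ^ 31 / √n := by
          have e : (10 : ℝ) ^ 31 / √n = 34 * (1000 * (1 / √n + (10 ^ 31 / 34000 - 1) / √n)) := by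
            field_simp; norm_num
          rw [e]
          have h4 : (10 : ℝ) ^ 26 / √n ≤ (10 ^ 31 / 34000 - 1) / √n := by
            gcongr
            norm_num
          linarith
        have h4 : (0 : ℝ) ≤ 1 / 4 * (10 ^ 32 / √n) := by positivity
        exact (cubeProb_mono fun A hA => hA.2).trans (by linarith)
    have e : (10 : ℝ) ^ 32 / √n = 10 ^ 31 / √n + 1 / 4 * (10 ^ 32 / √n) +
        (12 * 10 ^ 6 / √n + 1 / 100 * (10 ^ 32 / √n)) +
        (10 ^ 32 * (1 - 1 / 4 - 1 / 100 - 1 / 10) - 12 * 10 ^ 6) / √n := by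
      field_simp; norm_num
    have e' : (0 : ℝ) ≤ (10 ^ 32 * (1 - 1 / 4 - 1 / 100 - 1 / 10) - 12 * 10 ^ 6) / √n :=
      div_nonneg (by norm_num) hsn.le
    rw [e]
    linarith

/-- A quadratic Littlewood–Offord theorem. -/
theorem anticoncentrationBound (n : ℕ) (hn : 1 ≤ n) :
    AnticoncentrationBound ι n (10 ^ 32 / √n) := by
  induction n using Nat.strong_induction_on with
  | _ n ih =>
  intro Y U r b h hcard hrow ℓ
  obtain ⟨U', hU', hcard'⟩ := Finset.exists_subset_card_eq hcard
  rcases le_or_gt (10 ^ 60) n with hbig | hsmall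
  · exact (h.mono hU').cubeProb_eq_le_of_lt hcard' (fun i hi => hrow i (hU' hi)) hbig
      (fun m h1 h2 => ih m h2 h1) ℓ
  -- For n < 10^60 the claimed bound exceeds 1.
  · refine (cubeProb_le_one _).trans ?_
    have hn0 : (0 : ℝ) < n := by exact_mod_cast hn
    rw [le_div_iff₀ (Real.sqrt_pos.2 hn0), one_mul]
    have h1 : (n : ℝ) ≤ (10 ^ 32) ^ 2 := by
      have : (n : ℝ) < 10 ^ 60 := by exact_mod_cast hsmall
      linarith [show (10 : ℝ) ^ 60 ≤ (10 ^ 32) ^ 2 by norm_num]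
    exact Real.sqrt_le_iff.2 ⟨by positivity, h1⟩

end Main

/-! ### Independent uniform samples: resampling, Chebyshev bounds, sampled degrees. -/

section Uniform

variable {Ω κ : Type} [Fintype Ω] [Nonempty Ω] [Fintype κ] [DecidableEq κ]

/-- The mean of `f` for the uniform distribution. -/
noncomputable def uniformMean {Ω : Type} [Fintype Ω] (f : Ω → ℝ) : ℝ :=
  (∑ ω, f ω) / Fintype.card Ω

open Classical in
/-- The probability of `p` for the uniform distribution. -/
noncomputable def uniformProb {Ω : Type} [Fintype Ω] (p : Ω → Prop) : ℝ :=
  uniformMean fun ω => if p ω then 1 else 0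

theorem uniformMean_const (c : ℝ) : uniformMean (fun _ : Ω => c) = c := by
  simp [uniformMean]

theorem uniformMean_add (f g : Ω → ℝ) :
    uniformMean (fun ω => f ω + g ω) = uniformMean f + uniformMean g := by
  simp only [uniformMean, Finset.sum_add_distrib, add_div]

theorem uniformMean_const_mul (c : ℝ) (f : Ω → ℝ) :
    uniformMean (fun ω => c * f ω) = c * uniformMean f := by
  simp only [uniformMean, ← Finset.mul_sum, mul_div_assoc]

theorem uniformMean_sub (f g : Ω → ℝ) :
    uniformMean (fun ω => f ω - g ω) = uniformMean f - uniformMean g := by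
  simp only [uniformMean, Finset.sum_sub_distrib, sub_div]

theorem uniformMean_sum {α : Type*} (s : Finset α) (f : α → Ω → ℝ) :
    uniformMean (fun ω => ∑ a ∈ s, f a ω) = ∑ a ∈ s, uniformMean (f a) := by
  simp only [uniformMean, ← Finset.sum_div]
  rw [Finset.sum_comm]

theorem uniformMean_mono {f g : Ω → ℝ} (h : ∀ ω, f ω ≤ g ω) : uniformMean f ≤ uniformMean g :=
  div_le_div_of_nonneg_right (Finset.sum_le_sum fun ω _ => h ω) (Nat.cast_nonneg _)

theorem uniformMean_nonneg {f : Ω → ℝ} (h : ∀ ω, 0 ≤ f ω) : 0 ≤ uniformMean f :=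
  div_nonneg (Finset.sum_nonneg fun ω _ => h ω) (Nat.cast_nonneg _)

theorem uniformMean_comm {Ω' : Type} [Fintype Ω'] (f : Ω → Ω' → ℝ) :
    uniformMean (fun ω => uniformMean fun ω' => f ω ω') =
      uniformMean fun ω' => uniformMean fun ω => f ω ω' := by
  simp only [uniformMean, ← Finset.sum_div]
  rw [Finset.sum_comm, div_right_comm]

theorem exists_le_uniformMean (f : Ω → ℝ) : ∃ ω, f ω ≤ uniformMean f := by
  by_contra! h
  have h1 : ∑ ω : Ω, uniformMean f < ∑ ω, f ω :=
    Finset.sum_lt_sum_of_nonempty Finset.univ_nonempty fun ω _ => h ω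
  have h2 : (0 : ℝ) < Fintype.card Ω := by exact_mod_cast Fintype.card_pos
  rw [Finset.sum_const, nsmul_eq_mul, Finset.card_univ, uniformMean, mul_div_cancel₀ _ h2.ne'] at h1
  exact lt_irrefl _ h1

theorem uniformProb_nonneg (p : Ω → Prop) : 0 ≤ uniformProb p :=
  uniformMean_nonneg fun ω => by split_ifs <;> norm_num

theorem uniformProb_mono {p q : Ω → Prop} (h : ∀ ω, p ω → q ω) : uniformProb p ≤ uniformProb q := by
  refine uniformMean_mono fun ω => ?_
  by_cases hp : p ω
  · simp [hp, h ω hp]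
  · rw [if_neg hp]; split_ifs <;> norm_num

theorem uniformProb_le_one (p : Ω → Prop) : uniformProb p ≤ 1 := by
  rw [← uniformMean_const (Ω := Ω) 1]
  refine uniformMean_mono fun ω => ?_
  split_ifs <;> norm_num

theorem uniformProb_le_add {p q r : Ω → Prop} (h : ∀ ω, p ω → q ω ∨ r ω) :
    uniformProb p ≤ uniformProb q + uniformProb r := by
  rw [uniformProb, uniformProb, uniformProb, ← uniformMean_add]
  refine uniformMean_mono fun ω => ?_
  by_cases hq : q ω <;> by_cases hr : r ω <;> by_cases hp : p ω <;> simp [hq, hr, hp]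
  exact absurd (h ω hp) (by simp [hq, hr])

theorem uniformProb_le_uniformMean_div {f : Ω → ℝ} (hf : ∀ ω, 0 ≤ f ω) {t : ℝ} (ht : 0 < t)
    {p : Ω → Prop} (hp : ∀ ω, p ω → t ≤ f ω) : uniformProb p ≤ uniformMean f / t := by
  rw [le_div_iff₀ ht, mul_comm, uniformProb, ← uniformMean_const_mul]
  refine uniformMean_mono fun ω => ?_
  by_cases h : p ω
  · simpa [h] using hp ω h
  · simpa [h] using hf ω

/-- Resampling one coordinate does not change the mean. -/
theorem uniformMean_update (i : κ) (f : (κ → Ω) → ℝ) :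
    uniformMean f = uniformMean fun p => uniformMean fun ω => f (Function.update p i ω) := by
  have h2 : (0 : ℝ) < Fintype.card Ω := by exact_mod_cast Fintype.card_pos
  -- Swapping the i-th entry with the fresh sample is an involution.
  set e : (κ → Ω) × Ω → (κ → Ω) × Ω := fun x => (Function.update x.1 i x.2, x.1 i)
  have he : Function.Involutive e := fun x => by simp [e]
  have h1 : ∑ p, ∑ ω, f (Function.update p i ω) = Fintype.card Ω * ∑ p, f p := by
    rw [← Fintype.sum_prod_type', ← Equiv.sum_comp (Function.Involutive.toPerm e he)]
    have : ∀ x : (κ → Ω) × Ω, f (Function.update (Function.Involutive.toPerm e he x).1 i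
        (Function.Involutive.toPerm e he x).2) = f x.1 := by
      intro x; simp [e]
    simp only [this]
    rw [Fintype.sum_prod_type]
    simp [Finset.mul_sum]
  simp only [uniformMean, ← Finset.sum_div, h1]
  field_simp

theorem uniformMean_eval (i : κ) (f : Ω → ℝ) :
    uniformMean (fun p : κ → Ω => f (p i)) = uniformMean f := by
  rw [uniformMean_update i]
  simp only [Function.update_self, uniformMean_const]

theorem uniformMean_eval₂ {i j : κ} (hij : i ≠ j) (f : Ω → Ω → ℝ) :
    uniformMean (fun p : κ → Ω => f (p i) (p j)) =
      uniformMean fun ω => uniformMean fun ω' => f ω ω' := by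
  rw [uniformMean_update i]
  simp only [Function.update_self, Function.update_of_ne hij.symm]
  rw [uniformMean_update j]
  simp only [Function.update_self, uniformMean_const]
  rw [uniformMean_comm]

open Classical in
theorem card_filter_eq_sum {α : Type*} (Q : Finset α) (p : α → Prop) :
    ((Q.filter p).card : ℝ) = ∑ a ∈ Q, if p a then (1 : ℝ) else 0 := by
  simp

theorem uniformMean_card_filter {α : Type*} (Q : Finset α) (p : α → Ω → Prop)
    [∀ ω, DecidablePred fun a => p a ω] :
    uniformMean (fun ω => ((Q.filter fun a => p a ω).card : ℝ)) = ∑ a ∈ Q, uniformProb (p a) := by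
  classical
  have h : ∀ ω, ((Q.filter fun a => p a ω).card : ℝ) = ∑ a ∈ Q, if p a ω then (1 : ℝ) else 0 :=
    fun ω => by simp
  simp only [h, uniformMean_sum, uniformProb]
  refine Finset.sum_congr rfl fun a _ => ?_
  congr 1
  ext ω
  by_cases hp : p a ω <;> simp [hp]

open Classical in
/-- The variance of a binomial random variable. -/
theorem uniformMean_sq_card_filter_sub_le (Q : Finset κ) (g : Ω → Prop) :
    uniformMean (fun p : κ → Ω =>
      (((Q.filter fun j => g (p j)).card : ℝ) - Q.card * uniformProb g) ^ 2) ≤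
      Q.card * uniformProb g := by
  set π := uniformProb g with hπ
  set χ : Ω → ℝ := fun ω => (if g ω then 1 else 0) - π with hχ
  have hχ0 : uniformMean χ = 0 := by
    rw [hχ, uniformMean_sub, uniformMean_const]
    exact sub_self π
  have h1 : ∀ p : κ → Ω, (((Q.filter fun j => g (p j)).card : ℝ) - Q.card * π) ^ 2 =
      ∑ i ∈ Q, ∑ j ∈ Q, χ (p i) * χ (p j) := by
    intro p
    rw [← Finset.sum_mul_sum, ← sq]
    congr 1
    simp only [hχ, Finset.sum_sub_distrib, ← card_filter_eq_sum Q fun j => g (p j),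
      Finset.sum_const, nsmul_eq_mul]
  simp only [h1, uniformMean_sum]
  have h2 : ∀ i ∈ Q, ∑ j ∈ Q, uniformMean (fun p : κ → Ω => χ (p i) * χ (p j)) ≤ π := by
    intro i hi
    rw [Finset.sum_eq_single_of_mem i hi]
    · rw [uniformMean_eval i fun ω => χ ω * χ ω]
      have h3 : ∀ ω, χ ω * χ ω ≤ (1 - 2 * π) * (if g ω then 1 else 0) + π ^ 2 := by
        intro ω
        simp only [hχ]
        split_ifs <;> nlinarith
      refine (uniformMean_mono h3).trans ?_
      rw [uniformMean_add, uniformMean_const_mul, uniformMean_const]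
      change (1 - 2 * π) * π + π ^ 2 ≤ π
      nlinarith [sq_nonneg π]
    · intro j _ hj
      rw [uniformMean_eval₂ hj.symm fun a b => χ a * χ b]
      simp only [uniformMean_const_mul, hχ0, mul_zero, uniformMean_const]
  refine (Finset.sum_le_card_nsmul _ _ _ h2).trans_eq ?_
  rw [nsmul_eq_mul]

open Classical in
theorem uniformProb_card_filter_lt_le {Q : Finset κ} {g : Ω → Prop} (hQ : Q.Nonempty)
    (hg : 0 < uniformProb g) :
    uniformProb (fun p : κ → Ω => ((Q.filter fun j => g (p j)).card : ℝ) <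
      Q.card * uniformProb g / 2) ≤ 4 / (Q.card * uniformProb g) := by
  have hpos : (0 : ℝ) < Q.card := by exact_mod_cast hQ.card_pos
  have h1 := uniformProb_le_uniformMean_div
    (f := fun p : κ → Ω => (((Q.filter fun j => g (p j)).card : ℝ) - Q.card * uniformProb g) ^ 2)
    (p := fun p => ((Q.filter fun j => g (p j)).card : ℝ) < Q.card * uniformProb g / 2)
    (fun _ => sq_nonneg _) (t := (Q.card * uniformProb g / 2) ^ 2) (by positivity) (fun p hp => by
      rw [← neg_sq (((Q.filter fun j => g (p j)).card : ℝ) - _)]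
      exact pow_le_pow_left₀ (by positivity) (by linarith) 2)
  refine h1.trans ?_
  calc _ ≤ Q.card * uniformProb g / (Q.card * uniformProb g / 2) ^ 2 := by
        gcongr
        exact uniformMean_sq_card_filter_sub_le Q g
    _ = _ := by field_simp; norm_num

open Classical in
/-- If a relation has many elements of large degree, so does its restriction to a random sample. -/
theorem uniformProb_few_rows_le {R : Ω → Ω → Prop} {τ : ℝ} (hτ : 0 < τ)
    (hR : τ ≤ uniformProb fun ω => τ ≤ uniformProb (R ω)) {Q Q' : Finset κ} (hQQ' : Disjoint Q Q')
    (hQ : Q.Nonempty) (hQ' : Q'.Nonempty) :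
    uniformProb (fun p : κ → Ω => ((Q.filter fun i => (Q'.card : ℝ) * τ / 2 ≤
      (Q'.filter fun j => R (p i) (p j)).card).card : ℝ) < Q.card * τ / 4) ≤
      4 / (Q.card * τ) + 16 / (Q'.card * τ) := by
  set g : Ω → Prop := fun ω => τ ≤ uniformProb (R ω) with hg
  set π := uniformProb g with hπ
  have hπ0 : 0 < π := by linarith
  have hpos : (0 : ℝ) < Q.card := by exact_mod_cast hQ.card_pos
  have hpos' : (0 : ℝ) < Q'.card := by exact_mod_cast hQ'.card_pos
  set bad : κ → (κ → Ω) → Prop := fun i p => g (p i) ∧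
    ((Q'.filter fun j => R (p i) (p j)).card : ℝ) < Q'.card * τ / 2 with hbad
  have h1 : ∀ i ∈ Q, uniformProb (bad i) ≤ π * (4 / (Q'.card * τ)) := by
    intro i hi
    -- Hence p i is independent of the sample on Q', and may be resampled and fixed before the
    -- degree into Q' is estimated.
    have hiQ' : i ∉ Q' := Finset.disjoint_left.1 hQQ' hi
    rw [uniformProb, uniformMean_update i]
    have h2 : ∀ (p : κ → Ω) (ω : Ω), bad i (Function.update p i ω) ↔ g ω ∧
        ((Q'.filter fun j => R ω (p j)).card : ℝ) < Q'.card * τ / 2 := by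
      intro p ω
      have h3 : (Q'.filter fun j => R (Function.update p i ω i) (Function.update p i ω j)) =
          Q'.filter fun j => R ω (p j) := by
        refine Finset.filter_congr fun j hj => ?_
        rw [Function.update_self, Function.update_of_ne fun h => hiQ' (by rwa [← h])]
      simp only [hbad, h3]
      rw [Function.update_self]
    simp only [h2]
    rw [uniformMean_comm, mul_comm π, hπ, uniformProb, ← uniformMean_const_mul]
    refine uniformMean_mono fun ω => ?_
    by_cases hω : g ω
    · simp only [hω, true_and, if_true, mul_one]
      have hν : τ ≤ uniformProb (R ω) := hω
      have h3 := uniformProb_card_filter_lt_le (κ := κ) (g := R ω) hQ' (by linarith)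
      refine (uniformProb_mono fun p hp => lt_of_lt_of_le hp ?_).trans (h3.trans ?_)
      · gcongr
      · gcongr
    · simp only [hω, false_and, if_false, mul_zero]
      rw [uniformMean_const]
  have h2 : uniformProb (fun p : κ → Ω => Q.card * π / 4 ≤ ((Q.filter fun i => bad i p).card : ℝ)) ≤
      16 / (Q'.card * τ) := by
    refine (uniformProb_le_uniformMean_div (f := fun p => ((Q.filter fun i => bad i p).card : ℝ))
      (fun _ => Nat.cast_nonneg _) (t := Q.card * π / 4) (by positivity) (fun p hp => hp)).trans ?_
    rw [uniformMean_card_filter, div_le_iff₀ (by positivity)]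
    refine (Finset.sum_le_card_nsmul _ _ _ h1).trans_eq ?_
    rw [nsmul_eq_mul]
    ring
  have h3 := uniformProb_card_filter_lt_le (κ := κ) (g := g) hQ hπ0
  refine (uniformProb_le_add fun p hp => ?_).trans (add_le_add (h3.trans ?_) h2)
  · by_contra! hcon
    obtain ⟨c1, c2⟩ := hcon
    have hsub : (Q.filter fun i => g (p i)) ⊆ (Q.filter fun i => (Q'.card : ℝ) * τ / 2 ≤
        (Q'.filter fun j => R (p i) (p j)).card) ∪ Q.filter fun i => bad i p := by
      intro i hi
      obtain ⟨hiQ, hgi⟩ := Finset.mem_filter.1 hi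
      by_cases hc : (Q'.card : ℝ) * τ / 2 ≤ (Q'.filter fun j => R (p i) (p j)).card
      · exact Finset.mem_union_left _ (Finset.mem_filter.2 ⟨hiQ, hc⟩)
      · exact Finset.mem_union_right _ (Finset.mem_filter.2 ⟨hiQ, hgi, not_le.1 hc⟩)
    have h4 := (Finset.card_le_card hsub).trans (Finset.card_union_le _ _)
    have h5 : ((Q.filter fun i => g (p i)).card : ℝ) ≤ (Q.filter fun i => (Q'.card : ℝ) * τ / 2 ≤
        (Q'.filter fun j => R (p i) (p j)).card).card + (Q.filter fun i => bad i p).card := by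
      exact_mod_cast h4
    have h6 : (Q.card : ℝ) * τ / 4 ≤ Q.card * π / 4 := by gcongr
    linarith
  · gcongr

end Uniform

/-! ### Kernels with few nonzero alternating four-cycles, and concentration of pair counts. -/

section NearlyConstant

variable {Ω : Type} [Fintype Ω] [Nonempty Ω]

theorem uniformMean_prod {Ω' : Type} [Fintype Ω'] (f : Ω × Ω' → ℝ) :
    uniformMean f = uniformMean fun ω => uniformMean fun ω' => f (ω, ω') := by
  simp only [uniformMean, ← Finset.sum_div, Fintype.sum_prod_type, Fintype.card_prod]
  push_cast
  rw [div_div, mul_comm]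

/-- The probability of a relation between two independent uniform elements. -/
noncomputable def pairProb {Ω : Type} [Fintype Ω] (p : Ω → Ω → Prop) : ℝ :=
  uniformMean fun ω => uniformProb (p ω)

theorem pairProb_comm (p : Ω → Ω → Prop) : pairProb (fun x y => p y x) = pairProb p := by
  unfold pairProb uniformProb
  rw [uniformMean_comm]

theorem pairProb_le_add {p q r : Ω → Ω → Prop} (h : ∀ x y, p x y → q x y ∨ r x y) :
    pairProb p ≤ pairProb q + pairProb r := by
  unfold pairProb
  rw [← uniformMean_add]
  exact uniformMean_mono fun x => uniformProb_le_add (h x)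

theorem pairProb_le_of_forall {p : Ω → Ω → Prop} {G : Ω → Prop} {a c : ℝ} (hc : 0 ≤ c)
    (hG : uniformProb (fun x => ¬ G x) ≤ a) (h : ∀ x, G x → uniformProb (p x) ≤ c) :
    pairProb p ≤ a + c := by
  classical
  refine le_trans ?_ (add_le_add_left hG c)
  rw [pairProb, uniformProb, ← uniformMean_const (Ω := Ω) c, ← uniformMean_add]
  refine uniformMean_mono fun x => ?_
  by_cases hx : G x
  · simpa [hx] using h x hx
  · have := uniformProb_le_one (p x)
    simp only [hx, not_false_eq_true, if_true]
    linarith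

theorem pairProb_of_left (p : Ω → Prop) : pairProb (fun x _ : Ω => p x) = uniformProb p := by
  classical
  unfold pairProb uniformProb
  simp only [uniformMean_const]

/-- Averaging over x: some value of h is at least as common as the collision probability. -/
theorem exists_uniformProb_ne_le {α : Type*} (h : Ω → α) :
    ∃ x, uniformProb (fun z => h z ≠ h x) ≤ pairProb fun x z => h x ≠ h z := by
  obtain ⟨x, hx⟩ := exists_le_uniformMean fun x => uniformProb fun z => h x ≠ h z
  exact ⟨x, (uniformProb_mono fun z hz => Ne.symm hz).trans hx⟩

/-- A function that is close to a function of either variable is close to a constant. -/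
theorem exists_pairProb_ne_le {W : Ω → Ω → ℤ} (hsymm : ∀ x y, W x y = W y x) (h : Ω → ℤ) :
    ∃ x, uniformProb (fun z => h z ≠ h x) ≤ 2 * pairProb fun x z => W x z ≠ h x := by
  obtain ⟨x, hx⟩ := exists_uniformProb_ne_le h
  refine ⟨x, hx.trans ?_⟩
  have h1 : pairProb (fun x z => h x ≠ h z) ≤
      pairProb (fun x z => W x z ≠ h x) + pairProb fun x z => W z x ≠ h z :=
    pairProb_le_add fun x z hne => by
      by_contra! hcon
      exact hne (by rw [← hcon.1, hsymm, hcon.2])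
  rw [pairProb_comm fun x z => W x z ≠ h x] at h1
  linarith

/-- A symmetric kernel with values in `{0, 1}`, most of whose alternating four-cycle sums vanish,
is nearly constant. -/
theorem exists_nearly_constant {W : Ω → Ω → ℤ} (hsymm : ∀ x y, W x y = W y x)
    (h01 : ∀ x y, W x y = 0 ∨ W x y = 1) {τ : ℝ} (hτ : 0 < τ)
    (hR : uniformProb (fun ω : Ω × Ω => τ ≤ uniformProb fun ω' : Ω × Ω =>
      W ω.1 ω'.1 - W ω.2 ω'.1 - W ω.1 ω'.2 + W ω.2 ω'.2 ≠ 0) < τ) :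
    ∃ g : ℤ, (g = 0 ∨ g = 1) ∧ pairProb (fun x z => W x z ≠ g) ≤ 18 * τ := by
  classical
  obtain ⟨y, hy⟩ : ∃ y, uniformProb (fun x => τ ≤ uniformProb fun ω' : Ω × Ω =>
      W x ω'.1 - W y ω'.1 - W x ω'.2 + W y ω'.2 ≠ 0) < τ := by
    rw [uniformProb, uniformMean_prod, uniformMean_comm] at hR
    obtain ⟨y, hy⟩ := exists_le_uniformMean fun y => uniformMean fun x =>
      if τ ≤ uniformProb (fun ω' : Ω × Ω => W x ω'.1 - W y ω'.1 - W x ω'.2 + W y ω'.2 ≠ 0)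
        then (1 : ℝ) else 0
    exact ⟨y, hy.trans_lt hR⟩
  set Good : Ω → Prop := fun x => ¬ τ ≤ uniformProb fun ω' : Ω × Ω =>
      W x ω'.1 - W y ω'.1 - W x ω'.2 + W y ω'.2 ≠ 0 with hGood
  have hbad : uniformProb (fun x => ¬ Good x) ≤ τ := by
    simp only [hGood, not_not]
    exact hy.le
  have hgood : ∀ x, Good x → ∃ c : ℤ, (c = 0 ∨ c = 1 ∨ c = -1) ∧
      uniformProb (fun z => W x z ≠ W y z + c) ≤ τ := by
    intro x hx
    simp only [hGood, not_le] at hx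
    rw [uniformProb, uniformMean_prod, uniformMean_comm] at hx
    obtain ⟨w, hw⟩ := exists_le_uniformMean fun w => uniformProb fun z =>
      W x z - W y z - W x w + W y w ≠ 0
    refine ⟨W x w - W y w, ?_, ?_⟩
    · rcases h01 x w with h1 | h1 <;> rcases h01 y w with h2 | h2 <;> rw [h1, h2] <;> simp
    · refine le_trans ?_ (hw.trans (show _ ≤ τ from hx.le))
      refine uniformProb_mono (q := fun z => W x z - W y z - W x w + W y w ≠ 0) fun z hz h0 => ?_
      exact hz (by linarith)
  -- Good rows equal row y plus a constant c, up to a fraction τ. If some c is ±1, values in {0, 1}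
  -- force row y to be nearly constant. If every c is 0, then W x z is nearly a function of z alone,
  -- hence nearly constant by symmetry.
  have hg1 : ∃ g₁ : ℤ, (g₁ = 0 ∨ g₁ = 1) ∧ uniformProb (fun z => W y z ≠ g₁) ≤ 4 * τ := by
    by_cases hex : ∃ x, Good x ∧ ∃ c : ℤ, (c = 1 ∨ c = -1) ∧
        uniformProb (fun z => W x z ≠ W y z + c) ≤ τ
    · obtain ⟨x, -, c, hc, hle⟩ := hex
      rcases hc with rfl | rfl
      · refine ⟨0, Or.inl rfl, (uniformProb_mono fun z hz => ?_).trans (hle.trans (by linarith))⟩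
        rcases h01 x z with h1 | h1 <;> rcases h01 y z with h2 | h2 <;> rw [h1, h2] <;> omega
      · refine ⟨1, Or.inr rfl, (uniformProb_mono fun z hz => ?_).trans (hle.trans (by linarith))⟩
        rcases h01 x z with h1 | h1 <;> rcases h01 y z with h2 | h2 <;> rw [h1, h2] <;> omega
    · have h0 : ∀ x, Good x → uniformProb (fun z => W x z ≠ W y z) ≤ τ := by
        intro x hx
        obtain ⟨c, hc, hle⟩ := hgood x hx
        rcases hc with rfl | hc
        · simpa using hle
        · exact absurd ⟨x, hx, c, hc, hle⟩ hex
      have h1 := pairProb_le_of_forall hτ.le hbad h0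
      rw [← pairProb_comm] at h1
      obtain ⟨x, hx⟩ := exists_pairProb_ne_le (W := fun x z => W z x) (fun x z => hsymm z x) (W y)
      exact ⟨W y x, h01 y x, by linarith⟩
  obtain ⟨g₁, hg₁, hle₁⟩ := hg1
  have hh : ∀ x, ∃ h : ℤ, (h = 0 ∨ h = 1) ∧ (Good x → uniformProb (fun z => W x z ≠ h) ≤ 5 * τ) := by
    intro x
    by_cases hx : Good x
    · obtain ⟨c, hc, hle⟩ := hgood x hx
      rcases hc with rfl | rfl | rfl
      · refine ⟨g₁, hg₁, fun _ => (uniformProb_le_add fun z hz => ?_).trans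
          ((add_le_add hle hle₁).trans (by linarith))⟩
        by_contra! hcon
        exact hz (by rw [hcon.1, hcon.2, add_zero])
      · refine ⟨1, Or.inr rfl, fun _ => (uniformProb_mono fun z hz => ?_).trans
          (hle.trans (by linarith))⟩
        rcases h01 x z with h1 | h1 <;> rcases h01 y z with h2 | h2 <;> rw [h1, h2] <;> omega
      · refine ⟨0, Or.inl rfl, fun _ => (uniformProb_mono fun z hz => ?_).trans
          (hle.trans (by linarith))⟩
        rcases h01 x z with h1 | h1 <;> rcases h01 y z with h2 | h2 <;> rw [h1, h2] <;> omega
    · exact ⟨0, Or.inl rfl, fun h => absurd h hx⟩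
  choose h hh0 hh1 using hh
  have h1 := pairProb_le_of_forall (by linarith) hbad hh1
  -- W x z differs from h x with probability at most τ + 5τ. Symmetry makes h constant up to twice
  -- this, and the total is 6τ + 12τ = 18τ.
  obtain ⟨x, hx⟩ := exists_pairProb_ne_le hsymm h
  refine ⟨h x, hh0 x, ?_⟩
  have h2 : pairProb (fun x' z => W x' z ≠ h x) ≤ pairProb (fun x z => W x z ≠ h x) +
      pairProb fun x' _ => h x' ≠ h x :=
    pairProb_le_add fun x' z hne => by
      by_contra! hcon
      exact hne (by rw [hcon.1, hcon.2])
  rw [pairProb_of_left] at h2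
  linarith

variable {κ : Type} [Fintype κ] [DecidableEq κ]

open Classical in
/-- The variance of the number of pairs of a random sample that satisfy a relation. -/
theorem uniformMean_sq_card_pairs_sub_le (F : Ω → Ω → Prop) :
    uniformMean (fun p : κ → Ω =>
      (((Finset.univ.offDiag.filter fun e : κ × κ => F (p e.1) (p e.2)).card : ℝ) -
        (Finset.univ : Finset κ).offDiag.card * pairProb F) ^ 2) ≤
      8 * (Fintype.card κ : ℝ) ^ 3 * pairProb F := by
  set θ := pairProb F with hθ
  have hθ0 : 0 ≤ θ := uniformMean_nonneg fun x => uniformProb_nonneg _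
  have hθ1 : θ ≤ 1 := by
    rw [← uniformMean_const (Ω := Ω) 1]
    exact uniformMean_mono fun x => uniformProb_le_one _
  set D := (Finset.univ : Finset κ).offDiag with hD
  set χ : Ω → Ω → ℝ := fun x y => (if F x y then 1 else 0) - θ with hχ
  have hχ0 : uniformMean (fun y => uniformMean fun x => χ x y) = 0 := by
    rw [uniformMean_comm]
    simp only [hχ, uniformMean_sub, uniformMean_const]
    exact sub_self θ
  have h1 : ∀ p : κ → Ω, (((D.filter fun e : κ × κ => F (p e.1) (p e.2)).card : ℝ) -
      D.card * θ) ^ 2 = ∑ e ∈ D, ∑ e' ∈ D, χ (p e.1) (p e.2) * χ (p e'.1) (p e'.2) := by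
    intro p
    rw [← Finset.sum_mul_sum, ← sq]
    congr 1
    simp only [hχ, Finset.sum_sub_distrib,
      ← card_filter_eq_sum D fun e : κ × κ => F (p e.1) (p e.2), Finset.sum_const, nsmul_eq_mul]
  simp only [h1, uniformMean_sum]
  set K := Fintype.card κ with hK
  -- Pairs with no common index are independent and contribute 0; at most 4K ordered pairs share an
  -- index with a given one.
  have hterm : ∀ e ∈ D, ∀ e' ∈ D,
      uniformMean (fun p : κ → Ω => χ (p e.1) (p e.2) * χ (p e'.1) (p e'.2)) ≤
        if e'.1 = e.1 ∨ e'.1 = e.2 ∨ e'.2 = e.1 ∨ e'.2 = e.2 then 2 * θ else 0 := by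
    intro e he e' he'
    have hne := (Finset.mem_offDiag.1 he).2.2
    split_ifs with hshare
    · have h2 : ∀ p : κ → Ω, χ (p e.1) (p e.2) * χ (p e'.1) (p e'.2) ≤
          (if F (p e.1) (p e.2) then 1 else 0) + θ ^ 2 := by
        intro p
        simp only [hχ]
        split_ifs <;> nlinarith
      refine (uniformMean_mono h2).trans ?_
      rw [uniformMean_add, uniformMean_const,
        uniformMean_eval₂ hne fun x y => if F x y then (1 : ℝ) else 0]
      change θ + θ ^ 2 ≤ 2 * θ
      nlinarith
    · simp only [not_or] at hshare
      obtain ⟨n1, n2, n3, n4⟩ := hshare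
      rw [uniformMean_update e.1]
      simp only [Function.update_self, Function.update_of_ne hne.symm, Function.update_of_ne n1,
        Function.update_of_ne n3]
      rw [uniformMean_update e.2]
      simp only [Function.update_self, Function.update_of_ne n2, Function.update_of_ne n4]
      have h2 : ∀ p : κ → Ω, uniformMean (fun ω' => uniformMean fun ω =>
          χ ω ω' * χ (p e'.1) (p e'.2)) = 0 := by
        intro p
        simp only [mul_comm _ (χ (p e'.1) (p e'.2)), uniformMean_const_mul, hχ0, mul_zero]
      simp only [h2, uniformMean_const, le_refl]
  have hrow : ∀ e ∈ D, ∑ e' ∈ D, uniformMean (fun p : κ → Ω =>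
      χ (p e.1) (p e.2) * χ (p e'.1) (p e'.2)) ≤ 4 * K * (2 * θ) := by
    intro e he
    refine (Finset.sum_le_sum (hterm e he)).trans ?_
    rw [← Finset.sum_filter, Finset.sum_const, nsmul_eq_mul]
    have hsub : (D.filter fun e' => e'.1 = e.1 ∨ e'.1 = e.2 ∨ e'.2 = e.1 ∨ e'.2 = e.2) ⊆
        ({e.1, e.2} : Finset κ) ×ˢ Finset.univ ∪ Finset.univ ×ˢ ({e.1, e.2} : Finset κ) := by
      intro e' he'
      have := (Finset.mem_filter.1 he').2
      simp only [Finset.mem_union, Finset.mem_product, Finset.mem_insert, Finset.mem_singleton,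
        Finset.mem_univ, and_true, true_and]
      tauto
    have hcard := (Finset.card_le_card hsub).trans (Finset.card_union_le _ _)
    rw [Finset.card_product, Finset.card_product, Finset.card_univ, ← hK] at hcard
    have h2 : ({e.1, e.2} : Finset κ).card ≤ 2 := Finset.card_le_two
    have h3 : (D.filter fun e' => e'.1 = e.1 ∨ e'.1 = e.2 ∨ e'.2 = e.1 ∨ e'.2 = e.2).card ≤ 4 * K := by
      nlinarith
    gcongr
    exact_mod_cast h3
  refine (Finset.sum_le_card_nsmul _ _ _ hrow).trans ?_
  rw [nsmul_eq_mul]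
  have hDc : (D.card : ℝ) ≤ (K : ℝ) ^ 2 := by
    have : D.card ≤ K ^ 2 := by
      rw [hD, Finset.offDiag_card, Finset.card_univ, ← hK, sq]
      exact Nat.sub_le _ _
    exact_mod_cast this
  calc _ ≤ (K : ℝ) ^ 2 * (4 * K * (2 * θ)) := by gcongr
    _ = _ := by ring

open Classical in
theorem uniformProb_card_pairs_ge_le (F : Ω → Ω → Prop) {t : ℝ} (ht : 0 < t)
    (h : (Fintype.card κ : ℝ) ^ 2 * pairProb F ≤ t) :
    uniformProb (fun p : κ → Ω => 2 * t ≤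
      ((Finset.univ.offDiag.filter fun e : κ × κ => F (p e.1) (p e.2)).card : ℝ)) ≤
      8 * (Fintype.card κ : ℝ) ^ 3 * pairProb F / t ^ 2 := by
  have hθ0 : 0 ≤ pairProb F := uniformMean_nonneg fun x => uniformProb_nonneg _
  have hDc : ((Finset.univ : Finset κ).offDiag.card : ℝ) ≤ (Fintype.card κ : ℝ) ^ 2 := by
    have : (Finset.univ : Finset κ).offDiag.card ≤ Fintype.card κ ^ 2 := by
      rw [Finset.offDiag_card, Finset.card_univ, sq]
      exact Nat.sub_le _ _
    exact_mod_cast this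
  refine (uniformProb_le_uniformMean_div (f := fun p : κ → Ω =>
    (((Finset.univ.offDiag.filter fun e : κ × κ => F (p e.1) (p e.2)).card : ℝ) -
        (Finset.univ : Finset κ).offDiag.card * pairProb F) ^ 2) (fun _ => sq_nonneg _)
    (t := t ^ 2) (by positivity) (fun p hp => ?_)).trans
    (div_le_div_of_nonneg_right (uniformMean_sq_card_pairs_sub_le F) (by positivity))
  refine pow_le_pow_left₀ ht.le ?_ 2
  have : ((Finset.univ : Finset κ).offDiag.card : ℝ) * pairProb F ≤ t :=
    (mul_le_mul_of_nonneg_right hDc hθ0).trans h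
  linarith

end NearlyConstant

/-! ### Random tuples as random selections, and point probabilities of pair sums. -/

section Kernel

variable {V κ : Type} [Fintype V] [Nonempty V] [Fintype κ] [DecidableEq κ]

/-- The sum of a kernel over all ordered pairs of distinct entries of a tuple. -/
def pairSum (W : V → V → ℤ) (v : κ → V) : ℤ := ∑ i, ∑ j, if i = j then 0 else W (v i) (v j)

/-- The tuple that takes its entries from the first or second components of `p` according to
`A`. -/
def selectBy (A : Finset κ) (p : κ → V × V) (i : κ) : V := if i ∈ A then (p i).1 else (p i).2

/-- The alternating sum of a kernel along a four-cycle. -/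
def alternatingSum (W : V → V → ℤ) (a c : V × V) : ℤ :=
  W a.1 c.1 - W a.2 c.1 - W a.1 c.2 + W a.2 c.2

theorem pairSum_sub_of_eq_off {W : V → V → ℤ} (hsymm : ∀ x y, W x y = W y x) {v v' : κ → V} {i : κ}
    (h : ∀ j, j ≠ i → v j = v' j) :
    pairSum W v - pairSum W v' =
      2 * ∑ j, if i = j then 0 else W (v i) (v j) - W (v' i) (v j) := by
  unfold pairSum
  rw [← Finset.sum_sub_distrib]
  have h1 : ∀ a b : κ, ((if a = b then 0 else W (v a) (v b)) - if a = b then 0 else W (v' a) (v' b)) =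
      (if a = i then (if i = b then 0 else W (v i) (v b) - W (v' i) (v b)) else 0) +
      (if b = i then (if i = a then 0 else W (v i) (v a) - W (v' i) (v a)) else 0) := by
    intro a b
    by_cases ha : a = i
    · subst ha
      by_cases hb : b = a
      · subst hb; simp
      · rw [if_neg (Ne.symm hb), if_neg (Ne.symm hb), if_pos rfl, if_neg (Ne.symm hb), if_neg hb,
          h b hb, add_zero]
    · by_cases hb : b = i
      · subst hb
        rw [if_neg ha, if_neg ha, if_neg ha, if_pos rfl, if_neg (Ne.symm ha), ← h a ha, zero_add,
          hsymm (v a), hsymm (v a)]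
      · by_cases hab : a = b
        · simp [hab, hb]
        · simp [hab, ha, hb, h a ha, h b hb]
  have h2 : ∀ a, (∑ b, (if a = b then 0 else W (v a) (v b))) -
      ∑ b, (if a = b then 0 else W (v' a) (v' b)) =
      (if a = i then ∑ b, (if i = b then 0 else W (v i) (v b) - W (v' i) (v b)) else 0) +
      (if i = a then 0 else W (v i) (v a) - W (v' i) (v a)) := by
    intro a
    rw [← Finset.sum_sub_distrib, Finset.sum_congr rfl fun b _ => h1 a b, Finset.sum_add_distrib]
    congr 1
    · split_ifs with h3 <;> simp
    · simp
  rw [Finset.sum_congr rfl fun a _ => h2 a, Finset.sum_add_distrib]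
  simp only [Finset.sum_ite_eq', Finset.mem_univ, if_true]
  ring

/-- The kernel at a selected vertex is the half-sum plus spin times the half-difference over its two
candidates, so increments are affine in the spins. The factor 2 clears the halves, leaving integer
coefficients of size at most 2. -/
theorem isQuadraticOn_pairSum {W : V → V → ℤ} (hsymm : ∀ x y, W x y = W y x)
    (h01 : ∀ x y, W x y = 0 ∨ W x y = 1) (p : κ → V × V) (U : Finset κ) :
    IsQuadraticOn (fun A => 2 * (pairSum W (selectBy A p) : ℝ)) U
      (fun i u => if i = u then 0 else alternatingSum W (p i) (p u))
      (fun i => ∑ u, if i = u then 0 else (W (p i).1 (p u).1 - W (p i).2 (p u).1 +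
        W (p i).1 (p u).2 - W (p i).2 (p u).2 : ℝ)) where
  bound i _ u := by
    split_ifs
    · simp
    · unfold alternatingSum
      rw [abs_le]
      rcases h01 (p i).1 (p u).1 with h1 | h1 <;> rcases h01 (p i).2 (p u).1 with h2 | h2 <;>
        rcases h01 (p i).1 (p u).2 with h3 | h3 <;> rcases h01 (p i).2 (p u).2 with h4 | h4 <;>
        rw [h1, h2, h3, h4] <;> norm_num
  diag i _ := by simp
  symm i _ j _ := by
    by_cases hij : i = j
    · simp [hij]
    · simp only [hij, Ne.symm hij, if_false, alternatingSum, hsymm (p j).1, hsymm (p j).2]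
      ring
  deriv i _ A := by
    have hoff : ∀ j, j ≠ i → selectBy (insert i A) p j = selectBy (A.erase i) p j := by
      intro j hj
      simp [selectBy, hj]
    have h := pairSum_sub_of_eq_off hsymm hoff
    have h' : (pairSum W (selectBy (insert i A) p) : ℝ) - pairSum W (selectBy (A.erase i) p) =
        2 * ∑ j, if i = j then 0 else ((W (p i).1 (selectBy (insert i A) p j) : ℝ) -
          W (p i).2 (selectBy (insert i A) p j)) := by
      have e1 : selectBy (insert i A) p i = (p i).1 := by simp [selectBy]
      have e2 : selectBy (A.erase i) p i = (p i).2 := by simp [selectBy]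
      rw [e1, e2] at h
      have := congrArg (fun x : ℤ => (x : ℝ)) h
      push_cast at this
      exact this
    rw [← mul_sub, h', slopeAt, ← Finset.sum_add_distrib, Finset.mul_sum]
    congr 1
    refine Finset.sum_congr rfl fun u _ => ?_
    by_cases hu : i = u
    · simp [hu]
    · by_cases hA : u ∈ A
      · simp [hu, selectBy, hA, spin, alternatingSum]; ring
      · simp [hu, Ne.symm hu, selectBy, hA, spin, alternatingSum]; ring

/-- For fixed A, the selected and the rejected candidates together form a bijective recoding of p,
so the selected tuple is uniform. -/
theorem uniformMean_selectBy (A : Finset κ) (f : (κ → V) → ℝ) :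
    uniformMean (fun p : κ → V × V => f (selectBy A p)) = uniformMean f := by
  set e : (κ → V × V) ≃ (κ → V) × (κ → V) :=
    { toFun := fun p => (selectBy A p, fun i => if i ∈ A then (p i).2 else (p i).1)
      invFun := fun x i => if i ∈ A then (x.1 i, x.2 i) else (x.2 i, x.1 i)
      left_inv := fun p => by
        ext i <;> by_cases hi : i ∈ A <;> simp [selectBy, hi]
      right_inv := fun x => by
        ext i <;> by_cases hi : i ∈ A <;> simp [selectBy, hi] } with he
  have h1 : ∑ p : κ → V × V, f (selectBy A p) = Fintype.card (κ → V) * ∑ v, f v := by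
    have h2 : ∀ p, f (selectBy A p) = (fun x : (κ → V) × (κ → V) => f x.1) (e p) := fun p => rfl
    rw [Finset.sum_congr rfl fun p _ => h2 p, Equiv.sum_comp e fun x => f x.1,
      Fintype.sum_prod_type]
    simp [Finset.mul_sum]
  have h2 : Fintype.card (κ → V × V) = Fintype.card (κ → V) * Fintype.card (κ → V) := by
    rw [← Fintype.card_prod]
    exact Fintype.card_congr e
  have h3 : (0 : ℝ) < Fintype.card (κ → V) := by exact_mod_cast Fintype.card_pos
  rw [uniformMean, h1, h2, uniformMean]
  push_cast
  field_simp

theorem uniformProb_eq_uniformMean_cubeProb (q : (κ → V) → Prop) :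
    uniformProb q = uniformMean fun p : κ → V × V => cubeProb fun A => q (selectBy A p) := by
  classical
  have h1 : ∀ A : Finset κ, uniformProb (fun p : κ → V × V => q (selectBy A p)) = uniformProb q :=
    fun A => uniformMean_selectBy A fun v => if q v then 1 else 0
  have h2 : (fun p : κ → V × V => cubeProb fun A => q (selectBy A p)) = fun p =>
      (1 / 2 ^ Fintype.card κ : ℝ) * ∑ A, if q (selectBy A p) then 1 else 0 := by
    ext p
    rw [cubeProb, cubeMean, one_div_mul_eq_div]
  rw [h2, uniformMean_const_mul, uniformMean_sum]
  have h3 : ∀ A : Finset κ, uniformMean (fun p : κ → V × V =>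
      if q (selectBy A p) then (1 : ℝ) else 0) = uniformProb q := h1
  rw [Finset.sum_congr rfl fun A _ => h3 A, Finset.sum_const, Finset.card_univ, Fintype.card_finset,
    nsmul_eq_mul]
  push_cast
  field_simp

/-- Anticoncentration of `pairSum W` when the kernel has many rows that differ substantially. -/
theorem uniformProb_pairSum_eq_le {W : V → V → ℤ} (hsymm : ∀ x y, W x y = W y x)
    (h01 : ∀ x y, W x y = 0 ∨ W x y = 1) {τ : ℝ} (hτ : 0 < τ)
    (hR : τ ≤ uniformProb fun a : V × V => τ ≤ uniformProb fun c => alternatingSum W a c ≠ 0)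
    {k : ℕ} (hk : 2 ≤ k) (s : ℤ) :
    uniformProb (fun v : Fin k → V => pairSum W v = s) ≤
      10 ^ 32 / √(k * τ / 12) + 60 / (k * τ) := by
  classical
  have hk0 : (0 : ℝ) < k := by
    have : 0 < k := by omega
    exact_mod_cast this
  -- Directions are sought in one half of the indices and counted against the other half, which
  -- keeps the two samples independent.
  set Q : Finset (Fin k) := Finset.univ.filter fun i => (i : ℕ) < k / 2 with hQ
  set Q' : Finset (Fin k) := Finset.univ.filter fun i => ¬ (i : ℕ) < k / 2 with hQ'
  have hQc : Q.card = k / 2 := by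
    rw [hQ, Fin.card_filter_val_lt]
    omega
  have hQQ' : Disjoint Q Q' := Finset.disjoint_filter_filter_not _ _ _
  have hQ'c : Q'.card = k - k / 2 := by
    have := Finset.card_filter_add_card_filter_not (s := (Finset.univ : Finset (Fin k)))
      (fun i : Fin k => (i : ℕ) < k / 2)
    rw [Finset.card_univ, Fintype.card_fin] at this
    change Q.card + Q'.card = k at this
    omega
  have hq : (k : ℝ) / 3 ≤ Q.card := by
    rw [hQc, div_le_iff₀ (by norm_num)]
    exact_mod_cast (by omega : k ≤ k / 2 * 3)
  have hq' : (k : ℝ) / 3 ≤ Q'.card := by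
    rw [hQ'c, div_le_iff₀ (by norm_num)]
    exact_mod_cast (by omega : k ≤ (k - k / 2) * 3)
  have hQne : Q.Nonempty := Finset.card_pos.1 (by rw [hQc]; omega)
  have hQ'ne : Q'.Nonempty := Finset.card_pos.1 (by rw [hQ'c]; omega)
  have hfew := uniformProb_few_rows_le hτ hR hQQ' hQne hQ'ne
  set rows : (Fin k → V × V) → Finset (Fin k) := fun p => Q.filter fun i => (Q'.card : ℝ) * τ / 2 ≤
    (Q'.filter fun j => alternatingSum W (p i) (p j) ≠ 0).card with hrows
  have hbad : uniformProb (fun p : Fin k → V × V => ((rows p).card : ℝ) < Q.card * τ / 4) ≤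
      60 / (k * τ) := by
    refine le_trans (le_of_eq ?_) (hfew.trans ?_)
    · congr 1
      ext p
      rw [hrows]
      congr!
    · calc 4 / (Q.card * τ) + 16 / (Q'.card * τ) ≤ 4 / (k / 3 * τ) + 16 / (k / 3 * τ) := by gcongr
        _ = _ := by field_simp; norm_num
  have hkτ : 0 < k * τ / 12 := by positivity
  have hgood : ∀ p : Fin k → V × V, ¬ ((rows p).card : ℝ) < Q.card * τ / 4 →
      cubeProb (fun A => pairSum W (selectBy A p) = s) ≤ 10 ^ 32 / √(k * τ / 12) := by
    intro p hp
    have h1 : 1 ≤ ⌈k * τ / 12⌉₊ := Nat.one_le_ceil_iff.2 hkτ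
    have hanti := anticoncentrationBound (ι := Fin k) _ h1 _ (rows p) _ _
      (isQuadraticOn_pairSum hsymm h01 p (rows p)) (Nat.ceil_le.2 (by nlinarith [not_lt.1 hp]))
      (fun i hi => Nat.ceil_le.2 ?_) (2 * (s : ℝ))
    · refine (cubeProb_mono fun A hA => ?_).trans (hanti.trans ?_)
      · rw [hA]
      · have := Real.sqrt_pos.2 hkτ
        have := Nat.le_ceil (k * τ / 12)
        gcongr
    · obtain ⟨hiQ, h2⟩ := Finset.mem_filter.1 hi
      have h3 : k * τ / 12 ≤ Q'.card * τ / 2 := by nlinarith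
      refine h3.trans (h2.trans ?_)
      refine Nat.cast_le.2 (Finset.card_le_card fun j hj => ?_)
      obtain ⟨hjQ, hj⟩ := Finset.mem_filter.1 hj
      have hij : i ≠ j := fun h => Finset.disjoint_left.1 hQQ' hiQ (h ▸ hjQ)
      rw [mem_rowSupport, if_neg hij]
      exact hj
  rw [uniformProb_eq_uniformMean_cubeProb]
  have h0 : 0 ≤ (10 : ℝ) ^ 32 / √(k * τ / 12) := by positivity
  have h1 : ∀ p : Fin k → V × V, cubeProb (fun A => pairSum W (selectBy A p) = s) ≤
      10 ^ 32 / √(k * τ / 12) + if ((rows p).card : ℝ) < Q.card * τ / 4 then 1 else 0 := by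
    intro p
    split_ifs with hp
    · have := cubeProb_le_one fun A => pairSum W (selectBy A p) = s
      linarith
    · rw [add_zero]; exact hgood p hp
  refine (uniformMean_mono h1).trans ?_
  rw [uniformMean_add, uniformMean_const]
  refine add_le_add_right (le_trans (le_of_eq ?_) hbad) _
  rw [uniformProb]

theorem pairSum_eq_sum_offDiag (W : V → V → ℤ) (v : κ → V) :
    pairSum W v = ∑ e ∈ (Finset.univ : Finset κ).offDiag, W (v e.1) (v e.2) := by
  have h1 : (Finset.univ : Finset κ).offDiag =
      (Finset.univ ×ˢ Finset.univ).filter fun e : κ × κ => e.1 ≠ e.2 := by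
    ext e; simp
  rw [h1, Finset.sum_filter, Finset.sum_product]
  unfold pairSum
  refine Finset.sum_congr rfl fun i _ => Finset.sum_congr rfl fun j _ => ?_
  by_cases hij : i = j <;> simp [hij]

theorem pairSum_one_sub (W : V → V → ℤ) (v : κ → V) :
    pairSum (fun x y => 1 - W x y) v =
      (Fintype.card κ : ℤ) * (Fintype.card κ - 1) - pairSum W v := by
  rw [pairSum_eq_sum_offDiag, pairSum_eq_sum_offDiag, Finset.sum_sub_distrib, Finset.sum_const,
    Finset.offDiag_card, Finset.card_univ, nsmul_eq_mul, mul_one,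
    Nat.cast_sub (Nat.le_mul_self _)]
  push_cast
  ring

/-- The point probabilities of `pairSum W`, in the lower half of its range. -/
theorem uniformProb_pairSum_eq_le_of_le {W : V → V → ℤ} (hsymm : ∀ x y, W x y = W y x)
    (h01 : ∀ x y, W x y = 0 ∨ W x y = 1) {k ℓ : ℕ} (hℓ : 0 < ℓ) (hk : 4 * ℓ ≤ k * (k - 1)) :
    uniformProb (fun v : Fin k → V => pairSum W v = 2 * ℓ) ≤ 10 ^ 35 / √((ℓ : ℝ) / k) := by
  classical
  have hk2 : 2 ≤ k := by
    by_contra h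
    have : k - 1 = 0 := by omega
    rw [this] at hk
    omega
  have hk0 : (0 : ℝ) < k := by
    have : 0 < k := by omega
    exact_mod_cast this
  have hℓ0 : (0 : ℝ) < ℓ := by exact_mod_cast hℓ
  set m : ℝ := (ℓ : ℝ) / k with hm
  have hm0 : 0 < m := by positivity
  have hsm : 0 < √m := Real.sqrt_pos.2 hm0
  rcases lt_or_ge m 1 with hm1 | hm1
  · refine (uniformProb_le_one _).trans ?_
    rw [le_div_iff₀ hsm]
    have : √m ≤ 1 := Real.sqrt_le_one.2 hm1.le
    linarith [show (1 : ℝ) ≤ 10 ^ 35 by norm_num]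
  have hsm1 : 1 ≤ √m := Real.one_le_sqrt.2 hm1
  have hinv : 1 / m ≤ 1 / √m := by
    refine one_div_le_one_div_of_le hsm ?_
    have := Real.sq_sqrt hm0.le
    nlinarith
  -- With this τ, the nearly constant case has at most 18τk² = ℓ/2 expected exceptional pairs,
  -- whereas kτ = m / 36 is of the order wanted in the other case.
  set τ : ℝ := ℓ / (36 * k ^ 2) with hτdef
  have hτ : 0 < τ := by positivity
  rcases le_or_gt τ (uniformProb fun a : V × V => τ ≤ uniformProb fun c =>
    alternatingSum W a c ≠ 0) with hcase | hcase
  · refine (uniformProb_pairSum_eq_le hsymm h01 hτ hcase hk2 (2 * ℓ)).trans ?_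
    have h1 : k * τ = m / 36 := by rw [hτdef, hm]; field_simp
    have h2 : √m / 21 ≤ √(m / 36 / 12) := by
      refine Real.le_sqrt_of_sq_le ?_
      rw [div_pow, Real.sq_sqrt hm0.le]
      linarith
    rw [h1]
    calc (10 : ℝ) ^ 32 / √(m / 36 / 12) + 60 / (m / 36) ≤ 10 ^ 32 / (√m / 21) + 2160 * (1 / √m) := by
          refine add_le_add (by gcongr) ?_
          have : 60 / (m / 36) = 2160 * (1 / m) := by field_simp; norm_num
          rw [this]
          gcongr
      _ = (10 ^ 32 * 21 + 2160) / √m := by field_simp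
      _ ≤ _ := by gcongr; norm_num
  · obtain ⟨g, hg, hle⟩ := exists_nearly_constant hsymm h01 hτ hcase
    have hk2θ : (Fintype.card (Fin k) : ℝ) ^ 2 * pairProb (fun x z => W x z ≠ g) ≤ ℓ := by
      rw [Fintype.card_fin]
      have h1 : (k : ℝ) ^ 2 * (18 * τ) = ℓ / 2 := by rw [hτdef]; field_simp; norm_num
      have h2 : (k : ℝ) ^ 2 * pairProb (fun x z => W x z ≠ g) ≤ k ^ 2 * (18 * τ) := by gcongr
      linarith
    have hconc := uniformProb_card_pairs_ge_le (κ := Fin k) (fun x z => W x z ≠ g) hℓ0 hk2θ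
    have hcount : ∀ v : Fin k → V, pairSum W v = 2 * ℓ → (2 * ℓ : ℝ) ≤
        ((Finset.univ.offDiag.filter fun e : Fin k × Fin k => W (v e.1) (v e.2) ≠ g).card : ℝ) := by
      intro v hv
      rw [pairSum_eq_sum_offDiag] at hv
      have hcard : ((Finset.univ.offDiag.filter fun e : Fin k × Fin k =>
          W (v e.1) (v e.2) ≠ g).card : ℤ) = ∑ e ∈ (Finset.univ : Finset (Fin k)).offDiag,
            if W (v e.1) (v e.2) ≠ g then 1 else 0 := by
        rw [Finset.card_filter]
        push_cast
        rfl
      have hD : (((Finset.univ : Finset (Fin k)).offDiag.card : ℕ) : ℤ) = k * (k - 1 : ℕ) := by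
        rw [Finset.offDiag_card, Finset.card_univ, Fintype.card_fin, ← Nat.mul_sub_one, Nat.cast_mul]
      -- If g = 1 the exceptional ordered pairs are the k(k - 1) - 2ℓ non-edges, at least 2ℓ because
      -- ℓ lies in the lower half of the range.
      have hgoal : (2 * ℓ : ℤ) ≤ ((Finset.univ.offDiag.filter fun e : Fin k × Fin k =>
          W (v e.1) (v e.2) ≠ g).card : ℤ) := by
        rw [hcard]
        rcases hg with rfl | rfl
        · rw [← hv]
          refine Finset.sum_le_sum fun e _ => ?_
          rcases h01 (v e.1) (v e.2) with h | h <;> rw [h] <;> simp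
        · have h1 : ∀ e ∈ (Finset.univ : Finset (Fin k)).offDiag,
              (if W (v e.1) (v e.2) ≠ 1 then (1 : ℤ) else 0) = 1 - W (v e.1) (v e.2) := by
            intro e _
            rcases h01 (v e.1) (v e.2) with h | h <;> rw [h] <;> simp
          rw [Finset.sum_congr rfl h1, Finset.sum_sub_distrib, hv, Finset.sum_const, nsmul_eq_mul,
            mul_one, hD]
          have : (4 * ℓ : ℤ) ≤ k * (k - 1 : ℕ) := by exact_mod_cast hk
          linarith
      exact_mod_cast hgoal
    refine (uniformProb_mono hcount).trans (le_trans (le_of_eq ?_) (hconc.trans ?_))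
    · congr 1
      ext v
      congr!
    · rw [Fintype.card_fin]
      calc 8 * (k : ℝ) ^ 3 * pairProb (fun x z => W x z ≠ g) / (ℓ : ℝ) ^ 2 ≤
            8 * (k : ℝ) ^ 3 * (18 * τ) / (ℓ : ℝ) ^ 2 := by gcongr
        _ = 4 * (1 / m) := by rw [hτdef, hm]; field_simp; norm_num
        _ ≤ 4 * (1 / √m) := by gcongr
        _ = 4 / √m := by ring
        _ ≤ _ := by gcongr; norm_num

/-- The point probabilities of `pairSum W`. -/
theorem uniformProb_pairSum_eq_le_min {W : V → V → ℤ} (hsymm : ∀ x y, W x y = W y x)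
    (h01 : ∀ x y, W x y = 0 ∨ W x y = 1) {k ℓ : ℕ} (hℓ : 0 < ℓ) (hk : ℓ < k.choose 2) :
    uniformProb (fun v : Fin k → V => pairSum W v = 2 * ℓ) ≤
      10 ^ 35 / √(min (ℓ : ℝ) ((k.choose 2 : ℝ) - ℓ) / k) := by
  have hch : 2 * k.choose 2 = k * (k - 1) := by
    rw [Nat.choose_two_right, Nat.mul_div_cancel' (Nat.even_mul_pred_self k).two_dvd]
  rcases le_total (2 * ℓ) (k.choose 2) with h | h
  · have h1 : min (ℓ : ℝ) ((k.choose 2 : ℝ) - ℓ) = ℓ := by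
      refine min_eq_left ?_
      have : (2 * ℓ : ℝ) ≤ k.choose 2 := by exact_mod_cast h
      linarith
    rw [h1]
    exact uniformProb_pairSum_eq_le_of_le hsymm h01 hℓ (by omega)
  · have h1 : min (ℓ : ℝ) ((k.choose 2 : ℝ) - ℓ) = ((k.choose 2 - ℓ : ℕ) : ℝ) := by
      rw [Nat.cast_sub hk.le]
      refine min_eq_right ?_
      have : (k.choose 2 : ℝ) ≤ 2 * ℓ := by exact_mod_cast h
      linarith
    rw [h1]
    refine (uniformProb_mono fun v hv => ?_).trans
      (uniformProb_pairSum_eq_le_of_le (W := fun x y => 1 - W x y) (k := k) (ℓ := k.choose 2 - ℓ)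
        (fun x y => by rw [hsymm]) (fun x y => by rcases h01 x y with h | h <;> simp [h])
        (by omega) (by omega))
    rw [pairSum_one_sub, hv, Fintype.card_fin, Nat.cast_sub hk.le]
    have h2 : (2 * k.choose 2 : ℤ) = k * (k - 1) := by
      have hk1 : 1 ≤ k := by
        by_contra h0
        have : k = 0 := by omega
        subst this
        simp at hk
      have : ((k - 1 : ℕ) : ℤ) = k - 1 := by push_cast [hk1]; rfl
      rw [← this]
      exact_mod_cast hch
    rw [← h2]
    ring

end Kernel

/-! ### From random tuples to vertex sets, and existence of the limit. -/

section Graphs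

open Classical in
/-- The adjacency kernel of a graph. -/
noncomputable def adjKernel {V : Type} (G : SimpleGraph V) (x y : V) : ℤ := if G.Adj x y then 1 else 0

/-- The pair sum over an enumeration of s is the degree sum of the induced graph. -/
theorem pairSum_adjKernel_equiv {V : Type} [Fintype V] (G : SimpleGraph V) {k : ℕ} {s : Finset V}
    (e : Fin k ≃ s) :
    pairSum (adjKernel G) (fun i => (e i : V)) = 2 * (G.induce (s : Set V)).edgeSet.ncard := by
  classical
  set H := G.induce (s : Set V) with hH
  have h1 : H.edgeSet.ncard = H.edgeFinset.card := by
    rw [Set.ncard_eq_toFinset_card', SimpleGraph.edgeFinset]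
  have h2 := H.sum_degrees_eq_twice_card_edges
  have h3 : pairSum (adjKernel G) (fun i => (e i : V)) = ∑ x : (s : Set V), (H.degree x : ℤ) := by
    unfold pairSum
    let e' : Fin k ≃ (s : Set V) := e
    rw [← Equiv.sum_comp e']
    refine Finset.sum_congr rfl fun i _ => ?_
    rw [← SimpleGraph.card_neighborFinset_eq_degree, SimpleGraph.neighborFinset_eq_filter,
      Finset.card_filter]
    push_cast
    refine Eq.trans ?_ (Equiv.sum_comp e' fun x => if H.Adj (e' i) x then (1 : ℤ) else 0)
    refine Finset.sum_congr rfl fun j _ => ?_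
    have h4 : H.Adj (e' i) (e' j) ↔ G.Adj (e i) (e j) := Iff.rfl
    by_cases hij : i = j
    · subst hij; simp
    · simp only [hij, if_false, adjKernel, h4]
  rw [h3, h1]
  exact_mod_cast h2

/-- Each counted k-set has k! enumerations, all of them distinct tuples with the prescribed pair
sum; tuples with repetitions only help the inequality. -/
theorem inducedCount_mul_factorial_le {n : ℕ} (G : SimpleGraph (Fin n)) (k ℓ : ℕ) :
    (inducedCount G k ℓ : ℝ) * k.factorial ≤
      (n : ℝ) ^ k * uniformProb (fun v : Fin k → Fin n => pairSum (adjKernel G) v = 2 * ℓ) := by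
  classical
  set 𝒮 := (Finset.powersetCard k (Finset.univ : Finset (Fin n))).filter
    (fun s : Finset (Fin n) => (G.induce (s : Set (Fin n))).edgeSet.ncard = ℓ) with h𝒮
  have hcount : inducedCount G k ℓ = 𝒮.card := by
    unfold inducedCount
    congr!
  have hspec : ∀ s : 𝒮, (s : Finset (Fin n)).card = k ∧
      (G.induce ((s : Finset (Fin n)) : Set (Fin n))).edgeSet.ncard = ℓ := fun s => by
    obtain ⟨h1, h2⟩ := Finset.mem_filter.1 s.2
    exact ⟨(Finset.mem_powersetCard.1 h1).2, h2⟩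
  have hinj : Fintype.card (Σ s : 𝒮, Fin k ≃ (s : Finset (Fin n))) ≤
      Fintype.card {v : Fin k → Fin n // pairSum (adjKernel G) v = 2 * ℓ} := by
    refine Fintype.card_le_of_injective (fun x => ⟨fun i => (x.2 i : Fin n), by
      rw [pairSum_adjKernel_equiv, (hspec x.1).2]⟩) ?_
    rintro ⟨⟨s, hs⟩, e⟩ ⟨⟨s', hs'⟩, e'⟩ h
    have hv : ∀ i, (e i : Fin n) = e' i := fun i => congrFun (Subtype.ext_iff.1 h) i
    have hss : s = s' := by
      ext x
      constructor
      · intro hx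
        have := hv (e.symm ⟨x, hx⟩)
        rw [Equiv.apply_symm_apply] at this
        have h2 := (e' (e.symm ⟨x, hx⟩)).2
        rw [← this] at h2
        exact h2
      · intro hx
        have := hv (e'.symm ⟨x, hx⟩)
        rw [Equiv.apply_symm_apply] at this
        have h2 := (e (e'.symm ⟨x, hx⟩)).2
        rw [this] at h2
        exact h2
    subst hss
    have : e = e' := Equiv.ext fun i => Subtype.ext (hv i)
    rw [this]
  have hleft : Fintype.card (Σ s : 𝒮, Fin k ≃ (s : Finset (Fin n))) =
      𝒮.card * k.factorial := by
    rw [Fintype.card_sigma]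
    have : ∀ s : 𝒮, Fintype.card (Fin k ≃ (s : Finset (Fin n))) = k.factorial := fun s => by
      rw [Fintype.card_equiv (Finset.equivFinOfCardEq (hspec s).1).symm, Fintype.card_fin]
    simp [this]
  have hright : (Fintype.card {v : Fin k → Fin n // pairSum (adjKernel G) v = 2 * ℓ} : ℝ) ≤
      (n : ℝ) ^ k * uniformProb (fun v : Fin k → Fin n => pairSum (adjKernel G) v = 2 * ℓ) := by
    have hsum : (∑ v : Fin k → Fin n, if pairSum (adjKernel G) v = 2 * ℓ then (1 : ℝ) else 0) =
        Fintype.card {v : Fin k → Fin n // pairSum (adjKernel G) v = 2 * ℓ} := by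
      rw [Finset.sum_boole, Fintype.card_subtype]
    have hprob : uniformProb (fun v : Fin k → Fin n => pairSum (adjKernel G) v = 2 * ℓ) =
        Fintype.card {v : Fin k → Fin n // pairSum (adjKernel G) v = 2 * ℓ} / (n : ℝ) ^ k := by
      rw [← hsum, uniformProb, uniformMean, Fintype.card_fun, Fintype.card_fin, Fintype.card_fin]
      push_cast
      congr!
    rw [hprob]
    rcases Nat.eq_zero_or_pos (n ^ k) with h0 | h0
    · have hc : Fintype.card (Fin k → Fin n) = 0 := by
        rw [Fintype.card_fun, Fintype.card_fin, Fintype.card_fin, h0]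
      have : IsEmpty (Fin k → Fin n) := Fintype.card_eq_zero_iff.1 hc
      simp
    · have h1 : (n : ℝ) ^ k ≠ 0 := by exact_mod_cast h0.ne'
      rw [mul_div_cancel₀ _ h1]
  rw [hcount]
  refine le_trans ?_ hright
  rw [← Nat.cast_mul, ← hleft]
  exact_mod_cast hinj

/-- Bernoulli's inequality: (1 - k/n)^k ≥ 1 - k²/n ≥ 1/2. This is the cost of sampling with
replacement. -/
theorem pow_le_two_mul_descFactorial {n k : ℕ} (h : 2 * k ^ 2 ≤ n) (hn : 0 < n) :
    (n : ℝ) ^ k ≤ 2 * n.descFactorial k := by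
  have hn0 : (0 : ℝ) < n := by exact_mod_cast hn
  have hkn : k ≤ n := by nlinarith
  have h1 : ((n - k : ℕ) : ℝ) ^ k ≤ n.descFactorial k := by
    have h2 : (n - k) ^ k ≤ n.descFactorial k :=
      (Nat.pow_le_pow_left (by omega) k).trans (Nat.pow_sub_le_descFactorial n k)
    exact_mod_cast h2
  have h3 : (2 * (k : ℝ) ^ 2) ≤ n := by exact_mod_cast h
  have h4 : 1 + (k : ℝ) * (-(k / n)) ≤ (1 + -(k / n : ℝ)) ^ k := by
    refine one_add_mul_le_pow ?_ k
    have : (k : ℝ) / n ≤ 1 := by rw [div_le_one hn0]; exact_mod_cast hkn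
    linarith
  have h5 : (1 : ℝ) / 2 ≤ 1 + (k : ℝ) * (-(k / n)) := by
    have : (k : ℝ) * (k / n) ≤ 1 / 2 := by
      rw [mul_div_assoc', div_le_iff₀ hn0]
      nlinarith
    linarith
  have h6 : ((n - k : ℕ) : ℝ) ^ k = (n : ℝ) ^ k * (1 + -(k / n : ℝ)) ^ k := by
    rw [← mul_pow, Nat.cast_sub hkn]
    congr 1
    field_simp
    ring
  have h7 : (n : ℝ) ^ k * (1 / 2) ≤ (n : ℝ) ^ k * (1 + -(k / n : ℝ)) ^ k := by
    gcongr
    exact h5.trans h4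
  linarith

theorem maxInducedDensity_nonneg (k ℓ n : ℕ) : 0 ≤ maxInducedDensity k ℓ n :=
  Real.iSup_nonneg fun _ => by positivity

theorem le_maxInducedDensity {n : ℕ} (k ℓ : ℕ) (G : SimpleGraph (Fin n)) :
    (inducedCount G k ℓ : ℝ) / (n.choose k : ℝ) ≤ maxInducedDensity k ℓ n :=
  le_ciSup (f := fun G : SimpleGraph (Fin n) => (inducedCount G k ℓ : ℝ) / (n.choose k : ℝ))
    (Set.finite_range _).bddAbove G

theorem maxInducedDensity_le {k ℓ n : ℕ} (hℓ : 0 < ℓ) (hk : ℓ < k.choose 2) (hn : 2 * k ^ 2 ≤ n)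
    (hn0 : 0 < n) :
    maxInducedDensity k ℓ n ≤ 2 * (10 ^ 35 / √(min (ℓ : ℝ) ((k.choose 2 : ℝ) - ℓ) / k)) := by
  refine ciSup_le fun G => ?_
  have : Nonempty (Fin n) := ⟨⟨0, hn0⟩⟩
  set B : ℝ := 10 ^ 35 / √(min (ℓ : ℝ) ((k.choose 2 : ℝ) - ℓ) / k) with hB
  have hB0 : 0 ≤ B := by positivity
  have hsymm : ∀ x y, adjKernel G x y = adjKernel G y x := fun x y => by
    classical
    unfold adjKernel
    exact if_congr (G.adj_comm x y) rfl rfl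
  have h01 : ∀ x y, adjKernel G x y = 0 ∨ adjKernel G x y = 1 := fun x y => by
    unfold adjKernel; split_ifs <;> simp
  have h1 := inducedCount_mul_factorial_le G k ℓ
  have h2 := uniformProb_pairSum_eq_le_min hsymm h01 hℓ hk
  have h3 := pow_le_two_mul_descFactorial hn hn0
  have hkn : k ≤ n := by nlinarith
  have hch : (0 : ℝ) < n.choose k := by exact_mod_cast Nat.choose_pos hkn
  have hf : (0 : ℝ) < k.factorial := by exact_mod_cast k.factorial_pos
  have hd : (n.descFactorial k : ℝ) = k.factorial * n.choose k := by
    exact_mod_cast Nat.descFactorial_eq_factorial_mul_choose n k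
  rw [div_le_iff₀ hch]
  have h4 : (inducedCount G k ℓ : ℝ) * k.factorial ≤ 2 * (k.factorial * n.choose k) * B := by
    rw [← hd]
    exact h1.trans (mul_le_mul h3 h2 (uniformProb_nonneg _) (by positivity))
  refine le_of_mul_le_mul_right ?_ hf
  linarith

theorem ncard_edgeSet_induce_comap {V V' : Type} [DecidableEq V'] (G : SimpleGraph V')
    (f : V ↪ V') (s : Finset V) :
    ((G.comap f).induce (s : Set V)).edgeSet.ncard =
      (G.induce ((s.map f : Finset V') : Set V')).edgeSet.ncard := by
  let e : (s : Set V) ≃ ((s.map f : Finset V') : Set V') :=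
    (Equiv.Set.image f (s : Set V) f.injective).trans (Equiv.setCongr (by simp))
  let g : (G.comap f).induce (s : Set V) ≃g G.induce ((s.map f : Finset V') : Set V') :=
    { toEquiv := e
      map_rel_iff' := Iff.rfl }
  exact Nat.card_congr g.mapEdgeSet

theorem inducedCount_comap {V V' : Type} [Fintype V] [Fintype V'] [DecidableEq V']
    (G : SimpleGraph V') (f : V ↪ V') (k ℓ : ℕ) :
    inducedCount (G.comap f) k ℓ =
      (((Finset.powersetCard k (Finset.univ : Finset V')).filter
        (fun s : Finset V' => (G.induce (s : Set V')).edgeSet.ncard = ℓ)).filter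
          fun s => s ⊆ Finset.univ.map f).card := by
  classical
  unfold inducedCount
  refine Finset.card_bij (fun s _ => s.map f) (fun s hs => ?_) (fun s _ s' _ h => ?_)
    fun t ht => ?_
  · simp only [Finset.mem_filter, Finset.mem_powersetCard, Finset.subset_univ, true_and,
      Finset.card_map] at hs ⊢
    rw [← ncard_edgeSet_induce_comap]
    exact ⟨hs, Finset.map_subset_map.2 (Finset.subset_univ s)⟩
  · exact Finset.map_injective f h
  · obtain ⟨h1, h2⟩ := Finset.mem_filter.1 ht
    obtain ⟨s, -, rfl⟩ := Finset.subset_map_iff.1 h2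
    refine ⟨s, ?_, rfl⟩
    simp only [Finset.mem_filter, Finset.mem_powersetCard, Finset.subset_univ, true_and,
      Finset.card_map] at h1 ⊢
    rw [ncard_edgeSet_induce_comap]
    exact h1

/-- Averaging over the deletion of a vertex. -/
theorem maxInducedDensity_succ_le {k ℓ n : ℕ} (hkn : k ≤ n) :
    maxInducedDensity k ℓ (n + 1) ≤ maxInducedDensity k ℓ n := by
  classical
  refine ciSup_le fun G => ?_
  set 𝒮 := (Finset.powersetCard k (Finset.univ : Finset (Fin (n + 1)))).filter
    (fun s : Finset (Fin (n + 1)) => (G.induce (s : Set (Fin (n + 1)))).edgeSet.ncard = ℓ) with h𝒮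
  have hcount : inducedCount G k ℓ = 𝒮.card := by
    unfold inducedCount
    congr!
  have hdel : ∀ v : Fin (n + 1), inducedCount (G.comap (Fin.succAboveEmb v)) k ℓ =
      (𝒮.filter fun s => v ∉ s).card := by
    intro v
    rw [inducedCount_comap]
    congr 1
    ext s
    simp only [Finset.mem_filter, h𝒮]
    refine and_congr (by simp) ?_
    constructor
    · intro hs hv
      obtain ⟨x, -, hx⟩ := Finset.mem_map.1 (hs hv)
      exact Fin.succAbove_ne v x hx
    · intro hv x hx
      have hne : x ≠ v := fun h => hv (h ▸ hx)
      obtain ⟨y, hy⟩ := Fin.exists_succAbove_eq hne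
      exact Finset.mem_map.2 ⟨y, Finset.mem_univ y, hy⟩
  have hsum : ∑ v : Fin (n + 1), (𝒮.filter fun s => v ∉ s).card = 𝒮.card * (n + 1 - k) := by
    simp only [Finset.card_filter]
    rw [Finset.sum_comm]
    refine Finset.sum_const_nat fun s hs => ?_
    rw [← Finset.card_filter, Finset.filter_not, Finset.filter_mem_eq_inter, Finset.univ_inter,
      ← Finset.compl_eq_univ_sdiff, Finset.card_compl, Fintype.card_fin,
      (Finset.mem_powersetCard.1 (Finset.mem_filter.1 hs).1).2]
  have hch : (0 : ℝ) < n.choose k := by exact_mod_cast Nat.choose_pos hkn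
  have hch' : (0 : ℝ) < (n + 1).choose k := by exact_mod_cast Nat.choose_pos (by omega)
  set M := maxInducedDensity k ℓ n with hM
  have hle : (𝒮.card : ℝ) * (n + 1 - k : ℕ) ≤ (n + 1) * (M * n.choose k) := by
    rw [← Nat.cast_mul, ← hsum]
    push_cast
    have h1 : ∀ v ∈ (Finset.univ : Finset (Fin (n + 1))),
        ((𝒮.filter fun s => v ∉ s).card : ℝ) ≤ M * n.choose k := by
      intro v _
      rw [← hdel, ← div_le_iff₀ hch]
      exact le_maxInducedDensity k ℓ _
    refine (Finset.sum_le_card_nsmul _ _ _ h1).trans_eq ?_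
    rw [nsmul_eq_mul, Finset.card_univ, Fintype.card_fin]
    push_cast
    ring
  have hid : (n.choose k : ℝ) * (n + 1) = (n + 1).choose k * (n + 1 - k : ℕ) := by
    exact_mod_cast Nat.choose_mul_succ_eq n k
  have hpos : (0 : ℝ) < (n + 1 - k : ℕ) := by
    have : 0 < n + 1 - k := by omega
    exact_mod_cast this
  rw [hcount, div_le_iff₀ hch']
  refine le_of_mul_le_mul_right ?_ hpos
  calc _ ≤ (n + 1) * (M * n.choose k) := hle
    _ = M * (n.choose k * (n + 1)) := by ring
    _ = _ := by rw [hid]; ring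

theorem tendsto_maxInducedDensity (k ℓ : ℕ) :
    Tendsto (fun n : ℕ => maxInducedDensity k ℓ n) atTop (𝓝 (edgeInducibility k ℓ)) := by
  refine tendsto_nhds_limUnder ?_
  -- The shift by k is needed because the density takes the default value 0 for n < k.
  have hanti : Antitone fun n => maxInducedDensity k ℓ (n + k) := antitone_nat_of_succ_le fun n => by
    have := maxInducedDensity_succ_le (ℓ := ℓ) (show k ≤ n + k by omega)
    rwa [show n + 1 + k = n + k + 1 by omega]
  exact ⟨_, (tendsto_add_atTop_iff_nat k).1 (tendsto_atTop_ciInf hanti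
    ⟨0, by rintro _ ⟨n, rfl⟩; exact maxInducedDensity_nonneg k ℓ _⟩)⟩

end Graphs

theorem theorem1p3 :
    ∃ C : ℝ, 0 < C ∧ ∀ k ℓ : ℕ, 0 < ℓ → ℓ < k.choose 2 →
      Tendsto (fun n : ℕ => maxInducedDensity k ℓ n) atTop (𝓝 (edgeInducibility k ℓ)) ∧
      edgeInducibility k ℓ ≤
        C * (1 / √(min (ℓ : ℝ) ((k.choose 2 : ℝ) - (ℓ : ℝ)) / (k : ℝ))) := by
  refine ⟨2 * 10 ^ 35, by positivity, fun k ℓ hℓ hk => ⟨tendsto_maxInducedDensity k ℓ, ?_⟩⟩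
  refine le_of_tendsto (tendsto_maxInducedDensity k ℓ) ?_
  filter_upwards [eventually_ge_atTop (2 * k ^ 2), eventually_gt_atTop 0] with n hn hn0
  refine (maxInducedDensity_le hℓ hk hn hn0).trans_eq ?_
  ring
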